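/- **Setting.** Let $\mathcal X$ be a separable metric space and let $(\mathcal Y,\rho)$ be a separable metric space with at least two points, both with their Borel $\sigma$-algebras. Let $\alpha\ge 1$ and $\ell=\rho^\alpha$. *Learning rules.* An online learning rule is a sequence $f_\cdot=(f_t,R_t)_{t\ge1}$ of measurable functions $f_t:\mathcal R\times\mathcal X^{t-1}\times\mathcal Y^{t-1}\times\mathcal X\to\mathcal Y$ and probability distributions $R_t$ on a measurable space $\mathcal R$. At step $t$ it predicts $\hat Y_t=f_t(r_t;X_{<t},Y_{<t},X_t)$ with fresh private randomness $r_t\sim R_t$. *Adversarial responses.* An adversarial process against $f_\cdot$ consists of random variables $(X_t,Y_t,r_t)_{t\ge1}$ on a common probability space such that, for every $t$, $r_t\sim R_t$ is independent of $\big((X_s)_{s\ge1},(Y_s)_{s\le t},(r_s)_{s<t}\big)$. Thus $Y_t$ may depend on the past randomness $r_1,\dots,r_{t-1}$, on $(X_s)_{s\geq 1}$, on past responses and on additional randomness. *Empirical integrability.* $(Y_t)_{t\ge1}$ is empirically integrable if there is $y_0\in\mathcal Y$ such that for every $\epsilon>0$, almost surely there is $M\ge0$ with $\limsup_{T\to\infty}\frac1T\sum_{t=1}^T\ell(y_0,Y_t)\mathbf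 1_{\ell(y_0,Y_t)\ge M}\le\epsilon$. *Consistency.* $f_\cdot$ is universally consistent under a stochastic process $\mathbb X$ on $\mathcal X$ (for empirically integrable adversarial responses) if, for every adversarial process $(\tilde X_t,Y_t,r_t)_{t\ge1}$ against $f_\cdot$ in which $(\tilde X_t)_t$ has the law of $\mathbb X$ and $(Y_t)_t$ is empirically integrable, and for every measurable $f:\mathcal X\to\mathcal Y$, $$\limsup_{T\to\infty}\frac1T\sum_{t=1}^T\big(\ell(\hat Y_t,Y_t)-\ell(f(\tilde X_t),Y_t)\big)\le0\quad\text{almost surely}.$$ SOLAR is the set of processes $\mathbb X$ under which some learning rule (possibly depending on $\mathbb X$) is universally consistent. A learning rule is optimistically universal if it is universally consistent under every $\mathbb X\in\mathrm{SOLAR}$. *SMV.* $\mathbb X\in\mathrm{SMV}$ if for every countable measurable partition $(A_k)_{k\ge1}$ of $\mathcal X$, almost surely $|\{k: A_k\cap\{X_1,\dots,X_T\}\ne\emptyset\}|=o(T)$. *F-TiME.* A subset $B\subseteq\mathcal Y$ (with the loss $\ell$) satisfies F-TiME if for every $\eta>0$ there are $T\ge1$ and an online learning rule $g_1,\dots,g_T$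 without covariates and with values in $B$ such that for all $y_1,\dots,y_T\in B$ and all $y\in B$, $$\frac1T\,\mathbb E\Big[\sum_{t=1}^{T}\big(\ell(g_t(y_{<t}),y_t)-\ell(y,y_t)\big)\Big]\le\eta,$$ where the expectation is over the private randomness of $g$. **Theorem.** Suppose that every ball $B_\ell(y,r)=\{z\in\mathcal Y:\ell(y,z)<r\}$, $y\in\mathcal Y$, $r>0$, satisfies F-TiME. Then $\mathrm{SOLAR}=\mathrm{SMV}$, and there is an optimistically universal learning rule $f_\cdot$; that is, a single rule $f_\cdot$ is universally consistent, for empirically integrable adversarial responses, under every $\mathbb X\in\mathrm{SMV}$. -/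

import Mathlib

open MeasureTheory ProbabilityTheory Filter Topology

noncomputable section

namespace AdvRegression

universe u v

/-- The loss `ℓ = ρ ^ α`, a power of the metric of the value space. -/
def loss {𝓨 : Type v} [MetricSpace 𝓨] (α : ℝ) (y z : 𝓨) : ℝ := dist y z ^ α

/-- The ball `B_ℓ(y, r)`; as a subtype it is a value space of its own. -/
def lossBall {𝓨 : Type v} [MetricSpace 𝓨] (α : ℝ) (y : 𝓨) (r : ℝ) : Set 𝓨 :=
  {z | loss α y z < r}

/-- A (possibly randomized) online learning rule with instances in `𝓧` and values in `𝓨`.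
Time starts at `0`, so that step `t` has a history of length `t`: `predict t` receives the private
randomness of step `t` (drawn from `law t`), the `t` past instances, the `t` past values and the new
instance. -/
structure OnlineRule (𝓧 : Type u) (𝓨 : Type v) [MeasurableSpace 𝓧] [MeasurableSpace 𝓨] where
  R : Type
  [measurableSpaceR : MeasurableSpace R]
  law : ℕ → Measure R
  [isProbabilityMeasure_law : ∀ t, IsProbabilityMeasure (law t)]
  predict : ∀ t : ℕ, R × (Fin t → 𝓧) × (Fin t → 𝓨) × 𝓧 → 𝓨
  measurable_predict : ∀ t, Measurable (predict t)

attribute [instance] OnlineRule.measurableSpaceR OnlineRule.isProbabilityMeasure_law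

/-- The prediction at step `t` with private randomness `r`, along the instances `x` and the
values `y` (only `x s` for `s ≤ t` and `y s` for `s < t` are used). -/
def OnlineRule.prediction {𝓧 : Type u} {𝓨 : Type v} [MeasurableSpace 𝓧] [MeasurableSpace 𝓨]
    (f : OnlineRule 𝓧 𝓨) (t : ℕ) (r : f.R) (x : ℕ → 𝓧) (y : ℕ → 𝓨) : 𝓨 :=
  f.predict t (r, fun s => x s, fun s => y s, x t)

/-- Property F-TiME (finite-time mean estimation) of the value space `(𝓨, ρ ^ α)`. The rule `g`
solves the prediction problem without covariates, i.e. with a one-point instance space. The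
expectation is over independent draws `r t ∼ g.law t`; only the first `T` steps of `g` and the first
`T` values of `y` matter. -/
def FTiME (𝓨 : Type v) [MetricSpace 𝓨] [MeasurableSpace 𝓨] (α : ℝ) : Prop :=
  ∀ η : ℝ, 0 < η → ∃ T : ℕ, 1 ≤ T ∧ ∃ g : OnlineRule Unit 𝓨, ∀ (y : ℕ → 𝓨) (z : 𝓨),
    Integrable (fun r : ℕ → g.R => ∑ t ∈ Finset.range T,
      (loss α (g.prediction t (r t) (fun _ => ()) y) (y t) - loss α z (y t)))
      (Measure.infinitePi g.law) ∧
    (1 / (T : ℝ)) * ∫ r : ℕ → g.R, ∑ t ∈ Finset.range T,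
      (loss α (g.prediction t (r t) (fun _ => ()) y) (y t) - loss α z (y t))
      ∂(Measure.infinitePi g.law) ≤ η

/-- `(Y t)` is empirically integrable. The upper limit is taken in the extended reals. -/
def EmpiricallyIntegrable {Ω : Type*} [MeasurableSpace Ω] {𝓨 : Type v} [MetricSpace 𝓨]
    (α : ℝ) (P : Measure Ω) (Y : ℕ → Ω → 𝓨) : Prop :=
  ∃ y₀ : 𝓨, ∀ ε : ℝ, 0 < ε → ∀ᵐ ω ∂P, ∃ M : ℝ, 0 ≤ M ∧
    limsup (fun T : ℕ => (((1 / (T : ℝ)) * ∑ t ∈ Finset.range T,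
      Set.indicator {z | M ≤ loss α y₀ z} (loss α y₀) (Y t ω) : ℝ) : EReal)) atTop ≤ (ε : EReal)

/-- `X, Y` are the instances and the responses of an adversary playing against the rule `f`, and
`r` is the private randomness of `f`, all realised on the probability space `(Ω, P)`. The draw `r t`
has law `f.law t` and is independent of the whole instance process, of the responses up to and
including step `t`, and of the earlier draws. So `Y t` may depend in any manner on the
instances, on the past values, on further randomness, and on the past draws `r 0, …, r (t - 1)`. -/
structure IsAdversarialProcess {𝓧 : Type u} {𝓨 : Type v} [MeasurableSpace 𝓧] [MeasurableSpace 𝓨]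
    (f : OnlineRule 𝓧 𝓨) {Ω : Type*} [MeasurableSpace Ω] (P : Measure Ω)
    (X : ℕ → Ω → 𝓧) (Y : ℕ → Ω → 𝓨) (r : ℕ → Ω → f.R) : Prop where
  measurable_X : ∀ t, Measurable (X t)
  measurable_Y : ∀ t, Measurable (Y t)
  measurable_r : ∀ t, Measurable (r t)
  map_r : ∀ t, P.map (r t) = f.law t
  indep_r : ∀ t, IndepFun (r t)
    (fun ω => ((fun s : ℕ => X s ω), (fun s : Fin (t + 1) => Y s ω), (fun s : Fin t => r s ω))) P

/-- The long-run average excess loss of the rule `f` with respect to the function `h`, along a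
realisation of the instances, the values and the private randomness; it lies in `[-∞, ∞]`. -/
def excessLoss {𝓧 : Type u} {𝓨 : Type v} [MeasurableSpace 𝓧] [MetricSpace 𝓨] [MeasurableSpace 𝓨]
    (α : ℝ) (f : OnlineRule 𝓧 𝓨) (h : 𝓧 → 𝓨) (x : ℕ → 𝓧) (y : ℕ → 𝓨) (r : ℕ → f.R) : EReal :=
  limsup (fun T : ℕ => (((1 / (T : ℝ)) * ∑ t ∈ Finset.range T,
    (loss α (f.prediction t (r t) x y) (y t) - loss α (h (x t)) (y t)) : ℝ) : EReal)) atTop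

/-- `f` is consistent: for every measurable `h`, almost surely, the excess loss is at most `0`. -/
def IsConsistent {𝓧 : Type u} {𝓨 : Type v} [MeasurableSpace 𝓧] [MetricSpace 𝓨] [MeasurableSpace 𝓨]
    (α : ℝ) (f : OnlineRule 𝓧 𝓨) {Ω : Type*} [MeasurableSpace Ω] (P : Measure Ω)
    (X : ℕ → Ω → 𝓧) (Y : ℕ → Ω → 𝓨) (r : ℕ → Ω → f.R) : Prop :=
  ∀ h : 𝓧 → 𝓨, Measurable h →
    ∀ᵐ ω ∂P, excessLoss α f h (fun t => X t ω) (fun t => Y t ω) (fun t => r t ω) ≤ 0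

/-- `f` is universally consistent, for empirically integrable adversarial responses, under an
instance process with law `μ`. The universe of `Ω` is that of the space of trajectories of
`(X, Y, r)`, so every joint law of such processes is covered. -/
def IsUniversallyConsistent {𝓧 : Type u} {𝓨 : Type v} [MeasurableSpace 𝓧] [MetricSpace 𝓨]
    [MeasurableSpace 𝓨] (α : ℝ) (f : OnlineRule 𝓧 𝓨) (μ : ProbabilityMeasure (ℕ → 𝓧)) : Prop :=
  ∀ (Ω : Type (max u v)) [MeasurableSpace Ω] (P : Measure Ω) [IsProbabilityMeasure P]
    (X : ℕ → Ω → 𝓧) (Y : ℕ → Ω → 𝓨) (r : ℕ → Ω → f.R),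
    IsAdversarialProcess f P X Y r → P.map (fun ω t => X t ω) = (μ : Measure (ℕ → 𝓧)) →
    EmpiricallyIntegrable α P Y → IsConsistent α f P X Y r

/-- The processes on `𝓧`, given by their laws on the space of trajectories, for which some learning
rule (which may depend on the process) is universally consistent. -/
def SOLAR (𝓧 : Type u) (𝓨 : Type v) [MeasurableSpace 𝓧] [MetricSpace 𝓨] [MeasurableSpace 𝓨]
    (α : ℝ) : Set (ProbabilityMeasure (ℕ → 𝓧)) :=
  {μ | ∃ f : OnlineRule 𝓧 𝓨, IsUniversallyConsistent α f μ}

/-- Sublinear measurable visits: for every countable measurable partition, almost surely, the number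
of cells visited before time `T` is `o(T)`. -/
def SMV (𝓧 : Type u) [MeasurableSpace 𝓧] : Set (ProbabilityMeasure (ℕ → 𝓧)) :=
  {μ | ∀ A : ℕ → Set 𝓧, (∀ k, MeasurableSet (A k)) → Pairwise (fun i j => Disjoint (A i) (A j)) →
    (⋃ k, A k) = Set.univ →
    ∀ᵐ x ∂(μ : Measure (ℕ → 𝓧)),
      (fun T : ℕ => (Set.ncard {k : ℕ | ∃ t < T, x t ∈ A k} : ℝ)) =o[atTop] fun T : ℕ => (T : ℝ)}

/-- `f` is optimistically universal for adversarial regression with empirically integrable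
responses. -/
def IsOptimisticallyUniversal {𝓧 : Type u} {𝓨 : Type v} [MeasurableSpace 𝓧] [MetricSpace 𝓨]
    [MeasurableSpace 𝓨] (α : ℝ) (f : OnlineRule 𝓧 𝓨) : Prop :=
  ∀ μ ∈ SOLAR 𝓧 𝓨 α, IsUniversallyConsistent α f μ

end AdvRegression

end

open AdvRegression

namespace AdvRegression

/-! Necessity of SMV. Attach independent fair coins to the cells of a partition and let the response
be one of two fixed points, according to the coin of the visited cell. For each outcome of the coins
this is a noiseless problem, so a consistent rule has vanishing average loss. At the first visit to
a cell, however, its coin has not influenced the past, and every prediction is far from at least one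
of the two points. Hence first visits have density zero (`isLittleO_visited`, `SOLAR_subset_SMV`).

Sufficiency. The rule must not know the process, so the experts are bare labelings of time by three
symbols. A labeling and the instances seen so far determine causally a division of time into
clusters. For a fixed measurable `κ : X → ℕ`, SMV yields, along almost every trajectory, a labeling
with only `o(T)` nonzero labels on whose clusters `κ` is constant (`exists_goodExpert`). This is the
only use of SMV: a countable-valued map is approximated by functions of finitely many code bits, and
the points where the approximations fail are told apart by a countable partition.

On one ball, the F-TiME rule is run in blocks on each cluster (`exists_block_rule`). Complete blocks
have small regret and incomplete ones cost a constant per cluster (`sum_block_regret_le`).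
Exponential weights over all labelings, with a product prior that makes the label `0` almost free,
lose only a small multiple of `T` against a labeling with `o(T)` nonzero labels, although there are
uncountably many labelings (`exists_ball_strategy`). A second layer of exponential weights combines
balls of radius `n + 1` and accuracy `1 / (n + 1)` (`exists_strategy_le_seq`). To make this
possible, losses are clipped at a slowly growing horizon; empirical integrability controls what
clipping and truncation discard (`loss_sub_loss_le`, `exists_sum_tailLoss_le`).

All of this concerns mean losses along a fixed sequence. Against an adversary who sees past draws,
realized clipped losses differ from conditional means by uncorrelated terms, whose averages vanish
almost surely (`ae_tendsto_deviation`). -/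

/-! ### A strong law for orthogonal variables of slow growth -/

theorem integral_sq_sum_le_of_orthogonal {Ω : Type*} [MeasurableSpace Ω] (P : Measure Ω)
    [IsProbabilityMeasure P] (D : ℕ → Ω → ℝ) (hm : ∀ t, Measurable (D t)) (b : ℕ → ℝ)
    (hb : ∀ t ω, |D t ω| ≤ b t) (horth : ∀ s t, s < t → ∫ ω, D s ω * D t ω ∂P = 0) (T : ℕ) :
    ∫ ω, (∑ t ∈ Finset.range T, D t ω) ^ 2 ∂P ≤ ∑ t ∈ Finset.range T, b t ^ 2 := by
  have hint : ∀ s t, Integrable (fun ω => D s ω * D t ω) P := fun s t =>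
    Integrable.of_bound ((hm s).mul (hm t)).aestronglyMeasurable (b s * b t)
      (Eventually.of_forall fun ω => by
        rw [Real.norm_eq_abs, abs_mul]
        exact mul_le_mul (hb s ω) (hb t ω) (abs_nonneg _) ((abs_nonneg _).trans (hb s ω)))
  have horth' : ∀ s t, s ≠ t → ∫ ω, D s ω * D t ω ∂P = 0 := by
    intro s t hst
    rcases lt_or_gt_of_ne hst with h | h
    · exact horth s t h
    · simpa only [mul_comm] using horth t s h
  have e1 : ∀ ω, (∑ t ∈ Finset.range T, D t ω) ^ 2
      = ∑ s ∈ Finset.range T, ∑ t ∈ Finset.range T, D s ω * D t ω := by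
    intro ω
    rw [sq, Finset.sum_mul_sum]
  simp_rw [e1]
  rw [integral_finsetSum _ fun s _ => integrable_finsetSum _ fun t _ => hint s t]
  refine Finset.sum_le_sum fun s hs => ?_
  rw [integral_finsetSum _ fun t _ => hint s t]
  rw [Finset.sum_eq_single s (fun t _ hts => horth' s t hts.symm) (fun h => absurd hs h)]
  calc ∫ ω, D s ω * D s ω ∂P ≤ ∫ _, b s ^ 2 ∂P := by
        refine integral_mono (hint s s) (integrable_const _) fun ω => ?_
        have := hb s ω
        nlinarith [abs_mul_abs_self (D s ω), abs_nonneg (D s ω)]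
    _ = b s ^ 2 := by simp

/-- Along the squares `T = k ^ 2` the averages have second moment `O(k ^ (-3/2))`, which is
summable, so they converge almost surely. Between consecutive squares there are at most `2 * k`
terms, which contribute `O(T ^ (5/8))`. -/
theorem tendsto_average_of_orthogonal {Ω : Type*} [MeasurableSpace Ω] (P : Measure Ω)
    [IsProbabilityMeasure P] (D : ℕ → Ω → ℝ) (hm : ∀ t, Measurable (D t)) (C : ℝ)
    (hb : ∀ t ω, |D t ω| ≤ C * ((t : ℝ) + 1) ^ (1 / 8 : ℝ))
    (horth : ∀ s t, s < t → ∫ ω, D s ω * D t ω ∂P = 0) :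
    ∀ᵐ ω ∂P, Tendsto (fun T : ℕ => (1 / (T : ℝ)) * ∑ t ∈ Finset.range T, D t ω) atTop (𝓝 0) := by
  have hC : 0 ≤ C := by
    obtain ⟨ω⟩ : Nonempty Ω := nonempty_of_isProbabilityMeasure P
    have := (abs_nonneg _).trans (hb 0 ω)
    simpa using this
  set S : ℕ → Ω → ℝ := fun T ω => ∑ t ∈ Finset.range T, D t ω with hS
  have hSm : ∀ T, Measurable (S T) := fun T => Finset.measurable_sum _ fun t _ => hm t
  have hbT : ∀ T t : ℕ, t < T → ((t : ℝ) + 1) ^ (1 / 8 : ℝ) ≤ (T : ℝ) ^ (1 / 8 : ℝ) := by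
    intro T t h
    refine Real.rpow_le_rpow (by positivity) ?_ (by norm_num)
    exact_mod_cast h
  have hL2 : ∀ k : ℕ, ∫ ω, (S (k ^ 2) ω / (k : ℝ) ^ 2) ^ 2 ∂P
      ≤ C ^ 2 * (1 / (k : ℝ) ^ (3 / 2 : ℝ)) := by
    intro k
    rcases Nat.eq_zero_or_pos k with rfl | hk
    · simp [hS]
    have hk' : (0 : ℝ) < k := by exact_mod_cast hk
    have h1 := integral_sq_sum_le_of_orthogonal P D hm _ hb horth (k ^ 2)
    have h2 : ∑ t ∈ Finset.range (k ^ 2), (C * ((t : ℝ) + 1) ^ (1 / 8 : ℝ)) ^ 2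
        ≤ (k : ℝ) ^ 2 * (C ^ 2 * (k : ℝ) ^ (1 / 2 : ℝ)) := by
      have : ∀ t ∈ Finset.range (k ^ 2), (C * ((t : ℝ) + 1) ^ (1 / 8 : ℝ)) ^ 2
          ≤ C ^ 2 * (k : ℝ) ^ (1 / 2 : ℝ) := by
        intro t ht
        have h3 := hbT (k ^ 2) t (Finset.mem_range.1 ht)
        have h4 : ((k ^ 2 : ℕ) : ℝ) ^ (1 / 8 : ℝ) ^ 1 = (k : ℝ) ^ (1 / 4 : ℝ) := by
          push_cast
          rw [← Real.rpow_natCast, ← Real.rpow_mul hk'.le]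
          norm_num
        rw [pow_one] at h4
        rw [h4] at h3
        have h5 : ((k : ℝ) ^ (1 / 4 : ℝ)) ^ 2 = (k : ℝ) ^ (1 / 2 : ℝ) := by
          rw [← Real.rpow_natCast, ← Real.rpow_mul hk'.le]
          norm_num
        rw [mul_pow, ← h5]
        gcongr
      refine (Finset.sum_le_sum this).trans ?_
      simp
    have h6 : ∫ ω, (S (k ^ 2) ω / (k : ℝ) ^ 2) ^ 2 ∂P
        = (∫ ω, (S (k ^ 2) ω) ^ 2 ∂P) / (k : ℝ) ^ 4 := by
      rw [← integral_div]
      congr 1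
      ext ω
      rw [div_pow]
      ring
    rw [h6, div_le_iff₀ (by positivity)]
    refine (h1.trans h2).trans (le_of_eq ?_)
    have h7 : (k : ℝ) ^ (1 / 2 : ℝ) * (k : ℝ) ^ (3 / 2 : ℝ) = (k : ℝ) ^ 2 := by
      rw [← Real.rpow_add hk']
      norm_num
    have h8 : (0 : ℝ) < (k : ℝ) ^ (3 / 2 : ℝ) := by positivity
    field_simp
    nlinarith [h7]
  have hsub : ∀ᵐ ω ∂P, Tendsto (fun k : ℕ => S (k ^ 2) ω / (k : ℝ) ^ 2) atTop (𝓝 0) := by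
    -- A series of squares with finite expectation converges almost surely, so its terms tend to
    -- zero.
    have hfin : ∫⁻ ω, ∑' k : ℕ, ENNReal.ofReal ((S (k ^ 2) ω / (k : ℝ) ^ 2) ^ 2) ∂P ≠ ⊤ := by
      rw [lintegral_tsum fun k =>
        (((hSm _).div_const _).pow_const _).ennreal_ofReal.aemeasurable]
      have hsum : Summable fun k : ℕ => C ^ 2 * (1 / (k : ℝ) ^ (3 / 2 : ℝ)) :=
        (Real.summable_one_div_nat_rpow.2 (by norm_num)).mul_left _
      refine ne_top_of_le_ne_top hsum.tsum_ofReal_ne_top (ENNReal.tsum_le_tsum fun k => ?_)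
      rw [← ofReal_integral_eq_lintegral_ofReal]
      · exact ENNReal.ofReal_le_ofReal (hL2 k)
      · refine Integrable.of_bound (((hSm _).div_const _).pow_const _).aestronglyMeasurable
          (((∑ t ∈ Finset.range (k ^ 2), C * ((t : ℝ) + 1) ^ (1 / 8 : ℝ)) / (k : ℝ) ^ 2) ^ 2)
          (Eventually.of_forall fun ω => ?_)
        rw [Real.norm_eq_abs, abs_pow, abs_div, abs_of_nonneg (sq_nonneg (k : ℝ))]
        gcongr
        exact (Finset.abs_sum_le_sum_abs _ _).trans (Finset.sum_le_sum fun t _ => hb t ω)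
      · exact Eventually.of_forall fun ω => sq_nonneg _
    filter_upwards [ae_lt_top (Measurable.tsum fun k =>
        (((hSm _).div_const _).pow_const _).ennreal_ofReal) hfin] with ω hω
    have h1 := ENNReal.tendsto_atTop_zero_of_tsum_ne_top hω.ne
    have h2 : Tendsto (fun k : ℕ => (S (k ^ 2) ω / (k : ℝ) ^ 2) ^ 2) atTop (𝓝 0) := by
      have := (ENNReal.tendsto_toReal (ENNReal.zero_ne_top)).comp h1
      simpa [Function.comp_def, ENNReal.toReal_ofReal (sq_nonneg _)] using this
    have h3 := h2.sqrt
    simp only [Real.sqrt_sq_eq_abs, Real.sqrt_zero] at h3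
    exact (tendsto_zero_iff_abs_tendsto_zero _).2 h3
  filter_upwards [hsub] with ω hω
  have hsqrt : Tendsto Nat.sqrt atTop atTop := by
    refine tendsto_atTop.2 fun n => ?_
    filter_upwards [eventually_ge_atTop (n * n)] with T hT
    exact Nat.le_sqrt.2 hT
  have hA := (hω.comp hsqrt).abs
  simp only [abs_zero] at hA
  have hB : Tendsto (fun T : ℕ => 2 * C * (T : ℝ) ^ (-(3 / 8) : ℝ)) atTop (𝓝 0) := by
    have := (tendsto_rpow_neg_atTop (show (0 : ℝ) < 3 / 8 by norm_num)).comp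
      (tendsto_natCast_atTop_atTop (R := ℝ))
    simpa using this.const_mul (2 * C)
  refine squeeze_zero_norm' ?_ (by simpa using hA.add hB)
  filter_upwards [eventually_ge_atTop 1] with T hT
  have hT' : (0 : ℝ) < T := by exact_mod_cast hT
  set k := Nat.sqrt T with hk
  have hk1 : 1 ≤ k := Nat.le_sqrt.2 (by simpa using hT)
  have hk' : (0 : ℝ) < k := by exact_mod_cast hk1
  have hkT : k ^ 2 ≤ T := Nat.sqrt_le' T
  have hTk : T ≤ k ^ 2 + 2 * k := by
    have := Nat.sqrt_le_add T
    rw [← hk] at this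
    nlinarith
  have hdiff : |S T ω - S (k ^ 2) ω| ≤ 2 * k * (C * (T : ℝ) ^ (1 / 8 : ℝ)) := by
    rw [hS]
    simp only
    rw [← Finset.sum_Ico_eq_sub _ hkT]
    refine (Finset.abs_sum_le_sum_abs _ _).trans ?_
    have : ∀ t ∈ Finset.Ico (k ^ 2) T, |D t ω| ≤ C * (T : ℝ) ^ (1 / 8 : ℝ) := fun t ht =>
      (hb t ω).trans (mul_le_mul_of_nonneg_left (hbT T t (Finset.mem_Ico.1 ht).2) hC)
    refine (Finset.sum_le_sum this).trans ?_
    rw [Finset.sum_const, Nat.card_Ico, nsmul_eq_mul]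
    gcongr
    have : T - k ^ 2 ≤ 2 * k := by omega
    exact_mod_cast this
  have hkk : (k : ℝ) ≤ (T : ℝ) ^ (1 / 2 : ℝ) := by
    rw [← Real.sqrt_eq_rpow]
    refine Real.le_sqrt_of_sq_le ?_
    exact_mod_cast hkT
  have hpow : (T : ℝ) ^ (1 / 2 : ℝ) * (T : ℝ) ^ (1 / 8 : ℝ) = (T : ℝ) ^ (-(3 / 8) : ℝ) * T := by
    rw [← Real.rpow_add hT']
    nth_rewrite 3 [← Real.rpow_one (T : ℝ)]
    rw [← Real.rpow_add hT']
    norm_num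
  have hfin : |S T ω| ≤ |S (k ^ 2) ω| + 2 * C * (T : ℝ) ^ (-(3 / 8) : ℝ) * T := by
    have h1 : |S T ω| ≤ |S (k ^ 2) ω| + |S T ω - S (k ^ 2) ω| := by
      have := abs_add_le (S (k ^ 2) ω) (S T ω - S (k ^ 2) ω)
      simpa using this
    have h2 : 2 * k * (C * (T : ℝ) ^ (1 / 8 : ℝ)) ≤ 2 * C * (T : ℝ) ^ (-(3 / 8) : ℝ) * T := by
      calc 2 * k * (C * (T : ℝ) ^ (1 / 8 : ℝ))
          ≤ 2 * (T : ℝ) ^ (1 / 2 : ℝ) * (C * (T : ℝ) ^ (1 / 8 : ℝ)) := by gcongr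
        _ = 2 * C * ((T : ℝ) ^ (1 / 2 : ℝ) * (T : ℝ) ^ (1 / 8 : ℝ)) := by ring
        _ = _ := by rw [hpow]; ring
    linarith
  have hk2 : |S (k ^ 2) ω| / T ≤ |S (k ^ 2) ω / (k : ℝ) ^ 2| := by
    rw [abs_div, abs_of_nonneg (sq_nonneg (k : ℝ))]
    gcongr
    exact_mod_cast hkT
  rw [norm_mul, Real.norm_eq_abs, Real.norm_eq_abs, abs_of_pos (by positivity : 0 < 1 / (T : ℝ))]
  calc 1 / (T : ℝ) * |∑ t ∈ Finset.range T, D t ω|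
      ≤ 1 / (T : ℝ) * (|S (k ^ 2) ω| + 2 * C * (T : ℝ) ^ (-(3 / 8) : ℝ) * T) := by gcongr
    _ = |S (k ^ 2) ω| / T + 2 * C * (T : ℝ) ^ (-(3 / 8) : ℝ) := by field_simp
    _ ≤ _ := by
      gcongr


/-! ### Approximation of countable-valued maps by finitely many code bits -/

section Coding

variable {X : Type*} [MeasurableSpace X] [MeasurableSpace.CountablyGenerated X]

/-- The first `m` bits of the code of a point. -/
noncomputable def codePrefix (m : ℕ) (x : X) : Fin m → Bool :=
  fun i => MeasurableSpace.mapNatBool X x i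

theorem measurable_codePrefix (m : ℕ) : Measurable (codePrefix (X := X) m) :=
  measurable_pi_lambda _ fun _ => (measurable_pi_apply _).comp (MeasurableSpace.measurable_mapNatBool X)

theorem codePrefix_eq_of_le {m n : ℕ} (h : m ≤ n) {x y : X}
    (hxy : codePrefix n x = codePrefix n y) : codePrefix m x = codePrefix m y := by
  ext i
  have := congrFun hxy (Fin.castLE h i)
  simpa [codePrefix] using this

theorem eq_of_forall_codePrefix_eq [MeasurableSpace.SeparatesPoints X] {x y : X}
    (h : ∀ m, codePrefix m x = codePrefix m y) : x = y := by
  refine MeasurableSpace.injective_mapNatBool (α := X) (funext fun n => ?_)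
  exact congrFun (h (n + 1)) (Fin.last n)

/-- The sets determined by finitely many bits form an algebra that generates the σ-algebra, hence
they are dense for a finite measure. -/
theorem exists_codePrefix_symmDiff_lt (ν : Measure X) [IsFiniteMeasure ν] {A : Set X}
    (hA : MeasurableSet A) {ε : ℝ} (hε : 0 < ε) :
    ∃ m, ∃ S : Set (Fin m → Bool), ν (symmDiff A (codePrefix m ⁻¹' S)) < ENNReal.ofReal ε := by
  let 𝒜 : Set (Set X) := {B | ∃ m, ∃ S : Set (Fin m → Bool), B = codePrefix m ⁻¹' S}
  have hlift : ∀ m n (S : Set (Fin m → Bool)), m ≤ n →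
      ∃ S' : Set (Fin n → Bool), (codePrefix m ⁻¹' S : Set X) = codePrefix n ⁻¹' S' := by
    intro m n S h
    exact ⟨(fun p i => p (Fin.castLE h i)) ⁻¹' S, rfl⟩
  have halg : IsSetAlgebra 𝒜 := by
    refine ⟨⟨0, ∅, rfl⟩, ?_, ?_⟩
    · rintro _ ⟨m, S, rfl⟩
      exact ⟨m, Sᶜ, rfl⟩
    · rintro _ _ ⟨m, S, rfl⟩ ⟨n, S', rfl⟩
      obtain ⟨U, hU⟩ := hlift m (max m n) S (le_max_left _ _)
      obtain ⟨V, hV⟩ := hlift n (max m n) S' (le_max_right _ _)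
      exact ⟨max m n, U ∪ V, by rw [hU, hV]; rfl⟩
  have hgen : ‹MeasurableSpace X› = MeasurableSpace.generateFrom 𝒜 := by
    refine le_antisymm ?_ (MeasurableSpace.generateFrom_le ?_)
    · conv_lhs => rw [← MeasurableSpace.generateFrom_natGeneratingSequence X]
      refine MeasurableSpace.generateFrom_mono ?_
      rintro _ ⟨n, rfl⟩
      refine ⟨n + 1, {p | p (Fin.last n) = true}, ?_⟩
      ext x
      simp [codePrefix, MeasurableSpace.mapNatBool]
    · rintro _ ⟨m, S, rfl⟩
      exact measurable_codePrefix m S.toFinite.measurableSet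
  have hd := Measure.MeasureDense.of_generateFrom_isSetAlgebra_finite (μ := ν) halg hgen
  obtain ⟨_, ⟨m, S, rfl⟩, h⟩ := hd.approx A hA (measure_ne_top _ _) ε hε
  exact ⟨m, S, h⟩

/-- Discard the points with `κ ≥ K`, a set of small measure, and approximate each of the remaining
`K` fibers. Off the errors exactly one approximating set contains a given prefix, and its index is
the value of `κ`. -/
theorem exists_codePrefix_factor_approx (ν : Measure X) [IsFiniteMeasure ν] {κ : X → ℕ}
    (hκ : Measurable κ) {ε : ENNReal} (hε : 0 < ε) :
    ∃ m, ∃ a : (Fin m → Bool) → ℕ, ν {x | a (codePrefix m x) ≠ κ x} ≤ ε := by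
  classical
  obtain ⟨δ, hδ, hδε⟩ : ∃ δ : ℝ, 0 < δ ∧ ENNReal.ofReal δ + ENNReal.ofReal δ ≤ ε := by
    rcases eq_or_ne ε ⊤ with rfl | h
    · exact ⟨1, one_pos, le_top⟩
    · refine ⟨ε.toReal / 2, half_pos (ENNReal.toReal_pos hε.ne' h), ?_⟩
      rw [← ENNReal.ofReal_add (by positivity) (by positivity), add_halves, ENNReal.ofReal_toReal h]
  obtain ⟨K, hK⟩ : ∃ K, ν {x | K ≤ κ x} < ENNReal.ofReal δ := by
    have h0 : Tendsto (fun K => ν {x | K ≤ κ x}) atTop (𝓝 (ν (⋂ K, {x | K ≤ κ x}))) :=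
      tendsto_measure_iInter_atTop
        (fun K => (hκ measurableSet_Ici).nullMeasurableSet)
        (fun i j hij x hx => le_trans hij hx) ⟨0, measure_ne_top _ _⟩
    have h1 : (⋂ K, {x | K ≤ κ x}) = ∅ := by
      ext x
      simp only [Set.mem_iInter, Set.mem_ofPred_eq, Set.mem_empty_iff_false, iff_false, not_forall]
      exact ⟨κ x + 1, by omega⟩
    rw [h1, measure_empty] at h0
    exact (h0.eventually_lt_const (ENNReal.ofReal_pos.2 hδ)).exists
  have hj : ∀ j, ∃ m, ∃ S : Set (Fin m → Bool),
      ν (symmDiff (κ ⁻¹' {j}) (codePrefix m ⁻¹' S)) < ENNReal.ofReal (δ / (K + 1)) := fun j =>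
    exists_codePrefix_symmDiff_lt ν (hκ (measurableSet_singleton j)) (by positivity)
  choose m S hS using hj
  let M := (Finset.range K).sup m
  have hM : ∀ j < K, m j ≤ M := fun j hj => Finset.le_sup (Finset.mem_range.2 hj)
  let good : (Fin M → Bool) → ℕ → Prop := fun p j =>
    ∃ h : j < K, (fun i : Fin (m j) => p (Fin.castLE (hM j h) i)) ∈ S j
  let a : (Fin M → Bool) → ℕ := fun p => if h : ∃ j, good p j then Nat.find h else 0
  refine ⟨M, a, ?_⟩
  have hsub : {x | a (codePrefix M x) ≠ κ x} ⊆ {x | K ≤ κ x} ∪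
      ⋃ j ∈ Finset.range K, symmDiff (κ ⁻¹' {j}) (codePrefix (m j) ⁻¹' S j) := by
    intro x hx
    by_contra hnot
    simp only [Set.mem_union, Set.mem_ofPred_eq, not_or, not_le, Set.mem_iUnion, not_exists] at hnot
    obtain ⟨hlt, hno⟩ := hnot
    have hgood : ∀ j, good (codePrefix M x) j ↔ j = κ x := by
      intro j
      have key : ∀ j < K, (codePrefix (m j) x ∈ S j ↔ κ x = j) := by
        intro j hj
        have := hno j (Finset.mem_range.2 hj)
        rw [Set.mem_symmDiff] at this
        simp only [Set.mem_preimage, Set.mem_singleton_iff] at this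
        tauto
      constructor
      · rintro ⟨h, h'⟩
        exact ((key j h).1 h').symm
      · rintro rfl
        exact ⟨hlt, (key _ hlt).2 rfl⟩
    have hex : ∃ j, good (codePrefix M x) j := ⟨κ x, (hgood _).2 rfl⟩
    apply hx
    simp only [a, dif_pos hex]
    exact (hgood _).1 (Nat.find_spec hex)
  calc ν {x | a (codePrefix M x) ≠ κ x}
      ≤ ν {x | K ≤ κ x} + ν (⋃ j ∈ Finset.range K,
          symmDiff (κ ⁻¹' {j}) (codePrefix (m j) ⁻¹' S j)) :=
        (measure_mono hsub).trans (measure_union_le _ _)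
    _ ≤ ENNReal.ofReal δ + ∑ j ∈ Finset.range K, ENNReal.ofReal (δ / (K + 1)) := by
        gcongr
        refine (measure_biUnion_finset_le _ _).trans (Finset.sum_le_sum fun j _ => (hS j).le)
    _ ≤ ENNReal.ofReal δ + ENNReal.ofReal δ := by
        gcongr
        rw [← ENNReal.ofReal_sum_of_nonneg fun _ _ => by positivity]
        apply ENNReal.ofReal_le_ofReal
        rw [Finset.sum_const, Finset.card_range, nsmul_eq_mul, mul_div_assoc', div_le_iff₀ (by positivity)]
        nlinarith
    _ ≤ ε := hδε

end Coding

section ProcessApprox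

variable {X : Type*} [MeasurableSpace X] [MeasurableSpace.CountablyGenerated X]

theorem exists_codePrefix_factor_process (μ : Measure (ℕ → X)) [IsProbabilityMeasure μ] {κ : X → ℕ}
    (hκ : Measurable κ) (T : ℕ) {ε : ENNReal} (hε : 0 < ε) :
    ∃ m, ∃ a : (Fin m → Bool) → ℕ, μ {x | ∃ t < T, a (codePrefix m (x t)) ≠ κ (x t)} ≤ ε := by
  -- The sum of the marginals turns a union bound over time into a statement about one measure.
  let ν : Measure X := ∑ t ∈ Finset.range T, μ.map (fun x => x t)
  obtain ⟨m, a, h⟩ := exists_codePrefix_factor_approx ν hκ hε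
  refine ⟨m, a, le_trans ?_ h⟩
  have hF : MeasurableSet {x : X | a (codePrefix m x) ≠ κ x} :=
    (measurableSet_eq_fun ((measurable_of_finite a).comp (measurable_codePrefix m)) hκ).compl
  have hsub : {x : ℕ → X | ∃ t < T, a (codePrefix m (x t)) ≠ κ (x t)} ⊆
      ⋃ t ∈ Finset.range T, (fun x : ℕ → X => x t) ⁻¹' {x | a (codePrefix m x) ≠ κ x} := by
    rintro x ⟨t, ht, hx⟩
    simp only [Set.mem_iUnion]
    exact ⟨t, Finset.mem_range.2 ht, hx⟩
  refine (measure_mono hsub).trans ((measure_biUnion_finset_le _ _).trans (le_of_eq ?_))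
  simp only [ν, Measure.finsetSum_apply]
  refine Finset.sum_congr rfl fun t _ => ?_
  rw [Measure.map_apply (measurable_pi_apply t) hF]

/-- The failure events decrease with `M`. Their intersection is empty, because the finitely many
pairs of distinct points are separated by a common number of bits. -/
theorem exists_codePrefix_separates [MeasurableSpace.SeparatesPoints X] (μ : Measure (ℕ → X))
    [IsProbabilityMeasure μ] (T : ℕ) {ε : ENNReal} (hε : 0 < ε) :
    ∃ M, μ {x | ∃ s < T, ∃ t < T, codePrefix M (x s) = codePrefix M (x t) ∧ x s ≠ x t} ≤ ε := by
  have hmeas : ∀ M s t, MeasurableSet {x : ℕ → X | codePrefix M (x s) = codePrefix M (x t)} :=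
    fun M s t => measurableSet_eq_fun ((measurable_codePrefix M).comp (measurable_pi_apply s))
      ((measurable_codePrefix M).comp (measurable_pi_apply t))
  have heq : ∀ s t, {x : ℕ → X | x s = x t} = ⋂ M, {x | codePrefix M (x s) = codePrefix M (x t)} := by
    intro s t
    ext x
    simp only [Set.mem_iInter, Set.mem_ofPred_eq]
    exact ⟨fun h M => by rw [h], eq_of_forall_codePrefix_eq⟩
  let B : ℕ → Set (ℕ → X) := fun M =>
    {x | ∃ s < T, ∃ t < T, codePrefix M (x s) = codePrefix M (x t) ∧ x s ≠ x t}
  have hB : ∀ M, B M = ⋃ s ∈ Finset.range T, ⋃ t ∈ Finset.range T,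
      ({x | codePrefix M (x s) = codePrefix M (x t)} ∩ {x | x s = x t}ᶜ) := by
    intro M
    ext x
    simp only [B, Set.mem_ofPred_eq, Set.mem_iUnion, Finset.mem_range, Set.mem_inter_iff,
      Set.mem_compl_iff, exists_prop, ne_eq]
  have hBm : ∀ M, MeasurableSet (B M) := by
    intro M
    rw [hB]
    refine Finset.measurableSet_biUnion _ fun s _ => Finset.measurableSet_biUnion _ fun t _ => ?_
    refine (hmeas M s t).inter (MeasurableSet.compl ?_)
    rw [heq]
    exact MeasurableSet.iInter fun M => hmeas M s t
  have hanti : Antitone B := by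
    rintro M N h x ⟨s, hs, t, ht, h1, h2⟩
    exact ⟨s, hs, t, ht, codePrefix_eq_of_le h h1, h2⟩
  have h0 := tendsto_measure_iInter_atTop (μ := μ) (fun M => (hBm M).nullMeasurableSet) hanti
    ⟨0, measure_ne_top _ _⟩
  have h1 : (⋂ M, B M) = ∅ := by
    by_contra hne
    obtain ⟨x, hx⟩ := Set.nonempty_iff_ne_empty.2 hne
    rw [Set.mem_iInter] at hx
    have hch : ∀ p : Fin T × Fin T, ∃ M, x p.1 ≠ x p.2 →
        codePrefix M (x p.1) ≠ codePrefix M (x p.2) := by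
      rintro ⟨s, t⟩
      by_cases h : x s = x t
      · exact ⟨0, fun h' => absurd h h'⟩
      · by_contra! hall
        exact h (eq_of_forall_codePrefix_eq fun m => (hall m).2)
    choose M hM using hch
    obtain ⟨s, hs, t, ht, h1, h2⟩ := hx (Finset.univ.sup M)
    exact hM (⟨s, hs⟩, ⟨t, ht⟩) h2
      (codePrefix_eq_of_le (Finset.le_sup (f := M) (Finset.mem_univ (⟨s, hs⟩, ⟨t, ht⟩))) h1)
  rw [h1, measure_empty] at h0
  obtain ⟨M, hM⟩ := (h0.eventually_lt_const hε).exists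
  exact ⟨M, hM.le⟩

end ProcessApprox


/-! ### Labelings of time and their clusters -/

section Cluster

variable {X : Type*} [MeasurableSpace X] [MeasurableSpace.CountablyGenerated X]

/-- Step `s` is memorized by the expert `e`, and its point has the code of the point of step `t`. -/
def IsMemory (e : ℕ → Fin 3) (x : ℕ → X) (t s : ℕ) : Prop :=
  e s = 2 ∧ ∀ m, codePrefix m (x s) = codePrefix m (x t)

/-- Among the centers before `t` of the expert `e`, the step `s` has a point whose code has the
longest common prefix with the code of the point of step `t`. -/
def IsNearestCenter (e : ℕ → Fin 3) (x : ℕ → X) (t s : ℕ) : Prop :=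
  e s = 1 ∧ ∀ s' < t, e s' = 1 → ∀ m, codePrefix m (x s') = codePrefix m (x t) →
    codePrefix m (x s) = codePrefix m (x t)

/-- The expert `e` may put step `t` into the cluster founded by step `s`. -/
def MayJoin (e : ℕ → Fin 3) (x : ℕ → X) (t s : ℕ) : Prop :=
  s = t ∨ (s < t ∧ e t = 0 ∧ IsMemory e x t s) ∨
    (s < t ∧ e t = 0 ∧ (∀ s' < t, ¬ IsMemory e x t s') ∧ IsNearestCenter e x t s)

open Classical in
/-- The founder of the cluster into which the expert `e` puts step `t`. An expert labels every step
by `2` (new cluster, memorized), `1` (new cluster, whose founder is a center) or `0` (join the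
cluster of a memorized copy or else of the nearest center). -/
noncomputable def cluster (e : ℕ → Fin 3) (x : ℕ → X) (t : ℕ) : ℕ :=
  Nat.find (⟨t, Or.inl rfl⟩ : ∃ s, MayJoin e x t s)

theorem mayJoin_cluster (e : ℕ → Fin 3) (x : ℕ → X) (t : ℕ) : MayJoin e x t (cluster e x t) := by
  classical
  exact Nat.find_spec (⟨t, Or.inl rfl⟩ : ∃ s, MayJoin e x t s)

theorem cluster_le_of_mayJoin {e : ℕ → Fin 3} {x : ℕ → X} {t s : ℕ} (h : MayJoin e x t s) :
    cluster e x t ≤ s := by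
  classical
  exact Nat.find_min' _ h

theorem cluster_le (e : ℕ → Fin 3) (x : ℕ → X) (t : ℕ) : cluster e x t ≤ t :=
  cluster_le_of_mayJoin (Or.inl rfl)

theorem MayJoin.congr {e e' : ℕ → Fin 3} {x x' : ℕ → X} {t s : ℕ} (he : ∀ s ≤ t, e s = e' s)
    (hx : ∀ s ≤ t, x s = x' s) (h : MayJoin e x t s) : MayJoin e' x' t s := by
  have hmem : ∀ s < t, IsMemory e x t s ↔ IsMemory e' x' t s := by
    intro s hs
    rw [IsMemory, IsMemory, he s hs.le, hx s hs.le, hx t le_rfl]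
  rcases h with h | ⟨h1, h2, h3⟩ | ⟨h1, h2, h3, h4, h5⟩
  · exact Or.inl h
  · exact Or.inr (Or.inl ⟨h1, he t le_rfl ▸ h2, (hmem s h1).1 h3⟩)
  · refine Or.inr (Or.inr ⟨h1, he t le_rfl ▸ h2, fun s' hs' h => h3 s' hs' ((hmem s' hs').2 h),
      he s h1.le ▸ h4, fun s' hs' h m hm => ?_⟩)
    have := h5 s' hs' (by rw [he s' hs'.le, h]) m
    rw [hx s' hs'.le, hx t le_rfl, hx s h1.le] at this
    exact this hm

/-- Causality: this is what allows clusters to be used by a learner, and what makes all labelings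
that agree up to a given time indistinguishable up to then. -/
theorem cluster_congr {e e' : ℕ → Fin 3} {x x' : ℕ → X} {t : ℕ} (he : ∀ s ≤ t, e s = e' s)
    (hx : ∀ s ≤ t, x s = x' s) : cluster e x t = cluster e' x' t :=
  le_antisymm
    (cluster_le_of_mayJoin ((mayJoin_cluster e' x' t).congr (fun s hs => (he s hs).symm)
      fun s hs => (hx s hs).symm))
    (cluster_le_of_mayJoin ((mayJoin_cluster e x t).congr he hx))

theorem measurable_cluster (t : ℕ) :
    Measurable fun p : (ℕ → Fin 3) × (ℕ → X) => cluster p.1 p.2 t := by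
  classical
  have hE : ∀ (s : ℕ) (j : Fin 3), Measurable fun p : (ℕ → Fin 3) × (ℕ → X) => p.1 s = j := by
    intro s j
    exact measurableSet_setOfPred.1 (measurableSet_eq_fun
      ((measurable_pi_apply s).comp measurable_fst) measurable_const)
  have hA : ∀ m s, Measurable fun p : (ℕ → Fin 3) × (ℕ → X) =>
      codePrefix m (p.2 s) = codePrefix m (p.2 t) := by
    intro m s
    exact measurableSet_setOfPred.1 (measurableSet_eq_fun
      ((measurable_codePrefix m).comp ((measurable_pi_apply s).comp measurable_snd))
      ((measurable_codePrefix m).comp ((measurable_pi_apply t).comp measurable_snd)))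
  have hM : ∀ s, Measurable fun p : (ℕ → Fin 3) × (ℕ → X) => IsMemory p.1 p.2 t s := fun s =>
    (hE s 2).and (Measurable.forall fun m => hA m s)
  have hC : ∀ s, Measurable fun p : (ℕ → Fin 3) × (ℕ → X) => IsNearestCenter p.1 p.2 t s := by
    intro s
    refine (hE s 1).and (Measurable.forall fun s' => ?_)
    exact measurable_const.imp ((hE s' 1).imp (Measurable.forall fun m => (hA m s').imp (hA m s)))
  refine measurable_find _ fun s => measurableSet_setOfPred.2 ?_
  refine measurable_const.or (Measurable.or ?_ ?_)
  · exact measurable_const.and ((hE t 0).and (hM s))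
  · refine measurable_const.and ((hE t 0).and (Measurable.and (Measurable.forall fun s' => ?_) (hC s)))
    exact measurable_const.imp (hM s').not

theorem exists_isNearestCenter {e : ℕ → Fin 3} {x : ℕ → X} {t s₀ : ℕ} (hs₀ : s₀ < t)
    (h₀ : e s₀ = 1) : ∃ s < t, IsNearestCenter e x t s := by
  classical
  -- The length of the common prefix, infinite when the codes coincide; a maximizer over the
  -- finitely many earlier centers is a nearest one.
  let f : ℕ → ℕ∞ := fun s => ⨆ m : ℕ, ⨆ _ : codePrefix m (x s) = codePrefix m (x t), (m : ℕ∞)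
  obtain ⟨s, hs, hmax⟩ := Finset.exists_max_image ((Finset.range t).filter fun s => e s = 1) f
    ⟨s₀, Finset.mem_filter.2 ⟨Finset.mem_range.2 hs₀, h₀⟩⟩
  rw [Finset.mem_filter, Finset.mem_range] at hs
  refine ⟨s, hs.1, hs.2, fun s' hs' he' m hm => ?_⟩
  by_contra hno
  have h1 : (m : ℕ∞) ≤ f s' := le_iSup₂_of_le m hm le_rfl
  have h2 := h1.trans (hmax s' (Finset.mem_filter.2 ⟨Finset.mem_range.2 hs', he'⟩))
  have hm0 : 0 < m := by
    rcases Nat.eq_zero_or_pos m with rfl | h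
    · exact absurd (funext fun i => i.elim0) hno
    · exact h
  have h3 : f s ≤ ((m - 1 : ℕ) : ℕ∞) := by
    refine iSup₂_le fun n hn => ?_
    have : n < m := by
      by_contra! hle
      exact hno (codePrefix_eq_of_le hle hn)
    exact_mod_cast (by omega : n ≤ m - 1)
  have h4 : m ≤ m - 1 := by exact_mod_cast h2.trans h3
  omega

end Cluster

/-- The labels of the expert `e` are mostly `0`, and its clusters are pure with respect to `κ`. -/
def IsGoodExpert {X : Type*} [MeasurableSpace X] [MeasurableSpace.CountablyGenerated X]
    (κ : X → ℕ) (x : ℕ → X) (e : ℕ → Fin 3) : Prop :=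
  ((fun T : ℕ => (((Finset.range T).filter fun t => e t ≠ 0).card : ℝ)) =o[atTop]
    fun T : ℕ => (T : ℝ)) ∧
  ∀ t, κ (x (cluster e x t)) = κ (x t) ∧ e (cluster e x t) ≠ 0


/-! ### A good labeling along almost every SMV trajectory -/

section Existence

/-- Scales for the approximation of `κ` along a trajectory: during the window `[T l, T (l + 1))` the
map `κ` is compared with functions `a (l - 1)`, `a l` of finitely many code bits. -/
structure Scales where
  T : ℕ → ℕ
  T_zero : T 0 = 0
  strictMono_T : StrictMono T
  m : ℕ → ℕ
  a : ∀ l, (Fin (m l) → Bool) → ℕ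
  M : ℕ → ℕ
  growth : ∀ l, (l + 1) * ∑ j ∈ Finset.range (l + 1), 2 ^ m j ≤ T (l + 1)

namespace Scales

variable (S : Scales)

theorem exists_lt_T (t : ℕ) : ∃ l, t < S.T (l + 1) :=
  ⟨t, (Nat.lt_succ_self t).trans_le (S.strictMono_T.le_apply)⟩

open Classical in
/-- The window of the step `t`. -/
noncomputable def level (t : ℕ) : ℕ := Nat.find (S.exists_lt_T t)

theorem lt_T_level (t : ℕ) : t < S.T (S.level t + 1) := by
  classical
  exact Nat.find_spec (S.exists_lt_T t)

theorem T_level_le (t : ℕ) : S.T (S.level t) ≤ t := by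
  classical
  rcases h : S.level t with _ | l
  · rw [S.T_zero]; exact Nat.zero_le t
  · by_contra! hlt
    have : S.level t ≤ l := Nat.find_min' (S.exists_lt_T t) hlt
    omega

theorem level_mono {s t : ℕ} (h : s ≤ t) : S.level s ≤ S.level t := by
  by_contra! hlt
  have h1 := S.strictMono_T.monotone (show S.level t + 1 ≤ S.level s from hlt)
  have h2 := S.T_level_le s
  have h3 := S.lt_T_level t
  omega

theorem le_level {l t : ℕ} (h : S.T l ≤ t) : l ≤ S.level t := by
  by_contra! hlt
  have h1 := S.strictMono_T.monotone (show S.level t + 1 ≤ l from hlt)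
  have h3 := S.lt_T_level t
  omega

variable {X : Type*} [MeasurableSpace X] [MeasurableSpace.CountablyGenerated X]

/-- The approximation of level `l` fails at `y`. -/
def Fails (κ : X → ℕ) (l : ℕ) (y : X) : Prop := S.a l (codePrefix (S.m l) y) ≠ κ y

/-- Level `l` is the last one whose approximation fails at `y`. -/
def LastFails (κ : X → ℕ) (l : ℕ) (y : X) : Prop :=
  S.Fails κ l y ∧ ∀ l' > l, ¬ S.Fails κ l' y

theorem LastFails.unique {κ : X → ℕ} {l l' : ℕ} {y : X} (h : S.LastFails κ l y)
    (h' : S.LastFails κ l' y) : l = l' := by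
  rcases lt_trichotomy l l' with h1 | h1 | h1
  · exact absurd h'.1 (h.2 l' h1)
  · exact h1
  · exact absurd h.1 (h'.2 l h1)

open Classical in
/-- The cells of the partition that tells apart the points at which approximations fail. -/
noncomputable def cell (κ : X → ℕ) (y : X) : ℕ :=
  if h : ∃ l, S.LastFails κ l y then
    Nat.pair (Nat.find h) (Encodable.encode (codePrefix (S.M (Nat.find h)) y)) + 1 else 0

theorem cell_eq {κ : X → ℕ} {l : ℕ} {y : X} (h : S.LastFails κ l y) :
    S.cell κ y = Nat.pair l (Encodable.encode (codePrefix (S.M l) y)) + 1 := by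
  classical
  have hex : ∃ l, S.LastFails κ l y := ⟨l, h⟩
  rw [cell, dif_pos hex, LastFails.unique S (Nat.find_spec hex) h]

theorem measurableSet_fails {κ : X → ℕ} (hκ : Measurable κ) (l : ℕ) :
    MeasurableSet {y | S.Fails κ l y} :=
  (measurableSet_eq_fun ((measurable_of_finite _).comp (measurable_codePrefix _)) hκ).compl

theorem measurable_cell {κ : X → ℕ} (hκ : Measurable κ) : Measurable (S.cell κ) := by
  have hV : ∀ l, MeasurableSet {y | S.LastFails κ l y} := fun l =>
    measurableSet_setOfPred.2 ((measurableSet_setOfPred.1 (S.measurableSet_fails hκ l)).and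
      (Measurable.forall fun l' => measurable_const.imp
        (measurableSet_setOfPred.1 (S.measurableSet_fails hκ l')).not))
  refine measurable_to_countable' fun k => ?_
  have : S.cell κ ⁻¹' {k} = (⋃ l, {y | S.LastFails κ l y} ∩
      {y | Nat.pair l (Encodable.encode (codePrefix (S.M l) y)) + 1 = k}) ∪
      ((⋃ l, {y | S.LastFails κ l y})ᶜ ∩ {_y | (0 : ℕ) = k}) := by
    ext y
    simp only [Set.mem_preimage, Set.mem_singleton_iff, Set.mem_union, Set.mem_iUnion,
      Set.mem_inter_iff, Set.mem_compl_iff, Set.mem_ofPred_eq]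
    by_cases h : ∃ l, S.LastFails κ l y
    · obtain ⟨l, hl⟩ := h
      rw [S.cell_eq hl]
      constructor
      · intro h
        exact Or.inl ⟨l, hl, h⟩
      · rintro (⟨l', hl', h⟩ | ⟨h, -⟩)
        · rwa [LastFails.unique S hl hl']
        · exact absurd ⟨l, hl⟩ h
    · have h0 : S.cell κ y = 0 := dif_neg h
      rw [h0]
      constructor
      · intro h'
        exact Or.inr ⟨h, h'⟩
      · rintro (⟨l', hl', -⟩ | ⟨-, h'⟩)
        · exact absurd ⟨l', hl'⟩ h
        · exact h'
  rw [this]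
  refine (MeasurableSet.iUnion fun l => (hV l).inter ?_).union
    ((MeasurableSet.iUnion hV).compl.inter (MeasurableSet.const _))
  exact measurableSet_eq_fun (((measurable_of_finite fun p : Fin (S.M l) → Bool =>
    Nat.pair l (Encodable.encode p) + 1)).comp (measurable_codePrefix _)) measurable_const

/-- Step `t` is exceptional: it is an early step, or an approximation that matters in its window
fails at its point. -/
def Exceptional (κ : X → ℕ) (l₀ : ℕ) (x : ℕ → X) (t : ℕ) : Prop :=
  S.level t < l₀ + 2 ∨ S.Fails κ (S.level t - 1) (x t) ∨ S.Fails κ (S.level t) (x t)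

/-- The first exceptional visit of a point. -/
def FirstExceptional (κ : X → ℕ) (l₀ : ℕ) (x : ℕ → X) (t : ℕ) : Prop :=
  S.Exceptional κ l₀ x t ∧ ∀ s < t, S.Exceptional κ l₀ x s → x s ≠ x t

/-- The first regular visit, within its window, of a code prefix. -/
def FirstRegular (κ : X → ℕ) (l₀ : ℕ) (x : ℕ → X) (t : ℕ) : Prop :=
  ¬ S.Exceptional κ l₀ x t ∧ ∀ s < t, ¬ S.Exceptional κ l₀ x s → S.level s = S.level t →
    codePrefix (S.m (S.level t - 1)) (x s) ≠ codePrefix (S.m (S.level t - 1)) (x t)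

open Classical in
/-- The expert built from the scales. -/
noncomputable def expert (κ : X → ℕ) (l₀ : ℕ) (x : ℕ → X) (t : ℕ) : Fin 3 :=
  if S.FirstExceptional κ l₀ x t then 2 else if S.FirstRegular κ l₀ x t then 1 else 0

variable {S} {κ : X → ℕ} {l₀ : ℕ} {x : ℕ → X}

theorem expert_eq_two {t : ℕ} : S.expert κ l₀ x t = 2 ↔ S.FirstExceptional κ l₀ x t := by
  classical
  unfold expert
  split_ifs with h1 h2 <;> simp [h1]

theorem expert_eq_one {t : ℕ} : S.expert κ l₀ x t = 1 ↔ S.FirstRegular κ l₀ x t := by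
  classical
  unfold expert
  split_ifs with h1 h2
  · simp only [false_iff, show ((2 : Fin 3) = 1) = False by simp]
    exact fun h => h.1 h1.1
  · simp [h2]
  · simp [h2]

theorem expert_ne_zero {t : ℕ} : S.expert κ l₀ x t ≠ 0 ↔
    S.FirstExceptional κ l₀ x t ∨ S.FirstRegular κ l₀ x t := by
  rw [← expert_eq_one, ← expert_eq_two]
  generalize S.expert κ l₀ x t = j
  fin_cases j <;> simp

theorem Exceptional.exists_first {t : ℕ} (h : S.Exceptional κ l₀ x t) :
    ∃ s ≤ t, S.FirstExceptional κ l₀ x s ∧ x s = x t := by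
  classical
  have hex : ∃ s, S.Exceptional κ l₀ x s ∧ x s = x t := ⟨t, h, rfl⟩
  refine ⟨Nat.find hex, Nat.find_min' hex ⟨h, rfl⟩, ⟨(Nat.find_spec hex).1, ?_⟩,
    (Nat.find_spec hex).2⟩
  intro s hs hU heq
  exact Nat.find_min hex hs ⟨hU, heq.trans (Nat.find_spec hex).2⟩

theorem exists_firstRegular {t : ℕ} (h : ¬ S.Exceptional κ l₀ x t) :
    ∃ s ≤ t, S.FirstRegular κ l₀ x s ∧ S.level s = S.level t ∧
      codePrefix (S.m (S.level t - 1)) (x s) = codePrefix (S.m (S.level t - 1)) (x t) := by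
  classical
  have hex : ∃ s, ¬ S.Exceptional κ l₀ x s ∧ S.level s = S.level t ∧
      codePrefix (S.m (S.level t - 1)) (x s) = codePrefix (S.m (S.level t - 1)) (x t) :=
    ⟨t, h, rfl, rfl⟩
  obtain ⟨h1, h2, h3⟩ := Nat.find_spec hex
  refine ⟨Nat.find hex, Nat.find_min' hex ⟨h, rfl, rfl⟩, ⟨h1, ?_⟩, h2, h3⟩
  intro s hs hU hl heq
  rw [h2] at heq hl
  exact Nat.find_min hex hs ⟨hU, hl, heq.trans h3⟩

/-- Late exceptional points visit distinct cells. In window `L` no approximation of level above `L`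
fails, so the last failing level `l` of an exceptional point is `L` or `L - 1`. The step is then
before `T (l + 2)`, where `M l` bits separate distinct points, so the cell determines the point.
First visits to distinct points are therefore counted by visited cells. -/
theorem card_firstExceptional_le
    (hF : ∀ l ≥ l₀, ∀ t < S.T l, ¬ S.Fails κ l (x t))
    (hM : ∀ l ≥ l₀, ∀ s < S.T (l + 2), ∀ t < S.T (l + 2),
      codePrefix (S.M l) (x s) = codePrefix (S.M l) (x t) → x s = x t) (T : ℕ)
    [DecidablePred (S.FirstExceptional κ l₀ x)] :
    ((Finset.range T).filter (S.FirstExceptional κ l₀ x)).card ≤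
      S.T (l₀ + 2) + Set.ncard {k : ℕ | ∃ t < T, x t ∈ S.cell κ ⁻¹' {k}} := by
  classical
  have hsub : (Finset.range T).filter (S.FirstExceptional κ l₀ x) ⊆
      Finset.range (S.T (l₀ + 2)) ∪ (Finset.range T).filter (fun t =>
        S.FirstExceptional κ l₀ x t ∧ S.T (l₀ + 2) ≤ t) := by
    intro t ht
    simp only [Finset.mem_filter, Finset.mem_range, Finset.mem_union] at ht ⊢
    rcases lt_or_ge t (S.T (l₀ + 2)) with h | h
    · exact Or.inl h
    · exact Or.inr ⟨ht.1, ht.2, h⟩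
  refine (Finset.card_le_card hsub).trans ((Finset.card_union_le _ _).trans ?_)
  rw [Finset.card_range]
  refine Nat.add_le_add_left ?_ _
  have hset : {k : ℕ | ∃ t < T, x t ∈ S.cell κ ⁻¹' {k}} =
      ((Finset.range T).image fun t => S.cell κ (x t) : Finset ℕ) := by
    ext k
    simp
  rw [hset, Set.ncard_coe_finset]
  have hlast : ∀ t, S.FirstExceptional κ l₀ x t → S.T (l₀ + 2) ≤ t →
      ∃ l ≥ l₀, t < S.T (l + 2) ∧ S.LastFails κ l (x t) := by
    intro t hU ht
    have hl := S.le_level ht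
    have hgt : ∀ l' > S.level t, ¬ S.Fails κ l' (x t) := fun l' hl' =>
      hF l' (by omega) t ((S.lt_T_level t).trans_le (S.strictMono_T.monotone hl'))
    by_cases h : S.Fails κ (S.level t) (x t)
    · exact ⟨S.level t, by omega,
        (S.lt_T_level t).trans (S.strictMono_T (Nat.lt_succ_self _)), h, hgt⟩
    · refine ⟨S.level t - 1, by omega, ?_, ?_, ?_⟩
      · rw [show S.level t - 1 + 2 = S.level t + 1 by omega]
        exact S.lt_T_level t
      · rcases hU.1 with h' | h' | h'
        · omega
        · exact h'
        · exact absurd h' h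
      · intro l' hl'
        rcases (show l' = S.level t ∨ l' > S.level t by omega) with rfl | h'
        · exact h
        · exact hgt l' h'
  refine Finset.card_le_card_of_injOn (fun t => S.cell κ (x t)) ?_ ?_
  · intro t ht
    simp only [Finset.coe_filter, Finset.mem_range, Set.mem_ofPred_eq] at ht
    exact Finset.mem_coe.2 (Finset.mem_image_of_mem _ (Finset.mem_range.2 ht.1))
  · intro s hs t ht hst
    simp only [Finset.coe_filter, Finset.mem_range, Set.mem_ofPred_eq] at hs ht
    obtain ⟨l, hl, hsl, hls⟩ := hlast s hs.2.1 hs.2.2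
    obtain ⟨l', hl', htl, hlt⟩ := hlast t ht.2.1 ht.2.2
    simp only [S.cell_eq hls, S.cell_eq hlt, Nat.add_right_cancel_iff, Nat.pair_eq_pair] at hst
    obtain ⟨rfl, hst⟩ := hst
    have hx := hM l hl s hsl t htl (Encodable.encode_injective hst)
    rcases lt_trichotomy s t with h | h | h
    · exact absurd hx (ht.2.1.2 s h hs.2.1.1)
    · exact h
    · exact absurd hx.symm (hs.2.1.2 t h ht.2.1.1)

/-- In window `l` a new center needs a new prefix of length `m (l - 1)`, which gives at most `2 ^ m
(l - 1)` centers. The growth condition makes the total over the windows reached negligible. This is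
why a window compares prefixes of the previous level: `2 ^ m (l - 1)` is small against `T l`, while
nothing bounds `2 ^ m l` by it. -/
theorem level_mul_card_firstRegular_le (T : ℕ) [DecidablePred (S.FirstRegular κ l₀ x)] :
    S.level (T - 1) * ((Finset.range T).filter (S.FirstRegular κ l₀ x)).card ≤ T := by
  classical
  set L := S.level (T - 1) with hL
  have hcard : ((Finset.range T).filter (S.FirstRegular κ l₀ x)).card ≤
      ∑ j ∈ Finset.range L, 2 ^ S.m j := by
    have h1 : ((Finset.range L).sigma fun j => (Finset.univ : Finset (Fin (S.m j) → Bool))).card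
        = ∑ j ∈ Finset.range L, 2 ^ S.m j := by
      rw [Finset.card_sigma]
      simp
    rw [← h1]
    refine Finset.card_le_card_of_injOn
      (fun t => ⟨S.level t - 1, codePrefix (S.m (S.level t - 1)) (x t)⟩) ?_ ?_
    · intro t ht
      simp only [Finset.coe_filter, Finset.mem_range, Set.mem_ofPred_eq] at ht
      have hl2 : l₀ + 2 ≤ S.level t := by
        by_contra! hlt
        exact ht.2.1 (Or.inl hlt)
      have := S.level_mono (show t ≤ T - 1 by omega)
      simp only [Finset.coe_sigma, Set.mem_sigma_iff, Finset.coe_range, Set.mem_Iio,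
        Finset.coe_univ, Set.mem_univ, and_true]
      omega
    · intro s hs t ht hst
      simp only [Finset.coe_filter, Finset.mem_range, Set.mem_ofPred_eq] at hs ht
      have hls : l₀ + 2 ≤ S.level s := by
        by_contra! hlt
        exact hs.2.1 (Or.inl hlt)
      have hlt : l₀ + 2 ≤ S.level t := by
        by_contra! hlt
        exact ht.2.1 (Or.inl hlt)
      rw [Sigma.mk.injEq] at hst
      have hl : S.level s = S.level t := by omega
      have hp : codePrefix (S.m (S.level t - 1)) (x s) = codePrefix (S.m (S.level t - 1)) (x t) := by
        have := hst.2
        rw [hl] at this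
        exact eq_of_heq this
      rcases lt_trichotomy s t with h | h | h
      · exact absurd hp (ht.2.2 s h hs.2.1 hl)
      · exact h
      · exact absurd hp.symm (by rw [← hl]; exact hs.2.2 t h ht.2.1 hl.symm)
  rcases hL' : L with _ | l
  · simp
  · have h2 := S.growth l
    have h3 := S.T_level_le (T - 1)
    rw [← hL, hL'] at h3
    rw [hL'] at hcard
    calc (l + 1) * _ ≤ (l + 1) * _ := Nat.mul_le_mul_left _ hcard
      _ ≤ S.T (l + 1) := h2
      _ ≤ T - 1 := h3
      _ ≤ T := Nat.sub_le _ _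

variable [MeasurableSpace.SeparatesPoints X]

/-- A memorized copy is the same point. Otherwise the step is regular, some center of its window
shares its prefix of length `m (L - 1)`, and so does the nearest center. The approximation of level
`L - 1` is correct at both points and depends on that prefix only, so `κ` agrees. -/
theorem expert_pure (hF : ∀ l ≥ l₀, ∀ t < S.T l, ¬ S.Fails κ l (x t)) (t : ℕ) :
    κ (x (cluster (S.expert κ l₀ x) x t)) = κ (x t) ∧
      S.expert κ l₀ x (cluster (S.expert κ l₀ x) x t) ≠ 0 := by
  set e := S.expert κ l₀ x with he
  have hmem : ∀ s t, IsMemory e x t s ↔ S.FirstExceptional κ l₀ x s ∧ x s = x t := by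
    intro s t
    rw [IsMemory, he, expert_eq_two]
    exact and_congr_right fun _ => ⟨eq_of_forall_codePrefix_eq, fun h m => by rw [h]⟩
  have hnoexc : e t = 0 → (∀ s' < t, ¬ IsMemory e x t s') → ¬ S.Exceptional κ l₀ x t := by
    intro h0 hno hU
    obtain ⟨s', hs', hf, hx⟩ := hU.exists_first
    rcases hs'.eq_or_lt with rfl | hlt
    · have := expert_eq_two.2 hf
      rw [← he, h0] at this
      exact absurd this (by simp)
    · exact hno s' hlt ((hmem s' t).2 ⟨hf, hx⟩)
  have hcenter : e t = 0 → ¬ S.Exceptional κ l₀ x t → ∃ s < t, e s = 1 ∧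
      codePrefix (S.m (S.level t - 1)) (x s) = codePrefix (S.m (S.level t - 1)) (x t) := by
    intro h0 hU
    obtain ⟨s, hs, hf, -, hp⟩ := exists_firstRegular hU
    refine ⟨s, lt_of_le_of_ne hs ?_, expert_eq_one.2 hf, hp⟩
    rintro rfl
    have := expert_eq_one.2 hf
    rw [← he, h0] at this
    exact absurd this (by simp)
  rcases mayJoin_cluster e x t with h | ⟨h1, h2, h3⟩ | ⟨h1, h2, h3, h4⟩
  · rw [h]
    refine ⟨rfl, fun h0 => ?_⟩
    by_cases hex : ∃ s < t, IsMemory e x t s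
    · obtain ⟨s, hs, hm⟩ := hex
      have := cluster_le_of_mayJoin (Or.inr (Or.inl ⟨hs, h0, hm⟩) : MayJoin e x t s)
      omega
    · push Not at hex
      obtain ⟨s, hs, hs1, -⟩ := hcenter h0 (hnoexc h0 hex)
      obtain ⟨s', hs', hc⟩ := exists_isNearestCenter (x := x) hs hs1
      have := cluster_le_of_mayJoin (Or.inr (Or.inr ⟨hs', h0, hex, hc⟩) : MayJoin e x t s')
      omega
  · rw [((hmem _ _).1 h3).2, h3.1]
    exact ⟨rfl, by simp⟩
  · refine ⟨?_, by rw [h4.1]; simp⟩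
    set s := cluster e x t
    have hU := hnoexc h2 h3
    obtain ⟨s', hs', hs'1, hp⟩ := hcenter h2 hU
    have hagree := h4.2 s' hs' hs'1 _ hp
    have hl2 : l₀ + 2 ≤ S.level t := by
      by_contra! hlt
      exact hU (Or.inl hlt)
    have hUs := (expert_eq_one.1 h4.1).1
    have hlst := S.level_mono h1.le
    have hk1 : ¬ S.Fails κ (S.level t - 1) (x t) := fun h => hU (Or.inr (Or.inl h))
    have hk2 : ¬ S.Fails κ (S.level t - 1) (x s) := by
      intro hfail
      -- A center of the same or the previous window is regular with respect to level `L - 1`, which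
      -- is why exceptionality tests two levels; an older center lies before `T (L - 1)`, where that
      -- level does not fail.
      rcases (show S.level s = S.level t ∨ S.level s = S.level t - 1 ∨
        S.level s + 1 ≤ S.level t - 1 by omega) with h | h | h
      · exact hUs (Or.inr (Or.inl (by rwa [h])))
      · exact hUs (Or.inr (Or.inr (by rwa [h])))
      · exact hF (S.level t - 1) (by omega) s
          ((S.lt_T_level s).trans_le (S.strictMono_T.monotone h)) hfail
    simp only [Fails, not_not] at hk1 hk2
    rw [← hk1, ← hk2, hagree]

theorem isGoodExpert_expert (hF : ∀ l ≥ l₀, ∀ t < S.T l, ¬ S.Fails κ l (x t))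
    (hM : ∀ l ≥ l₀, ∀ s < S.T (l + 2), ∀ t < S.T (l + 2),
      codePrefix (S.M l) (x s) = codePrefix (S.M l) (x t) → x s = x t)
    (hvis : (fun T : ℕ => (Set.ncard {k : ℕ | ∃ t < T, x t ∈ S.cell κ ⁻¹' {k}} : ℝ)) =o[atTop]
      fun T : ℕ => (T : ℝ)) : IsGoodExpert κ x (S.expert κ l₀ x) := by
  classical
  refine ⟨?_, expert_pure hF⟩
  have hreg : (fun T : ℕ => (((Finset.range T).filter (S.FirstRegular κ l₀ x)).card : ℝ))
      =o[atTop] fun T : ℕ => (T : ℝ) := by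
    rw [Asymptotics.isLittleO_iff]
    intro c hc
    obtain ⟨l, hl⟩ := exists_nat_gt (1 / c)
    filter_upwards [eventually_ge_atTop (S.T l + 1)] with T hT
    have h1 : l ≤ S.level (T - 1) := S.le_level (by omega)
    have h2 := S.level_mul_card_firstRegular_le (κ := κ) (l₀ := l₀) (x := x) T
    set N := ((Finset.range T).filter (S.FirstRegular κ l₀ x)).card
    have h3 : (l : ℝ) * N ≤ T := by
      exact_mod_cast (Nat.mul_le_mul_right N h1).trans h2
    rw [Real.norm_of_nonneg (by positivity), Real.norm_of_nonneg (by positivity)]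
    have h4 : 1 ≤ c * l := by
      rw [div_lt_iff₀ hc] at hl
      linarith
    have h5 : (0 : ℝ) ≤ N := by positivity
    nlinarith
  have hconst : (fun _ : ℕ => (S.T (l₀ + 2) : ℝ)) =o[atTop] fun T : ℕ => (T : ℝ) :=
    Asymptotics.isLittleO_const_left.2 (Or.inr
      (tendsto_norm_atTop_atTop.comp tendsto_natCast_atTop_atTop))
  refine Asymptotics.IsBigO.trans_isLittleO ?_ ((hconst.add hvis).add hreg)
  refine Asymptotics.IsBigO.of_bound 1 (Eventually.of_forall fun T => ?_)
  rw [one_mul, Real.norm_of_nonneg (by positivity), Real.norm_of_nonneg (by positivity)]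
  have h1 : ((Finset.range T).filter fun t => S.expert κ l₀ x t ≠ 0).card ≤
      ((Finset.range T).filter (S.FirstExceptional κ l₀ x)).card +
        ((Finset.range T).filter (S.FirstRegular κ l₀ x)).card := by
    refine le_trans (Finset.card_le_card ?_) (Finset.card_union_le _ _)
    intro t ht
    simp only [Finset.mem_filter, Finset.mem_union] at ht ⊢
    rcases expert_ne_zero.1 ht.2 with h | h
    · exact Or.inl ⟨ht.1, h⟩
    · exact Or.inr ⟨ht.1, h⟩
  exact_mod_cast h1.trans (Nat.add_le_add_right (card_firstExceptional_le hF hM T) _)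

end Scales

end Existence


/-- The failure probabilities at level `l` are at most `2⁻¹ ^ l`, so by Borel–Cantelli the
approximation and the separation hold from some level `l₀` on. That level depends on the trajectory,
but the partition by `S.cell κ` does not, so SMV applies to it. -/
theorem exists_goodExpert {X : Type*} [MeasurableSpace X] [MeasurableSpace.CountablyGenerated X]
    [MeasurableSpace.SeparatesPoints X] {μ : ProbabilityMeasure (ℕ → X)} (hμ : μ ∈ SMV X)
    {κ : X → ℕ} (hκ : Measurable κ) :
    ∀ᵐ x ∂(μ : Measure (ℕ → X)), ∃ e, IsGoodExpert κ x e := by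
  have hε : ∀ l : ℕ, (0 : ENNReal) < ((2 : ENNReal)⁻¹) ^ l := fun l =>
    ENNReal.pow_pos (by simp) l
  have happ : ∀ T l : ℕ, ∃ m, ∃ a : (Fin m → Bool) → ℕ,
      (μ : Measure (ℕ → X)) {x | ∃ t < T, a (codePrefix m (x t)) ≠ κ (x t)} ≤ 2⁻¹ ^ l :=
    fun T l => exists_codePrefix_factor_process _ hκ T (hε l)
  choose m a hma using happ
  -- The pair holds `T l` and the sum of `2 ^ m j` over `j < l`. The bit count `m l` depends on `T
  -- l`, and `T (l + 1)` is chosen after it, large enough for the growth condition.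
  let st : ℕ → ℕ × ℕ := fun l => Nat.rec (0, 0) (fun l p =>
    (p.1 + 1 + (l + 1) * (p.2 + 2 ^ m p.1 l), p.2 + 2 ^ m p.1 l)) l
  have hst1 : ∀ l, (st (l + 1)).1 = (st l).1 + 1 + (l + 1) * ((st l).2 + 2 ^ m (st l).1 l) :=
    fun l => rfl
  have hst2 : ∀ l, (st l).2 = ∑ j ∈ Finset.range l, 2 ^ m (st j).1 j := by
    intro l
    induction l with
    | zero => rfl
    | succ l ih => rw [Finset.sum_range_succ, ← ih]
  have hsep : ∀ l : ℕ, ∃ M, (μ : Measure (ℕ → X)) {x | ∃ s < (st (l + 2)).1, ∃ t < (st (l + 2)).1,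
      codePrefix M (x s) = codePrefix M (x t) ∧ x s ≠ x t} ≤ 2⁻¹ ^ l :=
    fun l => exists_codePrefix_separates _ _ (hε l)
  choose M hM using hsep
  let S : Scales :=
    { T := fun l => (st l).1
      T_zero := rfl
      strictMono_T := strictMono_nat_of_lt_succ fun l => by
        rw [hst1]
        omega
      m := fun l => m (st l).1 l
      a := fun l => a (st l).1 l
      M := M
      growth := fun l => by
        rw [hst1, hst2, ← Finset.sum_range_succ (fun j => 2 ^ m (st j).1 j)]
        omega }
  have hsum : ∑' l : ℕ, ((2 : ENNReal)⁻¹) ^ l ≠ ⊤ := by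
    rw [ENNReal.tsum_geometric]
    simp
  have h1 : ∀ᵐ x ∂(μ : Measure (ℕ → X)), ∀ᶠ l in atTop,
      x ∉ {x : ℕ → X | ∃ t < S.T l, S.Fails κ l (x t)} :=
    ae_eventually_notMem (ne_top_of_le_ne_top hsum (ENNReal.tsum_le_tsum fun l => hma _ _))
  have h2 : ∀ᵐ x ∂(μ : Measure (ℕ → X)), ∀ᶠ l in atTop,
      x ∉ {x : ℕ → X | ∃ s < S.T (l + 2), ∃ t < S.T (l + 2),
        codePrefix (S.M l) (x s) = codePrefix (S.M l) (x t) ∧ x s ≠ x t} :=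
    ae_eventually_notMem (ne_top_of_le_ne_top hsum (ENNReal.tsum_le_tsum fun l => hM l))
  have h3 := hμ (fun k => S.cell κ ⁻¹' {k})
    (fun k => S.measurable_cell hκ (measurableSet_singleton k))
    (fun i j hij => Disjoint.preimage _ (Set.disjoint_singleton.2 hij))
    (by rw [← Set.preimage_iUnion, Set.iUnion_of_singleton, Set.preimage_univ])
  filter_upwards [h1, h2, h3] with x hx1 hx2 hx3
  obtain ⟨l₀, hl₀⟩ := eventually_atTop.1 (hx1.and hx2)
  refine ⟨S.expert κ l₀ x, Scales.isGoodExpert_expert (fun l hl t ht hf => ?_)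
    (fun l hl s hs t ht hp => ?_) hx3⟩
  · exact (hl₀ l hl).1 ⟨t, ht, hf⟩
  · by_contra hne
    exact (hl₀ l hl).2 ⟨s, hs, t, ht, hp, hne⟩


/-! ### Necessity of SMV: coins attached to cells -/

section Coins

/-- The law of a fair coin. -/
noncomputable def coin : Measure Bool := (2⁻¹ : ENNReal) • (Measure.dirac true + Measure.dirac false)

instance : IsProbabilityMeasure coin := ⟨by
  simp only [coin, Measure.smul_apply, Measure.add_apply, measure_univ, smul_eq_mul]
  rw [one_add_one_eq_two, ENNReal.inv_mul_cancel (by simp) (by simp)]⟩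

theorem map_not_coin : coin.map not = coin := by
  rw [coin, Measure.map_smul, Measure.map_add _ _ (measurable_of_finite _),
    Measure.map_dirac' (measurable_of_finite _), Measure.map_dirac' (measurable_of_finite _),
    add_comm]
  rfl

/-- Flip the coin with index `k`. -/
def flipCoin (k : ℕ) (b : ℕ → Bool) : ℕ → Bool := fun i => if i = k then !b i else b i

theorem flipCoin_of_ne {k i : ℕ} (h : i ≠ k) (b : ℕ → Bool) : flipCoin k b i = b i := if_neg h

theorem flipCoin_self (k : ℕ) (b : ℕ → Bool) : flipCoin k b k = !b k := if_pos rfl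

theorem measurePreserving_flipCoin (k : ℕ) : MeasurePreserving (flipCoin k)
    (Measure.infinitePi fun _ => coin) (Measure.infinitePi fun _ => coin) := by
  let g : ℕ → Bool → Bool := fun i c => if i = k then !c else c
  have h := Measure.infinitePi_map_pi (μ := fun _ : ℕ => coin) (f := g)
    (fun i => measurable_of_finite (g i))
  refine ⟨measurable_pi_lambda _ fun i => (measurable_of_finite (g i)).comp
    (measurable_pi_apply i), ?_⟩
  have h2 : (fun i => coin.map (g i)) = fun _ => coin := by
    ext1 i
    by_cases hi : i = k
    · simp only [g, hi, if_true]
      exact map_not_coin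
    · simp only [g, hi, if_false]
      exact Measure.map_id
  rw [h2] at h
  exact h

end Coins

section Predictions

variable {X : Type*} {Y : Type*} [MeasurableSpace X] [MeasurableSpace Y]

/-- The value chosen by a bit. -/
def bitValue (y₀ y₁ : Y) (b : Bool) : Y := if b then y₁ else y₀

theorem measurable_prediction (f : OnlineRule X Y) {Ω : Type*} [MeasurableSpace Ω] {t : ℕ} {r : Ω → f.R}
    {x : ℕ → Ω → X} {y : ℕ → Ω → Y} (hr : Measurable r) (hx : ∀ s, Measurable (x s))
    (hy : ∀ s, Measurable (y s)) :
    Measurable fun ω => f.prediction t (r ω) (fun s => x s ω) (fun s => y s ω) := by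
  refine (f.measurable_predict t).comp ?_
  exact hr.prodMk ((measurable_pi_lambda _ fun s => hx _).prodMk
    ((measurable_pi_lambda _ fun s => hy _).prodMk (hx t)))

theorem prediction_congr {f : OnlineRule X Y} {t : ℕ} {r : f.R} {x : ℕ → X} {y y' : ℕ → Y}
    (h : ∀ s < t, y s = y' s) : f.prediction t r x y = f.prediction t r x y' := by
  have : (fun s : Fin t => y s) = fun s : Fin t => y' s := funext fun s => h s s.2
  rw [OnlineRule.prediction, OnlineRule.prediction, this]

theorem measurable_bitResponse (y₀ y₁ : Y) {Ω : Type*} [MeasurableSpace Ω] {cell : X → ℕ}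
    (hc : Measurable cell) {x : Ω → X} {b : Ω → ℕ → Bool} (hx : Measurable x) (hb : Measurable b) :
    Measurable fun ω => bitValue y₀ y₁ (b ω (cell (x ω))) := by
  have h1 : Measurable fun p : ℕ × (ℕ → Bool) => p.2 p.1 :=
    measurable_from_prod_countable_right fun n => measurable_pi_apply n
  exact (measurable_of_finite (bitValue y₀ y₁)).comp (h1.comp ((hc.comp hx).prodMk hb))

end Predictions

section Necessity

variable {X : Type*} {Y : Type*} [MetricSpace Y]

open Classical in
/-- Step `t` visits its cell for the first time. -/
noncomputable def isNewVisit (cell : X → ℕ) (x : ℕ → X) (t : ℕ) : ℝ :=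
  if ∀ s < t, cell (x s) ≠ cell (x t) then 1 else 0

/-- Indicator of the points at distance at least `δ` from `y`. -/
noncomputable def farFrom (δ : ℝ) (y z : Y) : ℝ := Set.indicator {z | δ ≤ dist z y} 1 z

theorem farFrom_nonneg (δ : ℝ) (y z : Y) : 0 ≤ farFrom δ y z :=
  Set.indicator_nonneg (fun _ _ => zero_le_one) _

theorem farFrom_le_one (δ : ℝ) (y z : Y) : farFrom δ y z ≤ 1 :=
  Set.indicator_le_self' (f := (1 : Y → ℝ)) (fun _ _ => zero_le_one) z

theorem measurable_farFrom [MeasurableSpace Y] [BorelSpace Y] (δ : ℝ) (y : Y) : Measurable (farFrom δ y) :=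
  measurable_one.indicator (measurableSet_le measurable_const
    (continuous_id.dist continuous_const).measurable)

theorem one_le_farFrom_add (y₀ y₁ z : Y) :
    1 ≤ farFrom (dist y₀ y₁ / 2) y₀ z + farFrom (dist y₀ y₁ / 2) y₁ z := by
  by_cases h : dist y₀ y₁ / 2 ≤ dist z y₀
  · have h1 : farFrom (dist y₀ y₁ / 2) y₀ z = 1 := Set.indicator_of_mem (s := {z | _ ≤ _}) h _
    linarith [farFrom_nonneg (dist y₀ y₁ / 2) y₁ z]
  · have h' : dist y₀ y₁ / 2 ≤ dist z y₁ := by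
      have := dist_triangle_left y₀ y₁ z
      push Not at h
      linarith
    have h1 : farFrom (dist y₀ y₁ / 2) y₁ z = 1 := Set.indicator_of_mem (s := {z | _ ≤ _}) h' _
    linarith [farFrom_nonneg (dist y₀ y₁ / 2) y₀ z]

theorem farFrom_le_loss_div {α δ : ℝ} (hα : 0 ≤ α) (hδ : 0 < δ) (y z : Y) :
    farFrom δ y z ≤ loss α z y / δ ^ α := by
  have hpos : 0 < δ ^ α := Real.rpow_pos_of_pos hδ α
  by_cases h : δ ≤ dist z y
  · have h1 : farFrom δ y z = 1 := Set.indicator_of_mem (s := {z | _ ≤ _}) h _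
    rw [h1, le_div_iff₀ hpos, one_mul]
    exact Real.rpow_le_rpow hδ.le h hα
  · have h1 : farFrom δ y z = 0 := Set.indicator_of_notMem (s := {z | _ ≤ _}) h _
    rw [h1]
    exact div_nonneg (Real.rpow_nonneg dist_nonneg _) hpos.le

theorem ncard_visited_le (cell : X → ℕ) (x : ℕ → X) (T : ℕ) :
    (Set.ncard {k : ℕ | ∃ t < T, x t ∈ cell ⁻¹' {k}} : ℝ) ≤
      ∑ t ∈ Finset.range T, isNewVisit cell x t := by
  classical
  have hset : {k : ℕ | ∃ t < T, x t ∈ cell ⁻¹' {k}} ⊆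
      (((Finset.range T).filter fun t => ∀ s < t, cell (x s) ≠ cell (x t)).image
        fun t => cell (x t) : Finset ℕ) := by
    rintro k ⟨t, ht, hk⟩
    have hex : ∃ s, cell (x s) = k := ⟨t, hk⟩
    have hs := Nat.find_spec hex
    simp only [Finset.coe_image, Set.mem_image, Finset.coe_filter, Finset.mem_range,
      Set.mem_ofPred_eq]
    refine ⟨Nat.find hex, ⟨(Nat.find_min' hex hk).trans_lt ht, fun s hlt heq => ?_⟩, hs⟩
    exact Nat.find_min hex hlt (heq.trans hs)
  have h1 := Set.ncard_le_ncard hset (Finset.finite_toSet _)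
  rw [Set.ncard_coe_finset] at h1
  replace h1 := h1.trans Finset.card_image_le
  have h2 : ∑ t ∈ Finset.range T, isNewVisit cell x t =
      (((Finset.range T).filter fun t => ∀ s < t, cell (x s) ≠ cell (x t)).card : ℝ) := by
    simp only [isNewVisit, Finset.sum_boole]
  rw [h2]
  exact_mod_cast h1

variable [MeasurableSpace X] [MeasurableSpace Y] (f : OnlineRule X Y) (cell : X → ℕ) (y₀ y₁ : Y)

/-- The responses obtained from the bits attached to the cells. -/
def bitResponse (x : ℕ → X) (b : ℕ → Bool) (t : ℕ) : Y := bitValue y₀ y₁ (b (cell (x t)))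

/-- At first visits: the indicator of a bad prediction minus its mean over the bit of the cell. -/
noncomputable def coinDeviation (x : ℕ → X) (r : ℕ → f.R) (t : ℕ) (b : ℕ → Bool) : ℝ :=
  isNewVisit cell x t *
    (farFrom (dist y₀ y₁ / 2) (bitResponse cell y₀ y₁ x b t)
        (f.prediction t (r t) x (bitResponse cell y₀ y₁ x b)) -
      (farFrom (dist y₀ y₁ / 2) y₀ (f.prediction t (r t) x (bitResponse cell y₀ y₁ x b)) +
        farFrom (dist y₀ y₁ / 2) y₁ (f.prediction t (r t) x (bitResponse cell y₀ y₁ x b))) / 2)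

/-- In this form the coin of the visited cell enters as a sign, apart from its possible influence
through past responses. -/
theorem coinDeviation_eq (x : ℕ → X) (r : ℕ → f.R) (t : ℕ) (b : ℕ → Bool) :
    coinDeviation f cell y₀ y₁ x r t b = isNewVisit cell x t * ((if b (cell (x t)) then 1 else -1) *
      (farFrom (dist y₀ y₁ / 2) y₁ (f.prediction t (r t) x (bitResponse cell y₀ y₁ x b)) -
        farFrom (dist y₀ y₁ / 2) y₀ (f.prediction t (r t) x (bitResponse cell y₀ y₁ x b))) / 2) := by
  rw [coinDeviation]
  congr 1
  rw [show bitResponse cell y₀ y₁ x b t = bitValue y₀ y₁ (b (cell (x t))) from rfl]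
  cases b (cell (x t)) <;> simp only [bitValue, if_true, if_false, Bool.false_eq_true] <;> ring

theorem abs_coinDeviation_le (x : ℕ → X) (r : ℕ → f.R) (t : ℕ) (b : ℕ → Bool) :
    |coinDeviation f cell y₀ y₁ x r t b| ≤ 1 := by
  rw [coinDeviation]
  set p := f.prediction t (r t) x (bitResponse cell y₀ y₁ x b)
  have h1 := farFrom_nonneg (dist y₀ y₁ / 2) y₀ p
  have h2 := farFrom_nonneg (dist y₀ y₁ / 2) y₁ p
  have h3 := farFrom_nonneg (dist y₀ y₁ / 2) (bitResponse cell y₀ y₁ x b t) p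
  have h4 := farFrom_le_one (dist y₀ y₁ / 2) y₀ p
  have h5 := farFrom_le_one (dist y₀ y₁ / 2) y₁ p
  have h6 := farFrom_le_one (dist y₀ y₁ / 2) (bitResponse cell y₀ y₁ x b t) p
  rw [isNewVisit]
  split_ifs
  · rw [one_mul, abs_le]
    constructor <;> linarith
  · simp

/-- At a first visit, the chance over the coin that the prediction is far from the response is at
least `1 / 2`. Hence the indicator of a first visit is at most `2 * loss / δ ^ α - 2 *
coinDeviation`, and both averages are asymptotically nonpositive. The comparator has loss zero. -/
theorem isLittleO_visited {α : ℝ} (hα : 1 ≤ α) (hne : y₀ ≠ y₁) {x : ℕ → X} {r : ℕ → f.R}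
    {b : ℕ → Bool}
    (h1 : Tendsto (fun T : ℕ => (1 / (T : ℝ)) *
      ∑ t ∈ Finset.range T, coinDeviation f cell y₀ y₁ x r t b) atTop (𝓝 0))
    (h2 : excessLoss α f (fun z => bitValue y₀ y₁ (b (cell z))) x (bitResponse cell y₀ y₁ x b) r
      ≤ 0) :
    (fun T : ℕ => (Set.ncard {k : ℕ | ∃ t < T, x t ∈ cell ⁻¹' {k}} : ℝ)) =o[atTop]
      fun T : ℕ => (T : ℝ) := by
  set δ := dist y₀ y₁ / 2 with hδ
  have hδ0 : 0 < δ := half_pos (dist_pos.2 hne)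
  have hδα : 0 < δ ^ α := Real.rpow_pos_of_pos hδ0 α
  rw [Asymptotics.isLittleO_iff]
  intro c hc
  have hA : ∀ᶠ T : ℕ in atTop, -(c / 4) < (1 / (T : ℝ)) *
      ∑ t ∈ Finset.range T, coinDeviation f cell y₀ y₁ x r t b :=
    h1.eventually (lt_mem_nhds (by linarith))
  have hB : ∀ᶠ T : ℕ in atTop, (1 / (T : ℝ)) * ∑ t ∈ Finset.range T,
      (loss α (f.prediction t (r t) x (bitResponse cell y₀ y₁ x b)) (bitResponse cell y₀ y₁ x b t) -
        loss α (bitValue y₀ y₁ (b (cell (x t)))) (bitResponse cell y₀ y₁ x b t))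
        < c / 4 * δ ^ α := by
    have hpos : (0 : EReal) < ((c / 4 * δ ^ α : ℝ) : EReal) := by
      exact_mod_cast (by positivity : 0 < c / 4 * δ ^ α)
    filter_upwards [Filter.eventually_lt_of_limsup_lt (h2.trans_lt hpos)] with T hT
    exact_mod_cast hT
  filter_upwards [hA, hB, eventually_gt_atTop 0] with T hTA hTB hT
  have hT' : (0 : ℝ) < T := by exact_mod_cast hT
  rw [Real.norm_of_nonneg (by positivity), Real.norm_of_nonneg (by positivity)]
  refine (ncard_visited_le cell x T).trans ?_
  have hzero : ∀ t, loss α (bitValue y₀ y₁ (b (cell (x t)))) (bitResponse cell y₀ y₁ x b t) = 0 := by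
    intro t
    rw [loss, bitResponse, dist_self, Real.zero_rpow (by linarith)]
  simp only [hzero, sub_zero] at hTB
  rw [one_div_mul_eq_div, div_lt_iff₀ hT'] at hTB
  rw [one_div_mul_eq_div, lt_div_iff₀ hT'] at hTA
  have hpt : ∀ t, isNewVisit cell x t ≤ 2 * (loss α (f.prediction t (r t) x
      (bitResponse cell y₀ y₁ x b)) (bitResponse cell y₀ y₁ x b t) / δ ^ α) -
      2 * coinDeviation f cell y₀ y₁ x r t b := by
    intro t
    have e1 := farFrom_le_loss_div (by linarith : 0 ≤ α) hδ0 (bitResponse cell y₀ y₁ x b t)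
      (f.prediction t (r t) x (bitResponse cell y₀ y₁ x b))
    have e2 := one_le_farFrom_add y₀ y₁ (f.prediction t (r t) x (bitResponse cell y₀ y₁ x b))
    have e3 := farFrom_nonneg δ (bitResponse cell y₀ y₁ x b t)
      (f.prediction t (r t) x (bitResponse cell y₀ y₁ x b))
    rw [coinDeviation, ← hδ]
    rw [← hδ] at e2
    rw [isNewVisit]
    split_ifs
    · linarith
    · linarith
  have hsum := Finset.sum_le_sum fun t (_ : t ∈ Finset.range T) => hpt t
  rw [Finset.sum_sub_distrib, ← Finset.mul_sum, ← Finset.mul_sum, ← Finset.sum_div] at hsum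
  have e4 : (∑ t ∈ Finset.range T, loss α (f.prediction t (r t) x
      (bitResponse cell y₀ y₁ x b)) (bitResponse cell y₀ y₁ x b t)) / δ ^ α ≤ c / 4 * T := by
    rw [div_le_iff₀ hδα]
    linarith
  linarith

variable [BorelSpace Y]

theorem measurable_coinDeviation (x : ℕ → X) (r : ℕ → f.R) (t : ℕ) :
    Measurable (coinDeviation f cell y₀ y₁ x r t) := by
  have hy : ∀ s, Measurable fun b : ℕ → Bool => bitResponse cell y₀ y₁ x b s := fun s =>
    (measurable_of_finite (bitValue y₀ y₁)).comp (measurable_pi_apply (cell (x s)))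
  have hp : Measurable fun b : ℕ → Bool =>
      f.prediction t (r t) x (bitResponse cell y₀ y₁ x b) :=
    measurable_prediction f measurable_const (fun s => measurable_const) hy
  have hb : Measurable fun b : ℕ → Bool => (if b (cell (x t)) then (1 : ℝ) else -1) :=
    (measurable_of_finite fun c : Bool => if c then (1 : ℝ) else -1).comp
      (measurable_pi_apply (cell (x t)))
  have := (hb.mul (((measurable_farFrom (dist y₀ y₁ / 2) y₁).comp hp).sub
    ((measurable_farFrom (dist y₀ y₁ / 2) y₀).comp hp))).div_const 2
  convert this.const_mul (isNewVisit cell x t) using 1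
  ext b
  exact coinDeviation_eq f cell y₀ y₁ x r t b

/-- If `t` is a first visit, flipping the coin of its cell preserves the measure and all responses
before `t`. It keeps the deviation at `s` and negates the one at `t`, so the integral equals its
negative. -/
theorem integral_coinDeviation_mul (x : ℕ → X) (r : ℕ → f.R) {s t : ℕ} (hst : s < t) :
    ∫ b, coinDeviation f cell y₀ y₁ x r s b * coinDeviation f cell y₀ y₁ x r t b
      ∂(Measure.infinitePi fun _ => coin) = 0 := by
  by_cases hnew : ∀ s < t, cell (x s) ≠ cell (x t)
  swap
  · have : isNewVisit cell x t = 0 := if_neg hnew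
    simp [coinDeviation, this]
  set k := cell (x t) with hk
  have hresp : ∀ b, ∀ i < t, bitResponse cell y₀ y₁ x (flipCoin k b) i
      = bitResponse cell y₀ y₁ x b i := by
    intro b i hi
    rw [bitResponse, bitResponse, flipCoin_of_ne (hnew i hi)]
  have hs : ∀ b, coinDeviation f cell y₀ y₁ x r s (flipCoin k b)
      = coinDeviation f cell y₀ y₁ x r s b := by
    intro b
    rw [coinDeviation, coinDeviation, hresp b s hst,
      prediction_congr fun i hi => hresp b i (hi.trans hst)]
  have ht : ∀ b, coinDeviation f cell y₀ y₁ x r t (flipCoin k b)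
      = - coinDeviation f cell y₀ y₁ x r t b := by
    intro b
    rw [coinDeviation_eq, coinDeviation_eq, prediction_congr (hresp b), ← hk, flipCoin_self]
    cases b k <;> simp <;> ring
  have hmul := (measurable_coinDeviation f cell y₀ y₁ x r s).mul
    (measurable_coinDeviation f cell y₀ y₁ x r t)
  have h := integral_map (measurePreserving_flipCoin k).measurable.aemeasurable
    (μ := Measure.infinitePi fun _ => coin) hmul.aestronglyMeasurable
  rw [(measurePreserving_flipCoin k).map_eq] at h
  simp only [Pi.mul_apply, hs, ht, mul_neg, integral_neg] at h
  linarith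

theorem ae_tendsto_coinDeviation (x : ℕ → X) (r : ℕ → f.R) :
    ∀ᵐ b ∂(Measure.infinitePi fun _ : ℕ => coin), Tendsto (fun T : ℕ => (1 / (T : ℝ)) *
      ∑ t ∈ Finset.range T, coinDeviation f cell y₀ y₁ x r t b) atTop (𝓝 0) := by
  refine tendsto_average_of_orthogonal _ _ (measurable_coinDeviation f cell y₀ y₁ x r) 1
    (fun t b => (abs_coinDeviation_le f cell y₀ y₁ x r t b).trans ?_)
    fun s t hst => integral_coinDeviation_mul f cell y₀ y₁ x r hst
  rw [one_mul]
  refine Real.one_le_rpow ?_ (by norm_num)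
  have : (0 : ℝ) ≤ t := Nat.cast_nonneg t
  linarith

end Necessity


-- Necessity of SMV: noiseless responses

universe u v

theorem indepFun_eval_prod_restrict {A R : Type*} [MeasurableSpace A] [MeasurableSpace R]
    (μ : Measure A) [IsProbabilityMeasure μ] (law : ℕ → Measure R)
    [∀ t, IsProbabilityMeasure (law t)] (t : ℕ) :
    IndepFun (fun p : A × (ℕ → R) => p.2 t) (fun p => (p.1, fun s : Fin t => p.2 s))
      (μ.prod (Measure.infinitePi law)) := by
  have hbase : IndepFun (fun r : ℕ → R => r t) (fun r => fun s : Fin t => r s)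
      (Measure.infinitePi law) := by
    have h1 := iIndepFun_infinitePi (P := law) (X := fun _ r => r) fun i => measurable_id
    have h2 := h1.indepFun_finset {t} (Finset.range t) (by simp) fun i => measurable_pi_apply i
    have hφ : Measurable fun g : ({t} : Finset ℕ) → R => g ⟨t, Finset.mem_singleton_self t⟩ :=
      measurable_pi_apply _
    have hψ : Measurable fun (g : Finset.range t → R) (s : Fin t) =>
        g ⟨s, Finset.mem_range.2 s.2⟩ := measurable_pi_lambda _ fun s => measurable_pi_apply _
    exact h2.comp hφ hψ
  have hres : Measurable fun r : ℕ → R => fun s : Fin t => r s :=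
    measurable_pi_lambda _ fun s => measurable_pi_apply _
  have hg : Measurable fun p : A × (ℕ → R) => (p.1, fun s : Fin t => p.2 s) :=
    measurable_fst.prodMk (hres.comp measurable_snd)
  have hf : Measurable fun p : A × (ℕ → R) => p.2 t :=
    (measurable_pi_apply t).comp measurable_snd
  rw [indepFun_iff_measure_inter_preimage_eq_mul] at hbase ⊢
  intro S V hS hV
  rw [Measure.prod_apply ((hf hS).inter (hg hV)), Measure.prod_apply (hg hV)]
  have e1 : (μ.prod (Measure.infinitePi law)) ((fun p : A × (ℕ → R) => p.2 t) ⁻¹' S)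
      = Measure.infinitePi law ((fun r : ℕ → R => r t) ⁻¹' S) := by
    have : (fun p : A × (ℕ → R) => p.2 t) ⁻¹' S
        = Set.univ ×ˢ ((fun r : ℕ → R => r t) ⁻¹' S) := by
      ext p
      simp
    rw [this, Measure.prod_prod, measure_univ, one_mul]
  rw [e1, ← lintegral_const_mul]
  -- With the first component frozen, only the independence of the coordinates of the product
  -- measure remains.
  · refine lintegral_congr fun a => ?_
    exact hbase S ((fun z => (a, z)) ⁻¹' V) hS (measurable_prodMk_left hV)
  · exact measurable_measure_prodMk_left (hg hV)

section Noiseless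

variable {X : Type u} {Y : Type v} [MeasurableSpace X] [MetricSpace Y] [MeasurableSpace Y]

/-- The responses `h (X t)` with independent draws are a legitimate adversary. Boundedness makes the
tail above `B` empty. The lift `ULift` only moves the sample space to the required universe. -/
theorem ae_excessLoss_le_of_isUniversallyConsistent {α : ℝ} {f : OnlineRule X Y}
    {μ : ProbabilityMeasure (ℕ → X)} (hf : IsUniversallyConsistent α f μ) {h : X → Y}
    (hh : Measurable h) {y₀ : Y} {B : ℝ} (hB : ∀ z, loss α y₀ (h z) < B) (hB0 : 0 ≤ B) :
    ∀ᵐ p ∂((μ : Measure (ℕ → X)).prod (Measure.infinitePi f.law)),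
      excessLoss α f h p.1 (fun t => h (p.1 t)) p.2 ≤ 0 := by
  set base := (μ : Measure (ℕ → X)).prod (Measure.infinitePi f.law) with hbase
  let Ω := ULift.{v, u} ((ℕ → X) × (ℕ → f.R))
  let P : Measure Ω := base.map ULift.up
  have : IsProbabilityMeasure P := Measure.isProbabilityMeasure_map measurable_up.aemeasurable
  let xs : ℕ → Ω → X := fun t ω => ω.down.1 t
  let ys : ℕ → Ω → Y := fun t ω => h (ω.down.1 t)
  let rs : ℕ → Ω → f.R := fun t ω => ω.down.2 t
  have hxs : ∀ t, Measurable (xs t) := fun t =>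
    (measurable_pi_apply t).comp (measurable_fst.comp measurable_down)
  have hrs : ∀ t, Measurable (rs t) := fun t =>
    (measurable_pi_apply t).comp (measurable_snd.comp measurable_down)
  have hadv : IsAdversarialProcess f P xs ys rs := by
    refine ⟨hxs, fun t => hh.comp (hxs t), hrs, fun t => ?_, fun t => ?_⟩
    · have hm : Measurable fun p : (ℕ → X) × (ℕ → f.R) => p.2 t :=
        (measurable_pi_apply t).comp measurable_snd
      have e : P.map (rs t) = base.map fun p => p.2 t := by
        rw [Measure.map_map (hrs t) measurable_up]
        rfl
      rw [e, show (fun p : (ℕ → X) × (ℕ → f.R) => p.2 t) = (fun r => r t) ∘ Prod.snd from rfl,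
        ← Measure.map_map (measurable_pi_apply t) measurable_snd, hbase, Measure.map_snd_prod,
        measure_univ, one_smul, Measure.infinitePi_map_eval]
    · have h1 := indepFun_eval_prod_restrict (μ : Measure (ℕ → X)) f.law t
      have hψ : Measurable fun q : (ℕ → X) × (Fin t → f.R) =>
          (q.1, (fun s : Fin (t + 1) => h (q.1 s)), q.2) :=
        measurable_fst.prodMk (Measurable.prodMk (measurable_pi_lambda _ fun s =>
          hh.comp ((measurable_pi_apply _).comp measurable_fst)) measurable_snd)
      have h2 := h1.comp measurable_id hψ
      rw [indepFun_iff_measure_inter_preimage_eq_mul] at h2 ⊢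
      intro S V hS hV
      have hrt := hrs t
      have hg : Measurable fun ω : Ω => ((fun s : ℕ => xs s ω), (fun s : Fin (t + 1) => ys s ω),
          (fun s : Fin t => rs s ω)) :=
        (measurable_pi_lambda _ fun s => hxs s).prodMk
          ((measurable_pi_lambda _ fun s => hh.comp (hxs _)).prodMk
            (measurable_pi_lambda _ fun s => hrs _))
      rw [Measure.map_apply measurable_up ((hrt hS).inter (hg hV)),
        Measure.map_apply measurable_up (hrt hS), Measure.map_apply measurable_up (hg hV)]
      exact h2 S V hS hV
  have hlaw : P.map (fun ω t => xs t ω) = (μ : Measure (ℕ → X)) := by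
    rw [Measure.map_map (measurable_pi_lambda _ fun s => hxs s) measurable_up]
    change base.map Prod.fst = _
    rw [hbase, Measure.map_fst_prod, measure_univ, one_smul]
  have hint : EmpiricallyIntegrable α P ys := by
    refine ⟨y₀, fun ε hε => Eventually.of_forall fun ω => ⟨B, hB0, ?_⟩⟩
    have hz : ∀ t, Set.indicator {z | B ≤ loss α y₀ z} (loss α y₀) (ys t ω) = 0 := fun t =>
      Set.indicator_of_notMem (s := {z | B ≤ loss α y₀ z}) (not_le.2 (hB _)) _
    simp only [hz, Finset.sum_const_zero, mul_zero, EReal.coe_zero, limsup_const]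
    exact_mod_cast hε.le
  exact ae_of_ae_map measurable_up.aemeasurable (hf Ω P xs ys rs hadv hlaw hint h hh)

variable [BorelSpace Y]

theorem measurable_limsup_excess {Ω : Type*} [MeasurableSpace Ω] (α : ℝ)
    [SecondCountableTopology Y] (f : OnlineRule X Y)
    {x : Ω → ℕ → X} {y : Ω → ℕ → Y} {w : Ω → ℕ → Y} {r : Ω → ℕ → f.R}
    (hx : Measurable x) (hy : Measurable y) (hw : Measurable w) (hr : Measurable r) :
    Measurable fun ω => limsup (fun T : ℕ => (((1 / (T : ℝ)) * ∑ t ∈ Finset.range T,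
      (loss α (f.prediction t (r ω t) (x ω) (y ω)) (y ω t) - loss α (w ω t) (y ω t)) : ℝ) : EReal))
      atTop := by
  have hloss : ∀ {a b : Ω → Y}, Measurable a → Measurable b →
      Measurable fun ω => loss α (a ω) (b ω) := fun ha hb =>
    (ha.dist hb).pow_const α
  have hx' : ∀ s, Measurable fun ω => x ω s := fun s => (measurable_pi_apply s).comp hx
  have hy' : ∀ s, Measurable fun ω => y ω s := fun s => (measurable_pi_apply s).comp hy
  have hw' : ∀ s, Measurable fun ω => w ω s := fun s => (measurable_pi_apply s).comp hw
  have hr' : ∀ s, Measurable fun ω => r ω s := fun s => (measurable_pi_apply s).comp hr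
  refine Measurable.limsup fun T => measurable_coe_real_ereal.comp (Measurable.const_mul ?_ _)
  exact Finset.measurable_sum _ fun t _ =>
    (hloss (measurable_prediction f (hr' t) hx' hy') (hy' t)).sub (hloss (hw' t) (hy' t))

theorem SOLAR_subset_SMV [Nontrivial Y] [SecondCountableTopology Y] {α : ℝ} (hα : 1 ≤ α) :
    SOLAR X Y α ⊆ SMV X := by
  classical
  rintro μ ⟨f, hf⟩ A hA hdisj huniv
  obtain ⟨y₀, y₁, hne⟩ := exists_pair_ne Y
  have hex : ∀ z, ∃ k, z ∈ A k := fun z => Set.mem_iUnion.1 (huniv ▸ Set.mem_univ z)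
  let cell : X → ℕ := fun z => Nat.find (hex z)
  have hcell : Measurable cell := measurable_find hex hA
  have hcellA : ∀ z k, z ∈ A k ↔ z ∈ cell ⁻¹' {k} := by
    intro z k
    constructor
    · intro h
      by_contra hne
      exact Set.disjoint_left.1 (hdisj (Ne.symm hne)) h (Nat.find_spec (hex z))
    · rintro rfl
      exact Nat.find_spec (hex z)
  simp only [hcellA]
  set ν : Measure (ℕ → Bool) := Measure.infinitePi fun _ => coin
  have h1 : ∀ b : ℕ → Bool, ∀ᵐ p ∂((μ : Measure (ℕ → X)).prod (Measure.infinitePi f.law)),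
      excessLoss α f (fun z => bitValue y₀ y₁ (b (cell z))) p.1 (bitResponse cell y₀ y₁ p.1 b) p.2
        ≤ 0 := by
    intro b
    refine ae_excessLoss_le_of_isUniversallyConsistent hf
      (measurable_bitResponse y₀ y₁ hcell measurable_id measurable_const) (y₀ := y₀)
      (B := loss α y₀ y₁ + 1) (fun z => ?_) ?_
    · have h0 : 0 ≤ loss α y₀ y₁ := Real.rpow_nonneg dist_nonneg _
      cases b (cell z)
      · simp only [bitValue, Bool.false_eq_true, if_false]
        rw [show loss α y₀ y₀ = 0 by rw [loss, dist_self, Real.zero_rpow (by linarith)]]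
        linarith
      · simp only [bitValue, if_true]
        linarith
    · have h0 : 0 ≤ loss α y₀ y₁ := Real.rpow_nonneg dist_nonneg _
      linarith
  -- Consistency gives a null set of trajectories for each `b`; Fubini exchanges the quantifiers, so
  -- that for a typical trajectory and typical draws the coins can be taken random.
  have h2 : ∀ᵐ p ∂((μ : Measure (ℕ → X)).prod (Measure.infinitePi f.law)), ∀ᵐ b ∂ν,
      excessLoss α f (fun z => bitValue y₀ y₁ (b (cell z))) p.1 (bitResponse cell y₀ y₁ p.1 b) p.2
        ≤ 0 := by
    refine (Measure.ae_ae_comm ?_).1 (Eventually.of_forall h1)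
    have hy : Measurable fun q : (ℕ → Bool) × ((ℕ → X) × (ℕ → f.R)) =>
        bitResponse cell y₀ y₁ q.2.1 q.1 :=
      measurable_pi_lambda _ fun t => measurable_bitResponse y₀ y₁ hcell
        ((measurable_pi_apply t).comp (measurable_fst.comp measurable_snd)) measurable_fst
    exact measurableSet_le (measurable_limsup_excess α f
      (measurable_fst.comp measurable_snd) hy hy (measurable_snd.comp measurable_snd))
      measurable_const
  have h3 : ∀ᵐ p ∂((μ : Measure (ℕ → X)).prod (Measure.infinitePi f.law)),
      (fun T : ℕ => (Set.ncard {k : ℕ | ∃ t < T, p.1 t ∈ cell ⁻¹' {k}} : ℝ)) =o[atTop]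
        fun T : ℕ => (T : ℝ) := by
    filter_upwards [h2] with p hp
    obtain ⟨b, hb1, hb2⟩ := (hp.and (ae_tendsto_coinDeviation f cell y₀ y₁ p.1 p.2)).exists
    exact isLittleO_visited f cell y₀ y₁ hα hne hb2 hb1
  filter_upwards [Measure.ae_ae_of_ae_prod h3] with x hx
  exact hx.exists.choose_spec

end Noiseless


/-! ### Exponential weights with an arbitrary prior -/

theorem exp_neg_le_quadratic {x : ℝ} (hx : 0 ≤ x) : Real.exp (-x) ≤ 1 - x + x ^ 2 / 2 := by
  have h1 := Real.quadratic_le_exp_of_nonneg hx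
  have h2 : 0 < 1 + x + x ^ 2 / 2 := by positivity
  rw [Real.exp_neg]
  refine (inv_anti₀ h2 h1).trans ?_
  rw [inv_le_iff_one_le_mul₀ h2]
  nlinarith [sq_nonneg (x ^ 2)]

section Hedge

variable {E : Type*} [MeasurableSpace E] (π : Measure E) [IsProbabilityMeasure π]

/-- The normalization of the exponential weights with rate `β` for the losses `S`. -/
noncomputable def partition (β : ℝ) (S : E → ℝ) : ℝ := ∫ e, Real.exp (-(β * S e)) ∂π

variable {π}

theorem integrable_exp_neg {β : ℝ} {S : E → ℝ} (hβ : 0 ≤ β) (hS : Measurable S)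
    (h0 : ∀ e, 0 ≤ S e) : Integrable (fun e => Real.exp (-(β * S e))) π :=
  Integrable.of_bound (Real.measurable_exp.comp (hS.const_mul β).neg).aestronglyMeasurable 1
    (Eventually.of_forall fun e => by
      rw [Real.norm_of_nonneg (Real.exp_pos _).le, Real.exp_le_one_iff]
      have := mul_nonneg hβ (h0 e)
      linarith)

theorem partition_pos {β : ℝ} {S : E → ℝ} (hβ : 0 ≤ β) (hS : Measurable S) (h0 : ∀ e, 0 ≤ S e) :
    0 < partition π β S :=
  integral_exp_pos (integrable_exp_neg hβ hS h0)

/-- Jensen's inequality for the concave power `β' / β`. Consequently the potential `log (partition π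
β S) / β` does not increase when the rate is lowered, which permits decreasing rates. -/
theorem partition_le_rpow {β β' : ℝ} {S : E → ℝ} (hβ' : 0 < β') (h : β' ≤ β) (hS : Measurable S)
    (h0 : ∀ e, 0 ≤ S e) : partition π β' S ≤ partition π β S ^ (β' / β) := by
  have hβ : 0 < β := hβ'.trans_le h
  have hp0 : 0 ≤ β' / β := by positivity
  have e1 : ∀ e, Real.exp (-(β' * S e)) = Real.exp (-(β * S e)) ^ (β' / β) := by
    intro e
    rw [← Real.exp_mul]
    congr 1
    field_simp
  have h1 := (Real.concaveOn_rpow hp0 ((div_le_one hβ).2 h)).le_map_integral (μ := π)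
    (f := fun e => Real.exp (-(β * S e)))
    ((Real.continuous_rpow_const hp0).continuousOn) isClosed_Ici
    (Eventually.of_forall fun e => (Real.exp_pos _).le) (integrable_exp_neg hβ.le hS h0)
    (by
      have := integrable_exp_neg (π := π) hβ'.le hS h0
      simp only [e1] at this
      exact this)
  simp only [partition, e1]
  exact h1

/-- The loss of the exponentially weighted mixture. -/
noncomputable def hedgeLoss (π : Measure E) (β : ℝ) (S L : E → ℝ) : ℝ :=
  (∫ e, Real.exp (-(β * S e)) * L e ∂π) / partition π β S

theorem log_partition_add_le {β b : ℝ} {S L : E → ℝ} (hβ : 0 < β) (hS : Measurable S)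
    (hL : Measurable L) (hS0 : ∀ e, 0 ≤ S e) (hL0 : ∀ e, 0 ≤ L e) (hLb : ∀ e, L e ≤ b) :
    Real.log (partition π β fun e => S e + L e) ≤
      Real.log (partition π β S) - β * hedgeLoss π β S L + β ^ 2 * b ^ 2 / 2 := by
  have hZ := partition_pos (π := π) hβ.le hS hS0
  have hi1 := integrable_exp_neg (π := π) hβ.le hS hS0
  have hi2 : Integrable (fun e => Real.exp (-(β * S e)) * L e) π :=
    hi1.mul_bdd (c := b) hL.aestronglyMeasurable (Eventually.of_forall fun e => by
      rw [Real.norm_of_nonneg (hL0 e)]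
      exact hLb e)
  have h1 : partition π β (fun e => S e + L e) ≤
      partition π β S * (1 - β * hedgeLoss π β S L + β ^ 2 * b ^ 2 / 2) := by
    have h2 : ∀ e, Real.exp (-(β * (S e + L e))) ≤
        (1 + β ^ 2 * b ^ 2 / 2) * Real.exp (-(β * S e)) -
          β * (Real.exp (-(β * S e)) * L e) := by
      intro e
      rw [show -(β * (S e + L e)) = -(β * S e) + -(β * L e) by ring, Real.exp_add]
      have h3 := exp_neg_le_quadratic (mul_nonneg hβ.le (hL0 e))
      have h4 : (β * L e) ^ 2 ≤ β ^ 2 * b ^ 2 := by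
        rw [mul_pow]
        exact mul_le_mul_of_nonneg_left (pow_le_pow_left₀ (hL0 e) (hLb e) 2) (sq_nonneg β)
      have h5 : Real.exp (-(β * L e)) ≤ 1 - β * L e + β ^ 2 * b ^ 2 / 2 := by linarith
      have h6 := mul_le_mul_of_nonneg_left h5 (Real.exp_pos (-(β * S e))).le
      linarith
    have h3 := integral_mono (integrable_exp_neg (π := π) hβ.le (hS.add hL)
      fun e => add_nonneg (hS0 e) (hL0 e))
      ((hi1.const_mul (1 + β ^ 2 * b ^ 2 / 2)).sub (hi2.const_mul β)) h2
    have h4 : ∫ e, Real.exp (-(β * S e)) * L e ∂π = hedgeLoss π β S L * partition π β S := by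
      rw [hedgeLoss, div_mul_cancel₀ _ hZ.ne']
    simp only [Pi.sub_apply] at h3
    rw [integral_sub (hi1.const_mul _) (hi2.const_mul β), integral_const_mul, integral_const_mul,
      h4] at h3
    refine h3.trans (le_of_eq ?_)
    rw [partition]
    ring
  have hZ' : 0 < partition π β fun e => S e + L e :=
    partition_pos hβ.le (hS.add hL) fun e => add_nonneg (hS0 e) (hL0 e)
  have h2 : partition π β (fun e => S e + L e) ≤
      partition π β S * Real.exp (-(β * hedgeLoss π β S L) + β ^ 2 * b ^ 2 / 2) := by
    refine h1.trans (mul_le_mul_of_nonneg_left ?_ hZ.le)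
    have := Real.add_one_le_exp (-(β * hedgeLoss π β S L) + β ^ 2 * b ^ 2 / 2)
    linarith
  have h3 := Real.log_le_log hZ' h2
  rw [Real.log_mul hZ.ne' (Real.exp_pos _).ne', Real.log_exp] at h3
  linarith

/-- The potential `-log (partition π β S) / β` telescopes. A step raises it by at least the loss of
the mixture minus `β * b ^ 2 / 2`, and the subsequent change of rate does not lower it. -/
theorem sum_hedgeLoss_le {β b : ℕ → ℝ} (hβ : ∀ t, 0 < β t) (hanti : Antitone β)
    {L : ℕ → E → ℝ} (hL : ∀ t, Measurable (L t)) (hL0 : ∀ t e, 0 ≤ L t e)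
    (hLb : ∀ t e, L t e ≤ b t) (T : ℕ) :
    ∑ t ∈ Finset.range T, hedgeLoss π (β t) (fun e => ∑ s ∈ Finset.range t, L s e) (L t) ≤
      -(Real.log (partition π (β T) fun e => ∑ s ∈ Finset.range T, L s e) / β T) +
        ∑ t ∈ Finset.range T, β t * b t ^ 2 / 2 := by
  induction T with
  | zero => simp [partition]
  | succ T ih =>
    rw [Finset.sum_range_succ, Finset.sum_range_succ]
    set S : E → ℝ := fun e => ∑ s ∈ Finset.range T, L s e
    have hS : Measurable S := Finset.measurable_sum _ fun s _ => hL s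
    have hS0 : ∀ e, 0 ≤ S e := fun e => Finset.sum_nonneg fun s _ => hL0 s e
    have hS' : (fun e => ∑ s ∈ Finset.range (T + 1), L s e) = fun e => S e + L T e := by
      ext e
      rw [Finset.sum_range_succ]
    rw [hS']
    have h1 := log_partition_add_le (π := π) (hβ T) hS (hL T) hS0 (hL0 T) (hLb T)
    have hSL : Measurable fun e => S e + L T e := hS.add (hL T)
    have hSL0 : ∀ e, 0 ≤ S e + L T e := fun e => add_nonneg (hS0 e) (hL0 T e)
    have h2 := partition_le_rpow (π := π) (hβ (T + 1)) (hanti T.le_succ) hSL hSL0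
    have h3 := Real.log_le_log (partition_pos (hβ _).le hSL hSL0) h2
    rw [Real.log_rpow (partition_pos (hβ _).le hSL hSL0)] at h3
    have h4 : Real.log (partition π (β (T + 1)) fun e => S e + L T e) / β (T + 1) ≤
        Real.log (partition π (β T) fun e => S e + L T e) / β T := by
      rw [div_le_iff₀ (hβ _)]
      refine h3.trans (le_of_eq ?_)
      ring
    have h5 : Real.log (partition π (β T) fun e => S e + L T e) / β T ≤
        Real.log (partition π (β T) S) / β T - hedgeLoss π (β T) S (L T) + β T * b T ^ 2 / 2 := by
      rw [div_le_iff₀ (hβ T)]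
      refine h1.trans (le_of_eq ?_)
      have := (hβ T).ne'
      field_simp
    linarith

/-- Keep only the contribution of `G` to the integral. With a non-atomic prior, regret is measured
against a set of experts of positive mass, not against one expert. -/
theorem neg_log_partition_div_le {β s : ℝ} {S : E → ℝ} (hβ : 0 < β) (hS : Measurable S)
    (h0 : ∀ e, 0 ≤ S e) {G : Set E} (hG : MeasurableSet G) (hpos : 0 < π.real G)
    (hs : ∀ e ∈ G, S e ≤ s) :
    -(Real.log (partition π β S) / β) ≤ s + -Real.log (π.real G) / β := by
  have hi := integrable_exp_neg (π := π) hβ.le hS h0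
  have h1 : π.real G * Real.exp (-(β * s)) ≤ partition π β S := by
    calc π.real G * Real.exp (-(β * s)) = ∫ _ in G, Real.exp (-(β * s)) ∂π := by
          rw [setIntegral_const, smul_eq_mul]
      _ ≤ ∫ e in G, Real.exp (-(β * S e)) ∂π := by
          refine setIntegral_mono_on (integrable_const _).integrableOn hi.integrableOn hG
            fun e he => Real.exp_le_exp.2 ?_
          have := mul_le_mul_of_nonneg_left (hs e he) hβ.le
          linarith
      _ ≤ _ := setIntegral_le_integral hi (Eventually.of_forall fun e => (Real.exp_pos _).le)
  have h2 := Real.log_le_log (mul_pos hpos (Real.exp_pos _)) h1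
  rw [Real.log_mul hpos.ne' (Real.exp_pos _).ne', Real.log_exp] at h2
  rw [← neg_div, div_le_iff₀ hβ, add_mul, div_mul_cancel₀ _ hβ.ne']
  linarith

end Hedge


/-! ### Mean losses, mixtures and causal randomized strategies -/

section ExpLoss

/-- The mean of the losses `l` under the probability weights `p`. -/
noncomputable def expLoss (p : ℕ → ENNReal) (l : ℕ → ℝ) : ℝ :=
  (∑' k, p k * ENNReal.ofReal (l k)).toReal

theorem expLoss_nonneg (p : ℕ → ENNReal) (l : ℕ → ℝ) : 0 ≤ expLoss p l := ENNReal.toReal_nonneg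

theorem tsum_mul_ofReal_le {p : ℕ → ENNReal} (hp : ∑' k, p k = 1) {l : ℕ → ℝ} {b : ℝ}
    (h : ∀ k, p k ≠ 0 → l k ≤ b) : ∑' k, p k * ENNReal.ofReal (l k) ≤ ENNReal.ofReal b := by
  calc ∑' k, p k * ENNReal.ofReal (l k) ≤ ∑' k, p k * ENNReal.ofReal b := by
        refine ENNReal.tsum_le_tsum fun k => ?_
        rcases eq_or_ne (p k) 0 with h0 | h0
        · simp [h0]
        · gcongr
          exact h k h0
    _ = ENNReal.ofReal b := by rw [ENNReal.tsum_mul_right, hp, one_mul]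

theorem expLoss_le {p : ℕ → ENNReal} (hp : ∑' k, p k = 1) {l : ℕ → ℝ} {b : ℝ} (hb : 0 ≤ b)
    (h : ∀ k, p k ≠ 0 → l k ≤ b) : expLoss p l ≤ b :=
  (ENNReal.toReal_mono ENNReal.ofReal_ne_top (tsum_mul_ofReal_le hp h)).trans
    (ENNReal.toReal_ofReal hb).le

theorem expLoss_congr {p : ℕ → ENNReal} {l l' : ℕ → ℝ} (h : ∀ k, p k ≠ 0 → l k = l' k) :
    expLoss p l = expLoss p l' := by
  unfold expLoss
  congr 1
  refine tsum_congr fun k => ?_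
  rcases eq_or_ne (p k) 0 with h0 | h0
  · simp [h0]
  · rw [h k h0]

theorem measurable_expLoss {Ω : Type*} [MeasurableSpace Ω] {p : Ω → ℕ → ENNReal} {l : Ω → ℕ → ℝ}
    (hp : ∀ k, Measurable fun ω => p ω k) (hl : ∀ k, Measurable fun ω => l ω k) :
    Measurable fun ω => expLoss (p ω) (l ω) :=
  (Measurable.tsum fun k => (hp k).mul (hl k).ennreal_ofReal).ennreal_toReal

/-- The mixture of the weights `p e` with respect to the density `W`. -/
noncomputable def mixture {E : Type*} [MeasurableSpace E] (π : Measure E) (W : E → ℝ)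
    (p : E → ℕ → ENNReal) (k : ℕ) : ENNReal :=
  (∫⁻ e, ENNReal.ofReal (W e) * p e k ∂π) / ∫⁻ e, ENNReal.ofReal (W e) ∂π

variable {E : Type*} [MeasurableSpace E] {π : Measure E} {W : E → ℝ} {p : E → ℕ → ENNReal}

theorem tsum_mixture (hW : Measurable W) (hi : Integrable W π) (h0 : ∀ e, 0 ≤ W e)
    (hpos : 0 < ∫ e, W e ∂π) (hp : ∀ k, Measurable fun e => p e k) (hp1 : ∀ e, ∑' k, p e k = 1) :
    ∑' k, mixture π W p k = 1 := by
  have hZ : ∫⁻ e, ENNReal.ofReal (W e) ∂π = ENNReal.ofReal (∫ e, W e ∂π) :=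
    (ofReal_integral_eq_lintegral_ofReal hi (Eventually.of_forall h0)).symm
  have hm : ∀ k, Measurable fun e => ENNReal.ofReal (W e) * p e k := fun k =>
    hW.ennreal_ofReal.mul (hp k)
  simp only [mixture, div_eq_mul_inv]
  rw [ENNReal.tsum_mul_right, ← lintegral_tsum fun k => (hm k).aemeasurable]
  simp only [ENNReal.tsum_mul_left, hp1, mul_one]
  rw [hZ]
  exact ENNReal.mul_inv_cancel (ENNReal.ofReal_pos.2 hpos).ne' ENNReal.ofReal_ne_top

/-- By Tonelli, mixing the distributions of the predictions mixes the mean losses, so no convexity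
of the loss is needed to aggregate strategies. -/
theorem expLoss_mixture (hW : Measurable W) (hi : Integrable W π) (h0 : ∀ e, 0 ≤ W e)
    (hp : ∀ k, Measurable fun e => p e k) (hp1 : ∀ e, ∑' k, p e k = 1) {l : ℕ → ℝ} {b : ℝ}
    (hl : ∀ k, l k ≤ b) :
    expLoss (mixture π W p) l = (∫ e, W e * expLoss (p e) l ∂π) / ∫ e, W e ∂π := by
  have hZ : ∫⁻ e, ENNReal.ofReal (W e) ∂π = ENNReal.ofReal (∫ e, W e ∂π) :=
    (ofReal_integral_eq_lintegral_ofReal hi (Eventually.of_forall h0)).symm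
  have hb0 : ∀ k, l k ≤ max b 0 := fun k => (hl k).trans (le_max_left _ _)
  have hmL : Measurable fun e => expLoss (p e) l := measurable_expLoss hp fun k => measurable_const
  have hi2 : Integrable (fun e => W e * expLoss (p e) l) π :=
    hi.mul_bdd (c := max b 0) hmL.aestronglyMeasurable (Eventually.of_forall fun e => by
      rw [Real.norm_of_nonneg (expLoss_nonneg _ _)]
      exact expLoss_le (hp1 e) (le_max_right _ _) fun k _ => hb0 k)
  have hnum : ∑' k, (∫⁻ e, ENNReal.ofReal (W e) * p e k ∂π) * ENNReal.ofReal (l k) =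
      ENNReal.ofReal (∫ e, W e * expLoss (p e) l ∂π) := by
    rw [ofReal_integral_eq_lintegral_ofReal hi2
      (Eventually.of_forall fun e => mul_nonneg (h0 e) (expLoss_nonneg _ _))]
    have e1 : ∀ e, ENNReal.ofReal (W e * expLoss (p e) l) =
        ∑' k, ENNReal.ofReal (W e) * p e k * ENNReal.ofReal (l k) := by
      intro e
      rw [ENNReal.ofReal_mul (h0 e), expLoss, ENNReal.ofReal_toReal
        (ne_top_of_le_ne_top ENNReal.ofReal_ne_top (tsum_mul_ofReal_le (hp1 e) fun k _ => hl k)),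
        ← ENNReal.tsum_mul_left]
      simp only [mul_assoc]
    have hm : ∀ k, Measurable fun e => ENNReal.ofReal (W e) * p e k := fun k =>
      hW.ennreal_ofReal.mul (hp k)
    simp only [e1]
    rw [lintegral_tsum fun k => ((hm k).mul_const _).aemeasurable]
    refine tsum_congr fun k => ?_
    rw [lintegral_mul_const _ (hm k)]
  have e2 : ∑' k, mixture π W p k * ENNReal.ofReal (l k) =
      ENNReal.ofReal (∫ e, W e * expLoss (p e) l ∂π) / ENNReal.ofReal (∫ e, W e ∂π) := by
    rw [← hnum, ← hZ, div_eq_mul_inv, ← ENNReal.tsum_mul_right]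
    refine tsum_congr fun k => ?_
    rw [mixture, div_eq_mul_inv]
    ring
  rw [expLoss, e2, ENNReal.toReal_div, ENNReal.toReal_ofReal
    (integral_nonneg fun e => mul_nonneg (h0 e) (expLoss_nonneg _ _)),
    ENNReal.toReal_ofReal (integral_nonneg h0)]

theorem exists_ne_zero_of_mixture_ne_zero {k : ℕ} (h : mixture π W p k ≠ 0) :
    ∃ e, p e k ≠ 0 := by
  by_contra! hall
  exact h (by simp [mixture, hall])

end ExpLoss

/-- A family of randomized strategies indexed by `E`: at step `t`, along the instances `h.1` and the
values `h.2`, the strategy `e` predicts the value with index `k` with probability `w t (e, h) k`. -/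
structure StrategyFamily (E X Y : Type*) [MeasurableSpace E] [MeasurableSpace X]
    [MeasurableSpace Y] where
  w : ℕ → E × ((ℕ → X) × (ℕ → Y)) → ℕ → ENNReal
  measurable_w : ∀ t k, Measurable fun p => w t p k
  tsum_w : ∀ t p, ∑' k, w t p k = 1
  w_congr : ∀ t e h h', (∀ s ≤ t, h.1 s = h'.1 s) → (∀ s < t, h.2 s = h'.2 s) →
    w t (e, h) = w t (e, h')

namespace StrategyFamily

variable {E X Y : Type*} [MeasurableSpace E] [MeasurableSpace X] [MeasurableSpace Y]
  (F : StrategyFamily E X Y)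

/-- The mean loss at step `t` of the strategies. -/
noncomputable def lossAt (g : ℕ → ℕ → Y → ℝ) (t : ℕ) (p : E × ((ℕ → X) × (ℕ → Y))) : ℝ :=
  expLoss (F.w t p) fun k => g t k (p.2.2 t)

/-- The mean loss before step `t` of the strategies. -/
noncomputable def lossBefore (g : ℕ → ℕ → Y → ℝ) (t : ℕ) (p : E × ((ℕ → X) × (ℕ → Y))) : ℝ :=
  ∑ s ∈ Finset.range t, F.lossAt g s p

variable {g : ℕ → ℕ → Y → ℝ}

theorem measurable_lossAt (hg : ∀ t k, Measurable (g t k)) (t : ℕ) :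
    Measurable (F.lossAt g t) :=
  measurable_expLoss (F.measurable_w t) fun k =>
    (hg t k).comp ((measurable_pi_apply t).comp (measurable_snd.comp measurable_snd))

theorem measurable_lossBefore (hg : ∀ t k, Measurable (g t k)) (t : ℕ) :
    Measurable (F.lossBefore g t) :=
  Finset.measurable_sum _ fun s _ => F.measurable_lossAt hg s

theorem lossAt_nonneg (t : ℕ) (p : E × ((ℕ → X) × (ℕ → Y))) : 0 ≤ F.lossAt g t p :=
  expLoss_nonneg _ _

theorem lossBefore_nonneg (t : ℕ) (p : E × ((ℕ → X) × (ℕ → Y))) : 0 ≤ F.lossBefore g t p :=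
  Finset.sum_nonneg fun s _ => F.lossAt_nonneg s p

theorem lossBefore_congr {t : ℕ} {e : E} {h h' : (ℕ → X) × (ℕ → Y)}
    (hx : ∀ s < t, h.1 s = h'.1 s) (hy : ∀ s < t, h.2 s = h'.2 s) :
    F.lossBefore g t (e, h) = F.lossBefore g t (e, h') := by
  refine Finset.sum_congr rfl fun s hs => ?_
  have hs' := Finset.mem_range.1 hs
  rw [lossAt, lossAt, F.w_congr s e h h' (fun i hi => hx i (hi.trans_lt hs'))
    fun i hi => hy i (hi.trans hs')]
  simp only [hy s hs']

/-- The exponentially weighted mixture of a family of strategies. -/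
noncomputable def hedge (π : Measure E) [IsProbabilityMeasure π] (β : ℕ → ℝ) (hβ : ∀ t, 0 < β t)
    (g : ℕ → ℕ → Y → ℝ) (hg : ∀ t k, Measurable (g t k)) : StrategyFamily Unit X Y where
  w t q := mixture π (fun e => Real.exp (-(β t * F.lossBefore g t (e, q.2))))
    fun e => F.w t (e, q.2)
  measurable_w t k := by
    have hW : Measurable fun p : E × ((ℕ → X) × (ℕ → Y)) =>
        ENNReal.ofReal (Real.exp (-(β t * F.lossBefore g t p))) :=
      (Real.measurable_exp.comp ((F.measurable_lossBefore hg t).const_mul _).neg).ennreal_ofReal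
    have h1 := (hW.mul (F.measurable_w t k)).lintegral_prod_left' (μ := π)
    have h2 := hW.lintegral_prod_left' (μ := π)
    exact (h1.div h2).comp measurable_snd
  tsum_w t q := by
    have hS := (F.measurable_lossBefore hg t).comp (measurable_prodMk_right (y := q.2))
    exact tsum_mixture (Real.measurable_exp.comp (hS.const_mul _).neg)
      (integrable_exp_neg (hβ t).le hS fun e => F.lossBefore_nonneg t _)
      (fun e => (Real.exp_pos _).le) (partition_pos (hβ t).le hS fun e => F.lossBefore_nonneg t _)
      (fun k => (F.measurable_w t k).comp measurable_prodMk_right) fun e => F.tsum_w t _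
  w_congr t _ h h' hx hy := by
    have h1 : ∀ e, F.lossBefore g t (e, h) = F.lossBefore g t (e, h') := fun e =>
      F.lossBefore_congr (fun s hs => hx s hs.le) hy
    simp only [h1, F.w_congr t _ h h' hx hy]

variable {π : Measure E} [IsProbabilityMeasure π] {β : ℕ → ℝ} {hβ : ∀ t, 0 < β t}
  {hg : ∀ t k, Measurable (g t k)}

theorem exists_of_hedge_ne_zero {t k : ℕ} {q : Unit × ((ℕ → X) × (ℕ → Y))}
    (h : (F.hedge π β hβ g hg).w t q k ≠ 0) : ∃ e, F.w t (e, q.2) k ≠ 0 :=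
  exists_ne_zero_of_mixture_ne_zero h

theorem lossBefore_hedge_le {b : ℕ → ℝ} (hanti : Antitone β) (hb0 : ∀ t, 0 ≤ b t)
    (hb : ∀ t k y, g t k y ≤ b t) (q : Unit × ((ℕ → X) × (ℕ → Y))) {T : ℕ} {G : Set E}
    (hG : MeasurableSet G) (hpos : 0 < π.real G) {s : ℝ}
    (hs : ∀ e ∈ G, F.lossBefore g T (e, q.2) ≤ s) :
    (F.hedge π β hβ g hg).lossBefore g T q ≤
      s + -Real.log (π.real G) / β T + ∑ t ∈ Finset.range T, β t * b t ^ 2 / 2 := by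
  have hm : ∀ t, Measurable fun e => F.lossAt g t (e, q.2) := fun t =>
    (F.measurable_lossAt hg t).comp measurable_prodMk_right
  have h1 := sum_hedgeLoss_le (π := π) hβ hanti hm (fun t e => F.lossAt_nonneg t (e, q.2))
    (fun t e => expLoss_le (F.tsum_w t _) (hb0 t) fun k _ => hb t k _) T
  have h2 : ∀ t, (F.hedge π β hβ g hg).lossAt g t q = hedgeLoss π (β t)
      (fun e => ∑ s ∈ Finset.range t, F.lossAt g s (e, q.2)) fun e => F.lossAt g t (e, q.2) := by
    intro t
    have hS := (F.measurable_lossBefore hg t).comp (measurable_prodMk_right (y := q.2))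
    exact expLoss_mixture (p := fun e => F.w t (e, q.2)) (Real.measurable_exp.comp (hS.const_mul _).neg)
      (integrable_exp_neg (hβ t).le hS fun e => F.lossBefore_nonneg t _)
      (fun e => (Real.exp_pos _).le)
      (fun k => (F.measurable_w t k).comp measurable_prodMk_right) (fun e => F.tsum_w t _)
      (fun k => hb t k _)
  have h3 := neg_log_partition_div_le (π := π) (hβ T)
    ((F.measurable_lossBefore hg T).comp (measurable_prodMk_right (y := q.2)))
    (fun e => F.lossBefore_nonneg T (e, q.2)) hG hpos hs
  rw [lossBefore]
  simp only [h2]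
  exact h1.trans (by gcongr; exact h3)

end StrategyFamily


/-! ### A finite-time rule restarted in blocks on every cluster -/

section Blocks

variable {Z : Type*}

/-- Record a value in the buffer of a block of length `τ`; a complete block is closed. -/
def recordValue (τ : ℕ) (s : ℕ × (ℕ → Z)) (z : Z) : ℕ × (ℕ → Z) :=
  (if s.1 + 1 = τ then 0 else s.1 + 1, Function.update s.2 s.1 z)

open Classical in
/-- The current block (its length and buffer) of every cluster, before step `t`: the value `z t` is
recorded in the cluster `c t` if step `t` is accepted. -/
noncomputable def blockState (τ : ℕ) (z₀ : Z) (c : ℕ → ℕ) (z : ℕ → Z) (acc : ℕ → Prop) :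
    ℕ → ℕ → ℕ × (ℕ → Z)
  | 0, _ => (0, fun _ => z₀)
  | t + 1, i => if acc t ∧ i = c t then recordValue τ (blockState τ z₀ c z acc t i) (z t)
      else blockState τ z₀ c z acc t i

variable {τ : ℕ} {z₀ : Z} {c : ℕ → ℕ} {z : ℕ → Z} {acc : ℕ → Prop}

theorem blockState_succ_of_not {t i : ℕ} (h : ¬ (acc t ∧ i = c t)) :
    blockState τ z₀ c z acc (t + 1) i = blockState τ z₀ c z acc t i := if_neg h

theorem blockState_succ_of_acc {t : ℕ} (h : acc t) :
    blockState τ z₀ c z acc (t + 1) (c t) = recordValue τ (blockState τ z₀ c z acc t (c t)) (z t) :=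
  if_pos ⟨h, rfl⟩

theorem blockState_congr {c' : ℕ → ℕ} {z' : ℕ → Z} {acc' : ℕ → Prop} {t : ℕ}
    (hc : ∀ s < t, c s = c' s) (hz : ∀ s < t, z s = z' s) (ha : ∀ s < t, acc s ↔ acc' s) (i : ℕ) :
    blockState τ z₀ c z acc t i = blockState τ z₀ c' z' acc' t i := by
  induction t with
  | zero => rfl
  | succ t ih =>
    have ih' := ih (fun s hs => hc s (hs.trans t.lt_succ_self))
      (fun s hs => hz s (hs.trans t.lt_succ_self)) fun s hs => ha s (hs.trans t.lt_succ_self)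
    have h1 : (acc t ∧ i = c t) ↔ (acc' t ∧ i = c' t) := by
      rw [ha t t.lt_succ_self, hc t t.lt_succ_self]
    simp only [blockState, ih', hz t t.lt_succ_self]
    split_ifs <;> first | rfl | tauto

theorem blockState_fst_lt (hτ : 1 ≤ τ) (t i : ℕ) : (blockState τ z₀ c z acc t i).1 < τ := by
  induction t with
  | zero => exact hτ
  | succ t ih =>
    by_cases h : acc t ∧ i = c t
    · rw [h.2, blockState_succ_of_acc h.1, ← h.2, recordValue]
      simp only
      split_ifs <;> omega
    · rwa [blockState_succ_of_not h]

theorem blockState_fst_eq_zero {t i : ℕ} (h : ∀ s < t, c s ≠ i) :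
    (blockState τ z₀ c z acc t i).1 = 0 := by
  induction t with
  | zero => rfl
  | succ t ih =>
    rw [blockState_succ_of_not fun h' => h t t.lt_succ_self h'.2.symm]
    exact ih fun s hs => h s (hs.trans t.lt_succ_self)

-- Each cluster carries the regret of its open block minus `η` times the length of that block. With
-- these potentials added to `η * T`, the bound is kept at every accepted step: extending a block
-- adds its new regret, and closing a block discards a regret of at most `η * τ`. At the end only
-- the open blocks remain, at most `τ * C` per cluster.
open Classical in
theorem sum_block_regret_le (hτ : 1 ≤ τ) (hc : ∀ t, c t ≤ t) {η C : ℝ} (hη : 0 ≤ η)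
    {L : ℕ → (ℕ → Z) → Z → ℝ} {v : Z → Z → ℝ}
    (hL : ∀ j b b' z, (∀ i < j, b i = b' i) → L j b z = L j b' z)
    (hC : ∀ j b z, L j b z ≤ C) (hC0 : 0 ≤ C) (hv : ∀ u z, 0 ≤ v u z)
    (hreg : ∀ b u, ∑ j ∈ Finset.range τ, (L j b (b j) - v u (b j)) ≤ η * τ) (u : ℕ → Z) (T : ℕ) :
    ∑ t ∈ Finset.range T, (if acc t then
      L (blockState τ z₀ c z acc t (c t)).1 (blockState τ z₀ c z acc t (c t)).2 (z t)
        - v (u (c t)) (z t) else 0) ≤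
      η * T + τ * C * ((Finset.range T).image c).card := by
  let partialRegret : ℕ × (ℕ → Z) → Z → ℝ := fun s u =>
    ∑ j ∈ Finset.range s.1, (L j s.2 (s.2 j) - v u (s.2 j))
  let pot : ℕ → ℕ → ℝ := fun t i =>
    partialRegret (blockState τ z₀ c z acc t i) (u i) - η * (blockState τ z₀ c z acc t i).1
  have hpot0 : ∀ t i, (∀ s < t, c s ≠ i) → pot t i = 0 := by
    intro t i h
    simp only [pot, partialRegret, blockState_fst_eq_zero h]
    simp
  have key : ∀ T, ∑ t ∈ Finset.range T, (if acc t then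
      L (blockState τ z₀ c z acc t (c t)).1 (blockState τ z₀ c z acc t (c t)).2 (z t)
        - v (u (c t)) (z t) else 0) ≤ ∑ i ∈ Finset.range T, pot T i + η * T := by
    intro T
    induction T with
    | zero => simp
    | succ T ih =>
      -- Founders satisfy `c s ≤ s`, so the cluster `T` is still empty and the sum of potentials may
      -- include it for free.
      have h0 : pot T T = 0 := hpot0 T T fun s hs => by
        have := hc s
        omega
      rw [Finset.sum_range_succ]
      have h1 : ∑ i ∈ Finset.range T, pot T i = ∑ i ∈ Finset.range (T + 1), pot T i := by
        rw [Finset.sum_range_succ, h0, add_zero]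
      rw [h1] at ih
      push_cast
      have hrange : c T ∈ Finset.range (T + 1) := Finset.mem_range.2 (Nat.lt_succ_of_le (hc T))
      have h2 : ∑ i ∈ Finset.range (T + 1), pot (T + 1) i =
          ∑ i ∈ Finset.range (T + 1), pot T i + (pot (T + 1) (c T) - pot T (c T)) := by
        rw [← sub_eq_iff_eq_add', ← Finset.sum_sub_distrib]
        refine Finset.sum_eq_single (c T) (fun i _ hi => ?_) fun h => absurd hrange h
        simp only [pot, blockState_succ_of_not (fun h : acc T ∧ i = c T => hi h.2), sub_self]
      by_cases ha : acc T
      swap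
      · rw [if_neg ha, h2]
        have : pot (T + 1) (c T) = pot T (c T) := by
          simp only [pot, blockState_succ_of_not (fun h : acc T ∧ c T = c T => ha h.1)]
        rw [this]
        linarith
      rw [if_pos ha, h2]
      have hst := blockState_succ_of_acc (τ := τ) (z₀ := z₀) (c := c) (z := z) ha
      have hlt : (blockState τ z₀ c z acc T (c T)).1 < τ := blockState_fst_lt hτ T (c T)
      simp only [pot, hst]
      set s := blockState τ z₀ c z acc T (c T)
      -- Recording a value leaves the earlier summands unchanged, since `L j` depends only on the
      -- entries before `j`.
      have hsum : ∑ j ∈ Finset.range (s.1 + 1), (L j (Function.update s.2 s.1 (z T))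
          (Function.update s.2 s.1 (z T) j) - v (u (c T)) (Function.update s.2 s.1 (z T) j)) =
          partialRegret s (u (c T)) + (L s.1 s.2 (z T) - v (u (c T)) (z T)) := by
        rw [Finset.sum_range_succ, Function.update_self]
        congr 1
        · refine Finset.sum_congr rfl fun j hj => ?_
          have hj' := Finset.mem_range.1 hj
          rw [Function.update_of_ne hj'.ne,
            hL j (Function.update s.2 s.1 (z T)) s.2 (s.2 j) fun i hi =>
              Function.update_of_ne (hi.trans hj').ne _ _]
        · rw [hL s.1 (Function.update s.2 s.1 (z T)) s.2 (z T) fun i hi =>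
            Function.update_of_ne hi.ne _ _]
      by_cases hfull : s.1 + 1 = τ
      · have h3 := hreg (Function.update s.2 s.1 (z T)) (u (c T))
        rw [← hfull, hsum] at h3
        push_cast at h3
        have h4 : partialRegret (recordValue τ s (z T)) (u (c T)) = 0 := by
          simp only [partialRegret, recordValue, if_pos hfull, Finset.range_zero, Finset.sum_empty]
        have h5 : (recordValue τ s (z T)).1 = 0 := if_pos hfull
        rw [h4, h5]
        push_cast
        linarith
      · have h4 : partialRegret (recordValue τ s (z T)) (u (c T)) =
            partialRegret s (u (c T)) + (L s.1 s.2 (z T) - v (u (c T)) (z T)) := by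
          rw [← hsum]
          simp only [partialRegret, recordValue, if_neg hfull]
        have h5 : (recordValue τ s (z T)).1 = s.1 + 1 := if_neg hfull
        rw [h4, h5]
        push_cast
        linarith
  refine (key T).trans ?_
  have hpot : ∀ i, pot T i ≤ if i ∈ (Finset.range T).image c then τ * C else 0 := by
    intro i
    split_ifs with hi
    · have h1 : partialRegret (blockState τ z₀ c z acc T i) (u i) ≤ τ * C := by
        set s := blockState τ z₀ c z acc T i
        have hlt : s.1 < τ := blockState_fst_lt hτ T i
        calc partialRegret s (u i) ≤ ∑ j ∈ Finset.range s.1, C := Finset.sum_le_sum fun j _ => by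
              have := hC j s.2 (s.2 j)
              have := hv (u i) (s.2 j)
              linarith
          _ = s.1 * C := by simp
          _ ≤ τ * C := by gcongr
      have h2 : 0 ≤ η * ((blockState τ z₀ c z acc T i).1 : ℝ) := by positivity
      simp only [pot]
      linarith
    · refine (hpot0 T i fun s hs h => hi ?_).le
      exact Finset.mem_image.2 ⟨s, Finset.mem_range.2 hs, h⟩
  have hsub : (Finset.range T).image c ⊆ Finset.range T := by
    intro i hi
    obtain ⟨s, hs, rfl⟩ := Finset.mem_image.1 hi
    exact Finset.mem_range.2 ((hc s).trans_lt (Finset.mem_range.1 hs))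
  have h1 := Finset.sum_le_sum fun i (_ : i ∈ Finset.range T) => hpot i
  rw [Finset.sum_ite_mem, Finset.inter_eq_right.2 hsub, Finset.sum_const, nsmul_eq_mul] at h1
  linarith

variable [MeasurableSpace Z]

theorem measurable_recordValue (τ : ℕ) :
    Measurable fun p : (ℕ × (ℕ → Z)) × Z => recordValue τ p.1 p.2 := by
  classical
  refine Measurable.prodMk ?_ (measurable_pi_lambda _ fun i => ?_)
  · exact (measurable_of_countable fun n : ℕ => if n + 1 = τ then 0 else n + 1).comp
      (measurable_fst.comp measurable_fst)
  · simp only [Function.update_apply]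
    refine Measurable.ite ?_ measurable_snd
      ((measurable_pi_apply i).comp (measurable_snd.comp measurable_fst))
    exact measurableSet_eq_fun measurable_const (measurable_fst.comp measurable_fst)

theorem measurable_blockState {Ω : Type*} [MeasurableSpace Ω] {τ : ℕ} {z₀ : Z} {c : Ω → ℕ → ℕ}
    {z : Ω → ℕ → Z} {acc : Ω → ℕ → Prop} (hc : ∀ t, Measurable fun ω => c ω t)
    (hz : ∀ t, Measurable fun ω => z ω t) (ha : ∀ t, MeasurableSet {ω | acc ω t}) (t i : ℕ) :
    Measurable fun ω => blockState τ z₀ (c ω) (z ω) (acc ω) t i := by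
  classical
  induction t with
  | zero => exact measurable_const
  | succ t ih =>
    simp only [blockState]
    refine Measurable.ite ?_ ((measurable_recordValue τ).comp (ih.prodMk (hz t))) ih
    exact (ha t).inter (measurableSet_eq_fun measurable_const (hc t))

theorem measurable_blockState_cluster {Ω : Type*} [MeasurableSpace Ω] {τ : ℕ} {z₀ : Z}
    {c : Ω → ℕ → ℕ} {z : Ω → ℕ → Z} {acc : Ω → ℕ → Prop} (hc : ∀ t, Measurable fun ω => c ω t)
    (hz : ∀ t, Measurable fun ω => z ω t) (ha : ∀ t, MeasurableSet {ω | acc ω t}) (t : ℕ) :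
    Measurable fun ω => blockState τ z₀ (c ω) (z ω) (acc ω) t (c ω t) := by
  have h1 : Measurable fun p : Ω × ℕ => blockState τ z₀ (c p.1) (z p.1) (acc p.1) t p.2 :=
    measurable_from_prod_countable_left fun i => measurable_blockState hc hz ha t i
  exact h1.comp (measurable_id.prodMk (hc t))

end Blocks


/-! ### From F-TiME on a ball to a discretized block rule -/

section Loss

variable {Y : Type*} [MetricSpace Y]

theorem loss_nonneg (α : ℝ) (y z : Y) : 0 ≤ loss α y z := Real.rpow_nonneg dist_nonneg _

theorem loss_mono {α : ℝ} (hα : 0 ≤ α) {y z y' z' : Y} (h : dist y z ≤ dist y' z') :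
    loss α y z ≤ loss α y' z' := Real.rpow_le_rpow dist_nonneg h hα

theorem loss_le_rpow {α : ℝ} (hα : 0 ≤ α) {y z : Y} {r : ℝ} (h : dist y z ≤ r) :
    loss α y z ≤ r ^ α := Real.rpow_le_rpow dist_nonneg h hα

theorem mem_lossBall_rpow {α : ℝ} (hα : 0 < α) {y z : Y} {r : ℝ} (hr : 0 ≤ r) :
    z ∈ lossBall α y (r ^ α) ↔ dist y z < r :=
  Real.rpow_lt_rpow_iff dist_nonneg hr hα

/-- On bounded sets the loss is uniformly continuous. -/
theorem exists_loss_le_add {α : ℝ} (hα : 0 < α) (K : ℝ) {η : ℝ} (hη : 0 < η) :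
    ∃ δ, 0 < δ ∧ δ ≤ 1 ∧ ∀ a b y : Y, dist a b < δ → dist a y ≤ K →
      dist b y ≤ K → loss α a y ≤ loss α b y + η := by
  have hc : UniformContinuousOn (fun s : ℝ => s ^ α) (Set.Icc 0 K) :=
    isCompact_Icc.uniformContinuousOn_of_continuous
      (Real.continuous_rpow_const hα.le).continuousOn
  obtain ⟨δ, hδ, h⟩ := Metric.uniformContinuousOn_iff.1 hc η hη
  refine ⟨min δ 1, lt_min hδ one_pos, min_le_right _ _, fun a b y hab ha hb => ?_⟩
  have h1 := h (dist a y) ⟨dist_nonneg, ha⟩ (dist b y) ⟨dist_nonneg, hb⟩ (by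
    rw [Real.dist_eq]
    exact (abs_dist_sub_le a b y).trans_lt (hab.trans_le (min_le_left _ _)))
  rw [Real.dist_eq] at h1
  have := (abs_lt.1 h1).2
  rw [loss, loss]
  linarith

variable [MeasurableSpace Y] [BorelSpace Y] [SecondCountableTopology Y]

theorem measurable_loss (α : ℝ) : Measurable fun p : Y × Y => loss α p.1 p.2 :=
  (measurable_fst.dist measurable_snd).pow_const α

end Loss

section BlockRule

variable {Y : Type*} [MetricSpace Y] [MeasurableSpace Y] [BorelSpace Y]
  [SecondCountableTopology Y]

theorem exists_measurable_index {d : ℕ → Y} (hd : DenseRange d) {δ : ℝ} (hδ : 0 < δ) :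
    ∃ κ : Y → ℕ, Measurable κ ∧ ∀ y, dist (d (κ y)) y < δ := by
  classical
  have hex : ∀ y, ∃ k, dist (d k) y < δ := fun y => by
    obtain ⟨k, hk⟩ := hd.exists_dist_lt y hδ
    exact ⟨k, by rwa [dist_comm]⟩
  refine ⟨fun y => Nat.find (hex y), measurable_find hex fun k => ?_, fun y => Nat.find_spec (hex y)⟩
  exact measurableSet_lt (measurable_const.dist measurable_id) measurable_const

/-- Round the F-TiME predictions to points of the dense sequence. Uniform continuity of the loss on
bounded sets makes the rounding cost at most `η / 2` per step, and F-TiME supplies the other half.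
Each step uses its own draw only, so the expectation over all draws splits into one-step means. -/
theorem exists_block_rule {α : ℝ} (hα : 0 < α) {y₀ : Y} {R : ℝ} (hR : 0 < R)
    (hB : FTiME (lossBall α y₀ (R ^ α)) α) {d : ℕ → Y} (hd : DenseRange d) {η : ℝ} (hη : 0 < η) :
    ∃ τ : ℕ, 1 ≤ τ ∧ ∃ q : ℕ → (ℕ → lossBall α y₀ (R ^ α)) → ℕ → ENNReal,
      (∀ j k, Measurable fun b => q j b k) ∧ (∀ j b, ∑' k, q j b k = 1) ∧
      (∀ j b b', (∀ i < j, b i = b' i) → q j b = q j b') ∧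
      (∀ j b k, q j b k ≠ 0 → dist y₀ (d k) ≤ R + 1) ∧
      ∀ (b : ℕ → lossBall α y₀ (R ^ α)) (u : lossBall α y₀ (R ^ α)), ∑ j ∈ Finset.range τ,
        (expLoss (q j b) (fun k => loss α (d k) (b j)) - loss α (u : Y) (b j)) ≤ η * τ := by
  set B := lossBall α y₀ (R ^ α) with hBdef
  have hmem : ∀ z : B, dist y₀ (z : Y) < R := fun z => (mem_lossBall_rpow hα hR.le).1 z.2
  -- Rounded predictions are within `R + δ ≤ R + 1` of the center and the values within `R`, so the
  -- relevant distances are at most `2 * R + 1`.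
  obtain ⟨δ, hδ, hδ1, hunif⟩ := exists_loss_le_add (Y := Y) hα (2 * R + 1) (half_pos hη)
  obtain ⟨κ, hκ, hκd⟩ := exists_measurable_index hd hδ
  obtain ⟨τ, hτ, g, hg⟩ := hB (η / 2) (half_pos hη)
  let pr : ℕ → (ℕ → B) → g.R → B := fun j b r => g.prediction j r (fun _ => ()) b
  have hpr : ∀ j, Measurable fun p : (ℕ → B) × g.R => pr j p.1 p.2 := fun j =>
    measurable_prediction g measurable_snd (fun s => measurable_const)
      fun s => (measurable_pi_apply s).comp measurable_fst
  have hprb : ∀ j b, Measurable (pr j b) := fun j b => (hpr j).comp measurable_prodMk_left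
  let ix : ℕ → (ℕ → B) → g.R → ℕ := fun j b r => κ (pr j b r)
  have hix : ∀ j, Measurable fun p : (ℕ → B) × g.R => ix j p.1 p.2 := fun j =>
    hκ.comp (measurable_subtype_coe.comp (hpr j))
  have hixb : ∀ j b, Measurable (ix j b) := fun j b => (hix j).comp measurable_prodMk_left
  let q : ℕ → (ℕ → B) → ℕ → ENNReal := fun j b k => g.law j (ix j b ⁻¹' {k})
  have hdk : ∀ j b r, dist y₀ (d (ix j b r)) < R + δ := fun j b r => by
    have h1 := dist_triangle y₀ (pr j b r : Y) (d (ix j b r))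
    have h2 := hκd (pr j b r : Y)
    have h3 := hmem (pr j b r)
    rw [dist_comm] at h2
    exact h1.trans_lt (add_lt_add h3 h2)
  have hdiam : ∀ a b : B, dist (a : Y) b ≤ 2 * R + 1 := fun a b => by
    have h1 := dist_triangle_left (a : Y) b y₀
    have h2 := hmem a
    have h3 := hmem b
    linarith
  have hlint : ∀ j b (l : ℕ → ℝ), ∑' k, q j b k * ENNReal.ofReal (l k) =
      ∫⁻ r, ENNReal.ofReal (l (ix j b r)) ∂(g.law j) := by
    intro j b l
    have h1 : ∫⁻ r, ENNReal.ofReal (l (ix j b r)) ∂(g.law j) =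
        ∫⁻ k, ENNReal.ofReal (l k) ∂((g.law j).map (ix j b)) :=
      (lintegral_map (f := fun k => ENNReal.ofReal (l k)) (measurable_of_countable _)
        (hixb j b)).symm
    rw [h1, lintegral_countable']
    refine tsum_congr fun k => ?_
    rw [Measure.map_apply (hixb j b) (measurableSet_singleton k), mul_comm]
  have hlossm : ∀ j b (z : B), Measurable fun r => loss α (pr j b r : Y) z := fun j b z =>
    (measurable_loss α).comp ((measurable_subtype_coe.comp (hprb j b)).prodMk measurable_const)
  have hint : ∀ j b (z : B), Integrable (fun r => loss α (pr j b r : Y) z) (g.law j) :=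
    fun j b z => Integrable.of_bound (hlossm j b z).aestronglyMeasurable ((2 * R + 1) ^ α)
      (Eventually.of_forall fun r => by
        rw [Real.norm_of_nonneg (loss_nonneg _ _ _)]
        exact loss_le_rpow hα.le (hdiam _ _))
  have hexp : ∀ j b (z : B), expLoss (q j b) (fun k => loss α (d k) z) ≤
      ∫ r, loss α (pr j b r : Y) z ∂(g.law j) + η / 2 := by
    intro j b z
    have h1 : Integrable (fun r => loss α (pr j b r : Y) z + η / 2) (g.law j) :=
      (hint j b z).add (integrable_const _)
    have h2 : ∫ r, (loss α (pr j b r : Y) z + η / 2) ∂(g.law j) =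
        ∫ r, loss α (pr j b r : Y) z ∂(g.law j) + η / 2 := by
      rw [integral_add (hint j b z) (integrable_const _)]
      simp
    have h0 : ∀ r, 0 ≤ loss α (pr j b r : Y) z + η / 2 := fun r => by
      have := loss_nonneg α (pr j b r : Y) z
      linarith
    rw [expLoss, hlint, ← h2]
    refine ENNReal.toReal_le_of_le_ofReal (integral_nonneg h0) ?_
    rw [ofReal_integral_eq_lintegral_ofReal h1 (Eventually.of_forall h0)]
    refine lintegral_mono fun r => ENNReal.ofReal_le_ofReal ?_
    refine hunif _ _ _ (hκd _) ?_ (hdiam _ _)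
    have h3 := dist_triangle_left (d (ix j b r)) z y₀
    have h4 := hdk j b r
    have h5 := hmem z
    have h6 : dist (d (κ (pr j b r : Y))) (z : Y) = dist (d (ix j b r)) z := rfl
    linarith
  refine ⟨τ, hτ, q, fun j k => ?_, fun j b => ?_, fun j b b' h => ?_, fun j b k hk => ?_,
    fun b u => ?_⟩
  · exact measurable_measure_prodMk_left (hix j (measurableSet_singleton k))
  · have h1 := hlint j b fun _ => 1
    simpa using h1
  · have h1 : ix j b = ix j b' := by
      ext r
      exact congrArg (fun z : B => κ z) (prediction_congr h)
    simp only [q, h1]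
  · obtain ⟨r, hr⟩ := nonempty_of_measure_ne_zero hk
    have h1 := hdk j b r
    rw [show ix j b r = k from hr] at h1
    linarith
  · obtain ⟨-, h2⟩ := hg b u
    have heval : ∀ j, ∫ r, loss α (pr j b (r j) : Y) (b j) ∂(Measure.infinitePi g.law) =
        ∫ r, loss α (pr j b r : Y) (b j) ∂(g.law j) := by
      intro j
      have h3 := integral_map (μ := Measure.infinitePi g.law)
        (measurable_pi_apply j).aemeasurable (f := fun r => loss α (pr j b r : Y) (b j))
        (hlossm j b (b j)).aestronglyMeasurable
      rw [Measure.infinitePi_map_eval] at h3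
      exact h3.symm
    have hint' : ∀ j, Integrable (fun r : ℕ → g.R => loss α (pr j b (r j) : Y) (b j))
        (Measure.infinitePi g.law) := fun j =>
      (measurePreserving_eval_infinitePi g.law j).integrable_comp_of_integrable (hint j b (b j))
    have h4 : ∫ r : ℕ → g.R, ∑ t ∈ Finset.range τ,
        (loss α (g.prediction t (r t) (fun _ => ()) b) (b t) - loss α u (b t))
        ∂(Measure.infinitePi g.law) = ∑ t ∈ Finset.range τ,
          (∫ r, loss α (pr t b r : Y) (b t) ∂(g.law t) - loss α (u : Y) (b t)) := by
      have h5 : ∀ t, Integrable (fun r : ℕ → g.R =>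
          loss α (pr t b (r t) : Y) (b t) - loss α (u : Y) (b t)) (Measure.infinitePi g.law) :=
        fun t => (hint' t).sub (integrable_const _)
      refine (integral_finsetSum _ fun t _ => h5 t).trans (Finset.sum_congr rfl fun t _ => ?_)
      rw [integral_sub (hint' t) (integrable_const _), heval]
      simp
    rw [h4, one_div_mul_eq_div, div_le_iff₀ (by exact_mod_cast hτ)] at h2
    calc ∑ j ∈ Finset.range τ, (expLoss (q j b) (fun k => loss α (d k) (b j)) - loss α (u : Y) (b j))
        ≤ ∑ j ∈ Finset.range τ,
          ((∫ r, loss α (pr j b r : Y) (b j) ∂(g.law j) - loss α (u : Y) (b j)) + η / 2) :=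
          Finset.sum_le_sum fun j _ => by
            have := hexp j b (b j)
            linarith
      _ ≤ η / 2 * τ + τ * (η / 2) := by
          rw [Finset.sum_add_distrib]
          simp only [Finset.sum_const, Finset.card_range, nsmul_eq_mul]
          linarith
      _ = η * τ := by ring

end BlockRule


/-! ### A prior on labelings and the strategy for one ball -/

section LabelPrior

/-- The label `0` receives mass `exp (-a)` and the other two share the rest: a label `0` costs an
arbitrarily small amount, any other label a fixed amount. -/
theorem exists_label_law {a : ℝ} (ha : 0 < a) : ∃ ν : Measure (Fin 3), IsProbabilityMeasure ν ∧
    ∃ A : ℝ, 0 ≤ A ∧ (∀ i, 0 < ν.real {i}) ∧ -Real.log (ν.real {0}) ≤ a ∧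
      ∀ i, -Real.log (ν.real {i}) ≤ A := by
  have h1 : Real.exp (-a) < 1 := by rw [Real.exp_lt_one_iff]; linarith
  have h0 : 0 < Real.exp (-a) := Real.exp_pos _
  have hp : 0 < (1 - Real.exp (-a)) / 2 := by linarith
  let v : Fin 3 → ℝ := ![Real.exp (-a), (1 - Real.exp (-a)) / 2, (1 - Real.exp (-a)) / 2]
  have hv : ∀ i, 0 < v i := fun i => by fin_cases i <;> simpa [v]
  have hsum : ∑ i, v i = 1 := by
    rw [Fin.sum_univ_three]
    change Real.exp (-a) + (1 - Real.exp (-a)) / 2 + (1 - Real.exp (-a)) / 2 = 1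
    ring
  let ν : Measure (Fin 3) := Measure.sum fun i => ENNReal.ofReal (v i) • Measure.dirac i
  have hνi : ∀ i, ν.real {i} = v i := by
    intro i
    have : ν {i} = ENNReal.ofReal (v i) := by
      rw [Measure.sum_apply _ (measurableSet_singleton i), tsum_fintype,
        Finset.sum_eq_single i]
      · simp
      · intro j _ hj
        simp [hj]
      · simp
    rw [Measure.real, this, ENNReal.toReal_ofReal (hv i).le]
  refine ⟨ν, ⟨?_⟩, ∑ i, |Real.log (v i)|, Finset.sum_nonneg fun i _ => abs_nonneg _, fun i => ?_, ?_,
    fun i => ?_⟩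
  · rw [Measure.sum_apply _ MeasurableSet.univ, tsum_fintype]
    simp only [Measure.smul_apply, measure_univ, smul_eq_mul, mul_one]
    rw [← ENNReal.ofReal_sum_of_nonneg fun i _ => (hv i).le, hsum, ENNReal.ofReal_one]
  · rw [hνi]
    exact hv i
  · rw [hνi]
    change -Real.log (Real.exp (-a)) ≤ a
    rw [Real.log_exp, neg_neg]
  · rw [hνi]
    exact (neg_le_abs _).trans
      (Finset.single_le_sum (f := fun i => |Real.log (v i)|) (fun i _ => abs_nonneg _)
        (Finset.mem_univ i))

variable {ν : Measure (Fin 3)} [IsProbabilityMeasure ν]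

theorem infinitePi_real_agree (e : ℕ → Fin 3) (T : ℕ) :
    (Measure.infinitePi fun _ : ℕ => ν).real (Set.pi (Finset.range T) fun s => {e s}) =
      ∏ s ∈ Finset.range T, ν.real {e s} := by
  rw [Measure.real, Measure.infinitePi_pi _ fun i _ => measurableSet_singleton _,
    ENNReal.toReal_prod]
  rfl

theorem neg_log_infinitePi_agree_le {a A : ℝ} (ha : 0 ≤ a)
    (hpos : ∀ i, 0 < ν.real {i}) (h0 : -Real.log (ν.real {0}) ≤ a)
    (h1 : ∀ i, -Real.log (ν.real {i}) ≤ A) (e : ℕ → Fin 3) (T : ℕ) :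
    -Real.log ((Measure.infinitePi fun _ : ℕ => ν).real
      (Set.pi (Finset.range T) fun s => {e s})) ≤
      A * ((Finset.range T).filter fun t => e t ≠ 0).card + a * T := by
  rw [infinitePi_real_agree, Real.log_prod fun i _ => (hpos _).ne', ← Finset.sum_neg_distrib]
  calc ∑ s ∈ Finset.range T, -Real.log (ν.real {e s})
      ≤ ∑ s ∈ Finset.range T, ((if e s ≠ 0 then A else 0) + a) := by
        refine Finset.sum_le_sum fun s _ => ?_
        by_cases h : e s = 0
        · rw [h]
          simpa using h0
        · rw [if_pos h]
          have := h1 (e s)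
          linarith
    _ = _ := by
        rw [Finset.sum_add_distrib, ← Finset.sum_filter]
        simp only [Finset.sum_const, nsmul_eq_mul, Finset.card_range]
        ring

end LabelPrior

section BlockFamily

variable {X Y Z : Type*} [MeasurableSpace X] [MeasurableSpace.CountablyGenerated X]
  [MeasurableSpace Y] [MeasurableSpace Z]

/-- The strategies that play, on every cluster of an expert, the block rule `q`; only the values in
`B` count, and `pr` maps them to `Z`. -/
noncomputable def blockFamily (τ : ℕ) (z₀ : Z) {pr : Y → Z} (hpr : Measurable pr) {B : Set Y}
    (hB : MeasurableSet B) (q : ℕ → (ℕ → Z) → ℕ → ENNReal)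
    (hq : ∀ j k, Measurable fun b => q j b k) (hq1 : ∀ j b, ∑' k, q j b k = 1) :
    StrategyFamily (ℕ → Fin 3) X Y where
  w t p :=
    let s := blockState τ z₀ (cluster p.1 p.2.1) (fun s => pr (p.2.2 s)) (fun s => p.2.2 s ∈ B) t
      (cluster p.1 p.2.1 t)
    q s.1 s.2
  measurable_w t k := by
    have h1 : Measurable fun s : ℕ × (ℕ → Z) => q s.1 s.2 k :=
      measurable_from_prod_countable_right fun j => hq j k
    refine h1.comp (measurable_blockState_cluster
      (c := fun p : (ℕ → Fin 3) × ((ℕ → X) × (ℕ → Y)) => cluster p.1 p.2.1)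
      (z := fun p s => pr (p.2.2 s)) (acc := fun p s => p.2.2 s ∈ B) (fun s => ?_) (fun s => ?_)
      (fun s => ?_) t)
    · exact (measurable_cluster s).comp
        (measurable_fst.prodMk (measurable_fst.comp measurable_snd))
    · exact hpr.comp ((measurable_pi_apply s).comp (measurable_snd.comp measurable_snd))
    · exact ((measurable_pi_apply s).comp (measurable_snd.comp measurable_snd)) hB
  tsum_w t p := hq1 _ _
  w_congr t e h h' hx hy := by
    have h1 : ∀ s ≤ t, cluster e h.1 s = cluster e h'.1 s := fun s hs =>
      cluster_congr (fun _ _ => rfl) fun i hi => hx i (hi.trans hs)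
    simp only [h1 t le_rfl]
    rw [blockState_congr (fun s hs => h1 s hs.le) (fun s hs => congrArg pr (hy s hs))
      fun s hs => by rw [hy s hs]]

/-- All labelings that agree with `e` before `T` have the same loss before `T`. They form a cylinder
of positive prior mass, which serves as the comparison set for the exponential weights. -/
theorem blockFamily_w_congr {τ : ℕ} {z₀ : Z} {pr : Y → Z} {hpr : Measurable pr} {B : Set Y}
    {hB : MeasurableSet B} {q : ℕ → (ℕ → Z) → ℕ → ENNReal}
    {hq : ∀ j k, Measurable fun b => q j b k} {hq1 : ∀ j b, ∑' k, q j b k = 1} {t : ℕ}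
    {e e' : ℕ → Fin 3} (he : ∀ s ≤ t, e s = e' s) (h : (ℕ → X) × (ℕ → Y)) :
    (blockFamily τ z₀ hpr hB q hq hq1).w t (e, h) =
      (blockFamily τ z₀ hpr hB q hq hq1).w t (e', h) := by
  have h1 : ∀ s ≤ t, cluster e h.1 s = cluster e' h.1 s := fun s hs =>
    cluster_congr (fun i hi => he i (hi.trans hs)) fun _ _ => rfl
  simp only [blockFamily, h1 t le_rfl]
  rw [blockState_congr (fun s hs => h1 s hs.le) (fun _ _ => rfl) fun _ _ => Iff.rfl]

end BlockFamily

/-- Distinct clusters have distinct founders, and founders carry nonzero labels. -/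
theorem card_image_cluster_le {X : Type*} [MeasurableSpace X]
    [MeasurableSpace.CountablyGenerated X] {κ : X → ℕ} {x : ℕ → X} {e : ℕ → Fin 3}
    (h : IsGoodExpert κ x e) (T : ℕ) :
    ((Finset.range T).image (cluster e x)).card ≤
      ((Finset.range T).filter fun t => e t ≠ 0).card := by
  refine Finset.card_le_card fun i hi => ?_
  obtain ⟨s, hs, rfl⟩ := Finset.mem_image.1 hi
  rw [Finset.mem_filter, Finset.mem_range]
  exact ⟨(cluster_le e x s).trans_lt (Finset.mem_range.1 hs), (h.2 s).2⟩

section Level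

variable {X Y : Type*} [MeasurableSpace X] [MeasurableSpace.CountablyGenerated X] [MetricSpace Y]
  [MeasurableSpace Y] [BorelSpace Y] [SecondCountableTopology Y]

-- Run exponential weights over all labelings, each playing the block rule on its clusters. Against
-- a good labeling, the blocks cost `ε / 4` per step, the second-order term `β * C ^ 2 / 2 = ε / 4`,
-- the labels `0` at most `(ε * β / 4) / β = ε / 4`, and the `o(T)` nonzero labels eventually less
-- than the last `ε / 4`. Purity makes `d (κ (x t))` constant on each cluster, as the block regret
-- requires of its comparator.
open Classical in
theorem exists_ball_strategy {α : ℝ} (hα : 0 < α) {y₀ : Y} {R : ℝ} (hR : 0 < R)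
    (hB : FTiME (lossBall α y₀ (R ^ α)) α) {d : ℕ → Y} (hd : DenseRange d) {ε : ℝ} (hε : 0 < ε) :
    ∃ σ : StrategyFamily Unit X Y, (∀ t q k, σ.w t q k ≠ 0 → dist y₀ (d k) ≤ R + 1) ∧
      ∀ (x : ℕ → X) (y : ℕ → Y) (κ : X → ℕ) (e : ℕ → Fin 3), (∀ z, dist y₀ (d (κ z)) < R) →
        IsGoodExpert κ x e → ∀ᶠ T : ℕ in atTop, ∑ t ∈ Finset.range T,
          (if dist y₀ (y t) < R then expLoss (σ.w t ((), (x, y))) (fun k => loss α (d k) (y t)) -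
            loss α (d (κ (x t))) (y t) else 0) ≤ ε * T := by
  set B : Set Y := lossBall α y₀ (R ^ α) with hBdef
  set C : ℝ := (2 * R + 1) ^ α with hCdef
  have hC : 0 < C := Real.rpow_pos_of_pos (by linarith) α
  set β : ℝ := ε / (2 * C ^ 2) with hβdef
  have hβ : 0 < β := by positivity
  obtain ⟨τ, hτ, q, hqm, hq1, hqc, hqs, hqr⟩ := exists_block_rule hα hR hB hd
    (show 0 < ε / 4 by linarith)
  obtain ⟨ν, hν, A, hA, hνpos, hν0, hνA⟩ := exists_label_law (show 0 < ε * β / 4 by positivity)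
  have hmem : ∀ z, z ∈ B ↔ dist y₀ z < R := fun z => mem_lossBall_rpow hα hR.le
  have hy₀ : y₀ ∈ B := (hmem y₀).2 (by rwa [dist_self])
  have hBm : MeasurableSet B := by
    have : B = {z | dist y₀ z < R} := Set.ext hmem
    rw [this]
    exact measurableSet_lt (measurable_const.dist measurable_id) measurable_const
  -- The default value is immaterial: values outside the ball are neither recorded in blocks nor
  -- counted.
  let pr : Y → B := fun y => ⟨if y ∈ B then y else y₀, by split_ifs with h; exacts [h, hy₀]⟩
  have hpr : Measurable pr := (Measurable.ite hBm measurable_id measurable_const).subtype_mk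
  have hpr' : ∀ {y}, y ∈ B → (pr y : Y) = y := fun h => if_pos h
  let F : StrategyFamily (ℕ → Fin 3) X Y := blockFamily τ (⟨y₀, hy₀⟩ : B) hpr hBm q hqm hq1
  let g : ℕ → ℕ → Y → ℝ := fun _ k y => if y ∈ B then min (loss α (d k) y) C else 0
  have hg : ∀ t k, Measurable (g t k) := fun t k => by
    refine Measurable.ite hBm (Measurable.min ?_ measurable_const) measurable_const
    exact (measurable_loss α).comp (measurable_const.prodMk measurable_id)
  have hgC : ∀ t k y, g t k y ≤ C := fun t k y => by
    simp only [g]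
    split_ifs
    exacts [min_le_right _ _, hC.le]
  have hlossC : ∀ {y z : Y}, dist y₀ y ≤ R + 1 → z ∈ B → loss α y z ≤ C := fun {y z} h1 h2 => by
    refine loss_le_rpow hα.le ?_
    have := dist_triangle_left y z y₀
    have := (hmem z).1 h2
    linarith
  have hgl : ∀ (p : ℕ → ENNReal), (∀ k, p k ≠ 0 → dist y₀ (d k) ≤ R + 1) → ∀ t y,
      expLoss p (fun k => g t k y) = if y ∈ B then expLoss p (fun k => loss α (d k) y) else 0 := by
    intro p hp t y
    by_cases hy : y ∈ B
    · rw [if_pos hy]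
      refine expLoss_congr fun k hk => ?_
      simp only [g, if_pos hy]
      exact min_eq_left (hlossC (hp k hk) hy)
    · simp [g, hy, expLoss]
  have hFs : ∀ t p k, F.w t p k ≠ 0 → dist y₀ (d k) ≤ R + 1 := fun t p k hk => hqs _ _ _ hk
  let σ : StrategyFamily Unit X Y := F.hedge (Measure.infinitePi fun _ : ℕ => ν) (fun _ => β)
    (fun _ => hβ) g hg
  have hσs : ∀ t q k, σ.w t q k ≠ 0 → dist y₀ (d k) ≤ R + 1 := fun t q k hk => by
    obtain ⟨e, he⟩ := F.exists_of_hedge_ne_zero hk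
    exact hFs _ _ _ he
  refine ⟨σ, hσs, fun x y κ e hκ he => ?_⟩
  let n : ℕ → ℝ := fun T => (((Finset.range T).filter fun t => e t ≠ 0).card : ℝ)
  have hblock : ∀ T, F.lossBefore g T (e, (x, y)) ≤ ∑ t ∈ Finset.range T,
      (if y t ∈ B then loss α (d (κ (x t))) (y t) else 0) + ε / 4 * T + τ * C * n T := by
    intro T
    have h1 := sum_block_regret_le (z₀ := (⟨y₀, hy₀⟩ : B)) (acc := fun t => y t ∈ B)
      (z := fun t => pr (y t)) hτ (cluster_le e x) (η := ε / 4) (C := C) (by linarith)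
      (L := fun j b z => expLoss (q j b) fun k => loss α (d k) z)
      (v := fun u z => loss α (u : Y) z) (fun j b b' z h => by simp only [hqc j b b' h])
      (fun j b z => expLoss_le (hq1 j b) hC.le fun k hk => hlossC (hqs _ _ _ hk) z.2) hC.le
      (fun u z => loss_nonneg _ _ _) hqr (fun i => ⟨d (κ (x i)), (hmem _).2 (hκ _)⟩) T
    have h2 : (((Finset.range T).image (cluster e x)).card : ℝ) ≤ n T :=
      Nat.cast_le.2 (card_image_cluster_le he T)
    have h3 : τ * C * (((Finset.range T).image (cluster e x)).card : ℝ) ≤ τ * C * n T := by gcongr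
    have h4 : F.lossBefore g T (e, (x, y)) - ∑ t ∈ Finset.range T,
        (if y t ∈ B then loss α (d (κ (x t))) (y t) else 0) ≤ ε / 4 * T + τ * C * n T := by
      refine le_trans (le_of_eq ?_) (h1.trans (add_le_add_right h3 _))
      rw [StrategyFamily.lossBefore, ← Finset.sum_sub_distrib]
      refine Finset.sum_congr rfl fun t _ => ?_
      rw [StrategyFamily.lossAt, hgl _ (hFs t _) t]
      by_cases ht : y t ∈ B
      · simp only [if_pos ht, hpr' ht, (he.2 t).1]
        rfl
      · simp only [if_neg ht, sub_zero]
    linarith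
  have hG : ∀ T, MeasurableSet (Set.pi (Finset.range T) fun s => ({e s} : Set (Fin 3))) := fun T =>
    MeasurableSet.pi (Finset.range T).countable_toSet fun s _ => measurableSet_singleton _
  have hhedge : ∀ T, σ.lossBefore g T ((), (x, y)) ≤ ∑ t ∈ Finset.range T,
      (if y t ∈ B then loss α (d (κ (x t))) (y t) else 0) + 3 * ε / 4 * T +
        (τ * C + A / β) * n T := by
    intro T
    have hpos : 0 < (Measure.infinitePi fun _ : ℕ => ν).real
        (Set.pi (Finset.range T) fun s => {e s}) := by
      rw [infinitePi_real_agree]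
      exact Finset.prod_pos fun i _ => hνpos _
    have h1 := F.lossBefore_hedge_le (π := Measure.infinitePi fun _ : ℕ => ν) (β := fun _ => β)
      (hβ := fun _ => hβ) (hg := hg) (b := fun _ => C) antitone_const (fun _ => hC.le) hgC
      ((), (x, y)) (hG T) hpos (s := F.lossBefore g T (e, (x, y))) fun e' he' => by
        refine le_of_eq (Finset.sum_congr rfl fun s hs => ?_)
        rw [StrategyFamily.lossAt, StrategyFamily.lossAt, blockFamily_w_congr fun i hi => ?_]
        exact he' i (Finset.mem_range.2 (hi.trans_lt (Finset.mem_range.1 hs)))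
    have h2 := neg_log_infinitePi_agree_le (show 0 ≤ ε * β / 4 by positivity) hνpos hν0 hνA e T
    have h3 : -Real.log ((Measure.infinitePi fun _ : ℕ => ν).real
        (Set.pi (Finset.range T) fun s => {e s})) / β ≤ A / β * n T + ε / 4 * T := by
      rw [div_le_iff₀ hβ]
      refine h2.trans (le_of_eq ?_)
      simp only [n]
      field_simp
    have h4 : ∑ t ∈ Finset.range T, β * C ^ 2 / 2 = ε / 4 * T := by
      rw [Finset.sum_const, Finset.card_range, nsmul_eq_mul, hβdef]
      field_simp
      ring
    rw [h4] at h1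
    have h5 := hblock T
    change σ.lossBefore g T ((), (x, y)) ≤ _ at h1
    linarith
  have hK : 0 < τ * C + A / β + 1 := by positivity
  have hn := he.1.def (c := ε / 4 / (τ * C + A / β + 1)) (by positivity)
  filter_upwards [hn] with T hT
  have h1 := hhedge T
  rw [Real.norm_of_nonneg (Nat.cast_nonneg _), Real.norm_of_nonneg (Nat.cast_nonneg _),
    div_mul_eq_mul_div, le_div_iff₀ hK] at hT
  have h2 : (τ * C + A / β) * n T ≤ ε / 4 * T := by
    have : 0 ≤ n T := Nat.cast_nonneg _
    change n T * _ ≤ _ at hT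
    linarith
  have h3 : ∑ t ∈ Finset.range T, (if dist y₀ (y t) < R then
      expLoss (σ.w t ((), (x, y))) (fun k => loss α (d k) (y t)) -
        loss α (d (κ (x t))) (y t) else 0) = σ.lossBefore g T ((), (x, y)) -
      ∑ t ∈ Finset.range T, (if y t ∈ B then loss α (d (κ (x t))) (y t) else 0) := by
    rw [StrategyFamily.lossBefore, ← Finset.sum_sub_distrib]
    refine Finset.sum_congr rfl fun t _ => ?_
    rw [StrategyFamily.lossAt, hgl _ (hσs t _) t]
    simp only [hmem]
    split_ifs <;> simp
  rw [h3]
  linarith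

end Level


/-! ### Aggregation over the balls -/

section Levels

variable {X Y : Type*} [MeasurableSpace X] [MeasurableSpace Y]

/-- A sequence of strategies as a family indexed by `ℕ`. -/
def StrategyFamily.ofSeq (σ : ℕ → StrategyFamily Unit X Y) : StrategyFamily ℕ X Y where
  w t p := (σ p.1).w t ((), p.2)
  measurable_w t k := measurable_from_prod_countable_right fun n =>
    ((σ n).measurable_w t k).comp (measurable_const.prodMk measurable_id)
  tsum_w t p := (σ p.1).tsum_w t _
  w_congr t n := (σ n).w_congr t ()

theorem tendsto_add_one_rpow_neg {r : ℝ} (hr : 0 < r) :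
    Tendsto (fun t : ℕ => ((t : ℝ) + 1) ^ (-r)) atTop (𝓝 0) :=
  (tendsto_rpow_neg_atTop hr).comp
    (tendsto_atTop_add_const_right _ _ tendsto_natCast_atTop_atTop)

/-- A single strategy that does asymptotically as well as every strategy of a sequence. -/
theorem exists_strategy_le_seq (σ : ℕ → StrategyFamily Unit X Y) {g : ℕ → ℕ → Y → ℝ}
    (hg : ∀ t k, Measurable (g t k)) {K : ℝ} (hK : 0 ≤ K)
    (hb : ∀ t k y, g t k y ≤ K * ((t : ℝ) + 1) ^ (1 / 8 : ℝ)) :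
    ∃ ρ : StrategyFamily Unit X Y, ∀ (n : ℕ) (h : (ℕ → X) × (ℕ → Y)) (ε : ℝ), 0 < ε →
      ∀ᶠ T : ℕ in atTop, ρ.lossBefore g T ((), h) ≤ (σ n).lossBefore g T ((), h) + ε * T := by
  -- With losses `O(t ^ (1/8))` the second-order terms are `O(t ^ (-1/4))` and average out, while
  -- the cost `1 / β T` of the prior is still `o(T)`.
  let β : ℕ → ℝ := fun t => ((t : ℝ) + 1) ^ (-(1 / 2) : ℝ)
  have hβ : ∀ t, 0 < β t := fun t => Real.rpow_pos_of_pos (by positivity) _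
  have hanti : Antitone β := fun s t hst => by
    refine Real.rpow_le_rpow_of_nonpos (by positivity) ?_ (by norm_num)
    have : (s : ℝ) ≤ t := by exact_mod_cast hst
    linarith
  -- The Poisson law serves only as a prior that charges every natural number.
  refine ⟨(StrategyFamily.ofSeq σ).hedge (poissonMeasure 1) β hβ g hg, fun n h ε hε => ?_⟩
  set A : ℝ := -Real.log ((poissonMeasure 1).real {n})
  have hb0 : ∀ t : ℕ, 0 ≤ K * ((t : ℝ) + 1) ^ (1 / 8 : ℝ) := fun t => by positivity
  have h1 : ∀ T, ((StrategyFamily.ofSeq σ).hedge (poissonMeasure 1) β hβ g hg).lossBefore g T ((), h) ≤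
      (σ n).lossBefore g T ((), h) + A / β T + ∑ t ∈ Finset.range T,
        β t * (K * ((t : ℝ) + 1) ^ (1 / 8 : ℝ)) ^ 2 / 2 := fun T =>
    (StrategyFamily.ofSeq σ).lossBefore_hedge_le hanti hb0 hb ((), h) (measurableSet_singleton n)
      (poissonMeasure_real_singleton_pos n one_pos) fun e he => by
        rw [Set.mem_singleton_iff.1 he]
        exact le_rfl
  have h2 : ∀ t : ℕ, β t * (K * ((t : ℝ) + 1) ^ (1 / 8 : ℝ)) ^ 2 / 2 =
      K ^ 2 / 2 * ((t : ℝ) + 1) ^ (-(1 / 4) : ℝ) := by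
    intro t
    have hpos : (0 : ℝ) < (t : ℝ) + 1 := by positivity
    have e1 : ((t : ℝ) + 1) ^ (-(1 / 4) : ℝ) =
        ((t : ℝ) + 1) ^ (-(1 / 2) : ℝ) * (((t : ℝ) + 1) ^ (1 / 8 : ℝ)) ^ 2 := by
      rw [← Real.rpow_natCast, ← Real.rpow_mul hpos.le, ← Real.rpow_add hpos]
      norm_num
    rw [e1]
    ring
  simp only [h2, ← Finset.mul_sum] at h1
  have h3 : Tendsto (fun T : ℕ => A * ((T : ℝ) + 1) ^ (1 / 2 : ℝ) / T) atTop (𝓝 0) := by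
    have e1 : Tendsto (fun T : ℕ => A * (((T : ℝ) + 1) ^ (-(1 / 2) : ℝ) * (((T : ℝ) + 1) / T))) atTop
        (𝓝 (A * (0 * 1))) := by
      refine ((tendsto_add_one_rpow_neg (by norm_num)).mul ?_).const_mul A
      have : Tendsto (fun T : ℕ => 1 + 1 / (T : ℝ)) atTop (𝓝 (1 + 0)) :=
        tendsto_one_div_atTop_nhds_zero_nat.const_add 1
      rw [add_zero] at this
      refine this.congr' ?_
      filter_upwards [eventually_gt_atTop 0] with T hT
      have : (T : ℝ) ≠ 0 := by positivity
      field_simp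
    rw [zero_mul, mul_zero] at e1
    refine e1.congr fun T => ?_
    have hpos : (0 : ℝ) < (T : ℝ) + 1 := by positivity
    have e2 : ((T : ℝ) + 1) ^ (1 / 2 : ℝ) = ((T : ℝ) + 1) ^ (-(1 / 2) : ℝ) * ((T : ℝ) + 1) := by
      nth_rewrite 3 [← Real.rpow_one ((T : ℝ) + 1)]
      rw [← Real.rpow_add hpos]
      norm_num
    rw [e2]
    ring
  have h4 := ((tendsto_add_one_rpow_neg (r := 1 / 4) (by norm_num)).cesaro.const_mul (K ^ 2 / 2))
  rw [mul_zero] at h4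
  have h5 := h3.add h4
  rw [add_zero] at h5
  filter_upwards [h5.eventually (gt_mem_nhds hε), eventually_gt_atTop 0] with T hT hT0
  have hT' : (0 : ℝ) < T := by exact_mod_cast hT0
  have h6 : A / β T = A * ((T : ℝ) + 1) ^ (1 / 2 : ℝ) := by
    simp only [β]
    rw [Real.rpow_neg (by positivity), div_inv_eq_mul]
  have h7 := h1 T
  rw [h6] at h7
  have h8 := mul_lt_mul_of_pos_right hT hT'
  have h9 : (A * ((T : ℝ) + 1) ^ (1 / 2 : ℝ) / T + K ^ 2 / 2 * ((T : ℝ)⁻¹ *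
      ∑ i ∈ Finset.range T, ((i : ℝ) + 1) ^ (-(1 / 4) : ℝ))) * T =
      A * ((T : ℝ) + 1) ^ (1 / 2 : ℝ) + K ^ 2 / 2 *
        ∑ i ∈ Finset.range T, ((i : ℝ) + 1) ^ (-(1 / 4) : ℝ) := by
    field_simp
  rw [h9] at h8
  linarith

end Levels

/-! ### Realizing a strategy by a learning rule -/

section Realization

variable {X Y : Type*} [MeasurableSpace X] [MeasurableSpace Y]

/-- The weights form a Markov kernel from histories to `ℕ`, and such a kernel is the law of a
measurable function of the history and a uniform variable, which becomes the private randomness. -/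
theorem exists_rule_of_strategy (σ : StrategyFamily Unit X Y) (y₀ : Y) (v : ℕ → ℕ → Y) :
    ∃ f : OnlineRule X Y, (∀ t r x y, ∃ k, f.prediction t r x y = v t k) ∧
      ∀ t x y (l : Y → ℝ), (∀ z, 0 ≤ l z) →
        ∫ r, l (f.prediction t r x y) ∂f.law t =
          expLoss (σ.w t ((), (x, y))) fun k => l (v t k) := by
  classical
  -- Strategies read infinite sequences. Padding with the current instance puts it at position `t`;
  -- all other padded entries are irrelevant by causality.
  let pad : ∀ t : ℕ, (Fin t → X) × (Fin t → Y) × X → (ℕ → X) × (ℕ → Y) := fun t h =>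
    (fun s => if hs : s < t then h.1 ⟨s, hs⟩ else h.2.2,
      fun s => if hs : s < t then h.2.1 ⟨s, hs⟩ else y₀)
  have hpad : ∀ t, Measurable (pad t) := by
    intro t
    refine Measurable.prodMk (measurable_pi_lambda _ fun s => ?_) (measurable_pi_lambda _ fun s => ?_)
    · by_cases hs : s < t
      · simp only [hs, dif_pos]
        exact (measurable_pi_apply _).comp measurable_fst
      · simp only [hs, dif_neg, not_false_eq_true]
        exact measurable_snd.comp measurable_snd
    · by_cases hs : s < t
      · simp only [hs, dif_pos]
        exact (measurable_pi_apply _).comp (measurable_fst.comp measurable_snd)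
      · simp only [hs, dif_neg, not_false_eq_true]
        exact measurable_const
  let w : ∀ t : ℕ, (Fin t → X) × (Fin t → Y) × X → ℕ → ENNReal := fun t h => σ.w t ((), pad t h)
  have hw : ∀ t k, Measurable fun h => w t h k := fun t k =>
    (σ.measurable_w t k).comp (measurable_const.prodMk (hpad t))
  let κ : ∀ t : ℕ, Kernel ((Fin t → X) × (Fin t → Y) × X) ℕ := fun t =>
    { toFun := fun h => Measure.sum fun k => w t h k • Measure.dirac k
      measurable' := by
        refine Measure.measurable_of_measurable_coe _ fun s hs => ?_
        simp only [Measure.sum_apply _ hs, Measure.smul_apply, smul_eq_mul]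
        exact Measurable.tsum fun k => (hw t k).mul_const _ }
  have hκ : ∀ t h k, κ t h {k} = w t h k := by
    intro t h k
    change (Measure.sum fun k => w t h k • Measure.dirac k) {k} = w t h k
    rw [Measure.sum_apply _ (measurableSet_singleton k), tsum_eq_single k]
    · simp
    · intro j hj
      simp [hj]
  have hM : ∀ t, IsMarkovKernel (κ t) := by
    intro t
    refine ⟨fun h => ⟨?_⟩⟩
    change (Measure.sum fun k => w t h k • Measure.dirac k) Set.univ = 1
    rw [Measure.sum_apply _ MeasurableSet.univ]
    simp only [Measure.smul_apply, measure_univ, smul_eq_mul, mul_one]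
    exact σ.tsum_w t _
  choose J hJ hJκ using fun t => (κ t).exists_measurable_map_eq_unitInterval
  let f : OnlineRule X Y :=
    { R := unitInterval
      law := fun _ => volume
      predict := fun t p => v t (J t p.2 p.1)
      measurable_predict := fun t => (measurable_of_countable (v t)).comp
        ((hJ t).comp (measurable_snd.prodMk measurable_fst)) }
  refine ⟨f, fun t r x y => ⟨_, rfl⟩, fun t x y l hl0 => ?_⟩
  set h : (Fin t → X) × (Fin t → Y) × X := (fun s => x s, fun s => y s, x t)
  have hJm : Measurable (J t h) := (hJ t).comp measurable_prodMk_left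
  have hwh : w t h = σ.w t ((), (x, y)) := by
    refine σ.w_congr t () _ _ (fun s hs => ?_) fun s hs => ?_
    · by_cases hs' : s < t
      · simp [pad, h, hs']
      · obtain rfl : s = t := by omega
        simp [pad, h]
    · simp [pad, h, hs]
  change ∫ r : unitInterval, l (v t (J t h r)) = _
  have hm : Measurable fun k => l (v t k) := measurable_of_countable _
  rw [integral_eq_lintegral_of_nonneg_ae (Eventually.of_forall fun r => hl0 _)
    (hm.comp hJm).aestronglyMeasurable, expLoss, ← hwh]
  congr 1
  have h1 : ∫⁻ r : unitInterval, ENNReal.ofReal (l (v t (J t h r))) =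
      ∫⁻ k, ENNReal.ofReal (l (v t k)) ∂(volume.map (J t h)) :=
    (lintegral_map (f := fun k => ENNReal.ofReal (l (v t k))) (measurable_of_countable _) hJm).symm
  rw [h1, hJκ, lintegral_countable']
  refine tsum_congr fun k => ?_
  rw [hκ, mul_comm]

end Realization


/-! ### Realized losses against conditional means -/

/-- Independence makes the joint law of `r` and `W` a product; integrating over `r` first kills the
centered factor. -/
theorem integral_mul_centered_eq_zero {Ω R S : Type*} [MeasurableSpace Ω] [MeasurableSpace R]
    [MeasurableSpace S] {P : Measure Ω} [IsProbabilityMeasure P] {ν : Measure R}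
    [IsProbabilityMeasure ν] {r : Ω → R} {W : Ω → S} (hr : Measurable r) (hW : Measurable W)
    (hν : P.map r = ν) (hind : IndepFun r W P) {A : S → ℝ} (hA : Measurable A) {a : ℝ}
    (ha : ∀ s, |A s| ≤ a) {B : R × S → ℝ} (hB : Measurable B) {b : ℝ} (hb : ∀ p, |B p| ≤ b) :
    ∫ ω, A (W ω) * (B (r ω, W ω) - ∫ u, B (u, W ω) ∂ν) ∂P = 0 := by
  have hC : Measurable fun s => ∫ u, B (u, s) ∂ν :=
    (hB.stronglyMeasurable.integral_prod_left' (μ := ν)).measurable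
  have hCb : ∀ s, |∫ u, B (u, s) ∂ν| ≤ b := fun s => by
    have := norm_integral_le_of_norm_le_const (μ := ν) (f := fun u => B (u, s)) (C := b)
      (Eventually.of_forall fun u => hb (u, s))
    simpa using this
  have hWp : IsProbabilityMeasure (P.map W) := Measure.isProbabilityMeasure_map hW.aemeasurable
  let Φ : R × S → ℝ := fun p => A p.2 * (B p - ∫ u, B (u, p.2) ∂ν)
  have hΦ : Measurable Φ := (hA.comp measurable_snd).mul (hB.sub (hC.comp measurable_snd))
  have hΦb : ∀ p, ‖Φ p‖ ≤ a * (b + b) := fun p => by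
    have h0 : 0 ≤ a := (abs_nonneg _).trans (ha p.2)
    rw [Real.norm_eq_abs, abs_mul]
    exact mul_le_mul (ha _) ((abs_sub _ _).trans (add_le_add (hb _) (hCb _))) (abs_nonneg _) h0
  have hmap : P.map (fun ω => (r ω, W ω)) = ν.prod (P.map W) := by
    rw [(indepFun_iff_map_prod_eq_prod_map_map hr.aemeasurable hW.aemeasurable).1 hind, hν]
  have h1 : ∫ ω, Φ (r ω, W ω) ∂P = ∫ p, Φ p ∂(ν.prod (P.map W)) := by
    rw [← hmap]
    exact (integral_map (hr.prodMk hW).aemeasurable hΦ.aestronglyMeasurable).symm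
  refine h1.trans ?_
  rw [integral_prod_symm _ (Integrable.of_bound hΦ.aestronglyMeasurable _
    (Eventually.of_forall hΦb))]
  have h2 : ∀ s, ∫ u, Φ (u, s) ∂ν = 0 := by
    intro s
    have hi : Integrable (fun u => B (u, s)) ν :=
      Integrable.of_bound (hB.comp measurable_prodMk_right).aestronglyMeasurable b
        (Eventually.of_forall fun u => hb (u, s))
    simp only [Φ]
    rw [integral_const_mul, integral_sub hi (integrable_const _)]
    simp
  simp [h2]

section Deviation

variable {X Y : Type*} [MeasurableSpace X] [MeasurableSpace Y]

/-- The deviation of the loss `G t` of the rule at step `t` from its conditional mean. -/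
noncomputable def deviation (f : OnlineRule X Y) (G : ℕ → Y × Y → ℝ) (t : ℕ)
    (p : f.R × ((ℕ → X) × (ℕ → Y))) : ℝ :=
  G t (f.prediction t p.1 p.2.1 p.2.2, p.2.2 t) -
    ∫ u, G t (f.prediction t u p.2.1 p.2.2, p.2.2 t) ∂f.law t

variable {f : OnlineRule X Y} {G : ℕ → Y × Y → ℝ}

theorem deviation_congr {t : ℕ} {r : f.R} {x : ℕ → X} {y y' : ℕ → Y} (h : ∀ s ≤ t, y s = y' s) :
    deviation f G t (r, (x, y)) = deviation f G t (r, (x, y')) := by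
  have h1 : ∀ u, f.prediction t u x y = f.prediction t u x y' := fun u =>
    prediction_congr fun s hs => h s hs.le
  simp only [deviation, h1, h t le_rfl]

theorem measurable_loss_prediction (hG : ∀ t, Measurable (G t)) (t : ℕ) :
    Measurable fun p : f.R × ((ℕ → X) × (ℕ → Y)) =>
      G t (f.prediction t p.1 p.2.1 p.2.2, p.2.2 t) := by
  have hy : ∀ s, Measurable fun p : f.R × ((ℕ → X) × (ℕ → Y)) => p.2.2 s := fun s =>
    (measurable_pi_apply s).comp (measurable_snd.comp measurable_snd)
  exact (hG t).comp ((measurable_prediction f measurable_fst (fun s =>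
    (measurable_pi_apply s).comp (measurable_fst.comp measurable_snd)) hy).prodMk (hy t))

theorem measurable_deviation (hG : ∀ t, Measurable (G t)) (t : ℕ) :
    Measurable (deviation f G t) := by
  have h1 := measurable_loss_prediction (f := f) hG t
  exact h1.sub ((h1.stronglyMeasurable.integral_prod_left' (μ := f.law t)).measurable.comp
    measurable_snd)

theorem abs_deviation_le {b : ℕ → ℝ}
    (hb : ∀ t r x y z, |G t (f.prediction t r x y, z)| ≤ b t) (t : ℕ)
    (p : f.R × ((ℕ → X) × (ℕ → Y))) : |deviation f G t p| ≤ 2 * b t := by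
  have h1 := norm_integral_le_of_norm_le_const (μ := f.law t)
    (f := fun u => G t (f.prediction t u p.2.1 p.2.2, p.2.2 t)) (C := b t)
    (Eventually.of_forall fun u => hb t u _ _ _)
  simp only [probReal_univ, mul_one, Real.norm_eq_abs] at h1
  refine (abs_sub _ _).trans ?_
  have h2 := hb t p.1 p.2.1 p.2.2 (p.2.2 t)
  linarith

/-- For `s < t` the deviation at `s` is a function of the instances, the values up to `t` and the
draws before `t`, while the deviation at `t` is centered given these data. This is exactly the
independence granted by an adversarial process, so the deviations are orthogonal. -/
theorem ae_tendsto_deviation {Ω : Type*} [MeasurableSpace Ω] {P : Measure Ω}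
    [IsProbabilityMeasure P] {x : ℕ → Ω → X} {y : ℕ → Ω → Y} {r : ℕ → Ω → f.R}
    (h : IsAdversarialProcess f P x y r) (hG : ∀ t, Measurable (G t)) {K : ℝ}
    (hb : ∀ t r x y z, |G t (f.prediction t r x y, z)| ≤ K * ((t : ℝ) + 1) ^ (1 / 8 : ℝ)) :
    ∀ᵐ ω ∂P, Tendsto (fun T : ℕ => (1 / (T : ℝ)) * ∑ t ∈ Finset.range T,
      deviation f G t (r t ω, (fun s => x s ω, fun s => y s ω))) atTop (𝓝 0) := by
  classical
  have hhist : Measurable fun ω => ((fun s => x s ω, fun s => y s ω) : (ℕ → X) × (ℕ → Y)) :=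
    (measurable_pi_lambda _ h.measurable_X).prodMk (measurable_pi_lambda _ h.measurable_Y)
  refine tendsto_average_of_orthogonal P
    (fun t ω => deviation f G t (r t ω, (fun s => x s ω, fun s => y s ω)))
    (fun t => (measurable_deviation hG t).comp ((h.measurable_r t).prodMk hhist)) (2 * K)
    (fun t ω => (abs_deviation_le hb t _).trans (by rw [mul_assoc])) fun s t hst => ?_
  let S := (ℕ → X) × (Fin (t + 1) → Y) × (Fin t → f.R)
  let W : Ω → S := fun ω =>
    ((fun s : ℕ => x s ω), (fun s : Fin (t + 1) => y s ω), (fun s : Fin t => r s ω))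
  have hW : Measurable W := (measurable_pi_lambda _ h.measurable_X).prodMk
    ((measurable_pi_lambda _ fun s : Fin (t + 1) => h.measurable_Y s).prodMk
      (measurable_pi_lambda _ fun s : Fin t => h.measurable_r s))
  let pad : (Fin (t + 1) → Y) → ℕ → Y := fun w i => if hi : i < t + 1 then w ⟨i, hi⟩ else w 0
  have hpad : Measurable pad := measurable_pi_lambda _ fun i => by
    by_cases hi : i < t + 1
    · simp only [pad, hi, dif_pos]
      exact measurable_pi_apply _
    · simp only [pad, hi, dif_neg, not_false_eq_true]
      exact measurable_pi_apply _
  let H : S → (ℕ → X) × (ℕ → Y) := fun w => (w.1, pad w.2.1)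
  have hH : Measurable H := measurable_fst.prodMk
    (hpad.comp (measurable_fst.comp measurable_snd))
  have hHW : ∀ i ≤ t, ∀ u ω, deviation f G i (u, (fun s => x s ω, fun s => y s ω)) =
      deviation f G i (u, H (W ω)) := fun i hi u ω => deviation_congr fun j hj => by
    have : j < t + 1 := by omega
    change y j ω = pad (W ω).2.1 j
    simp only [pad, W, this, dif_pos]
  have hrs : Measurable fun w : S => w.2.2 ⟨s, hst⟩ :=
    (measurable_pi_apply _).comp (measurable_snd.comp measurable_snd)
  have key := integral_mul_centered_eq_zero (h.measurable_r t) hW (h.map_r t) (h.indep_r t)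
    (A := fun w => deviation f G s (w.2.2 ⟨s, hst⟩, H w))
    ((measurable_deviation hG s).comp (hrs.prodMk hH)) (fun w => abs_deviation_le hb s _)
    (B := fun p => G t (f.prediction t p.1 (H p.2).1 (H p.2).2, (H p.2).2 t))
    ((measurable_loss_prediction hG t).comp
      (measurable_fst.prodMk (hH.comp measurable_snd))) fun p => hb t _ _ _ _
  refine Eq.trans (integral_congr_ae (Eventually.of_forall fun ω => ?_)) key
  simp only [hHW s hst.le, hHW t le_rfl]
  rfl

end Deviation


/-! ### Clipping at a growing horizon, and tails -/

/-- The radius of the ball to which the predictions and the counted values at step `t` belong. -/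
noncomputable def horizon (α : ℝ) (t : ℕ) : ℝ := ((t : ℝ) + 1) ^ (1 / (8 * α))

theorem horizon_nonneg (α : ℝ) (t : ℕ) : 0 ≤ horizon α t := by
  unfold horizon
  positivity

/-- The exponent of the horizon is chosen so that clipped losses grow like `t ^ (1/8)`, the rate
admitted both by the averaging theorem and by the aggregation over balls. -/
theorem horizon_rpow {α : ℝ} (hα : 0 < α) (t : ℕ) :
    horizon α t ^ α = ((t : ℝ) + 1) ^ (1 / 8 : ℝ) := by
  rw [horizon, ← Real.rpow_mul (by positivity)]
  congr 1
  field_simp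

theorem tendsto_horizon {α : ℝ} (hα : 0 < α) : Tendsto (horizon α) atTop atTop :=
  (tendsto_rpow_atTop (by positivity)).comp
    (tendsto_atTop_add_const_right _ _ tendsto_natCast_atTop_atTop)

section Clipping

variable {Y : Type*} [MetricSpace Y]

/-- The loss of a prediction at step `t`, counted only if the value is within the horizon. -/
noncomputable def clippedLoss (α : ℝ) (y₀ : Y) (t : ℕ) (p : Y × Y) : ℝ :=
  if dist y₀ p.2 ≤ horizon α t then loss α p.1 p.2 else 0

/-- The value with index `k`, replaced by `y₀` if it is beyond the horizon. -/
noncomputable def clippedValue (α : ℝ) (y₀ : Y) (d : ℕ → Y) (t k : ℕ) : Y :=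
  if dist y₀ (d k) ≤ horizon α t then d k else y₀

/-- The loss of the constant `y₀`, counted only for values at distance at least `R`. -/
noncomputable def tailLoss (α : ℝ) (y₀ : Y) (R : ℝ) (y : Y) : ℝ :=
  if R ≤ dist y₀ y then loss α y₀ y else 0

theorem tailLoss_nonneg (α : ℝ) (y₀ : Y) (R : ℝ) (y : Y) : 0 ≤ tailLoss α y₀ R y := by
  unfold tailLoss
  split_ifs
  exacts [loss_nonneg _ _ _, le_rfl]

theorem clippedLoss_nonneg (α : ℝ) (y₀ : Y) (t : ℕ) (p : Y × Y) : 0 ≤ clippedLoss α y₀ t p := by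
  unfold clippedLoss
  split_ifs
  exacts [loss_nonneg _ _ _, le_rfl]

theorem dist_clippedValue_le (α : ℝ) (y₀ : Y) (d : ℕ → Y) (t k : ℕ) :
    dist y₀ (clippedValue α y₀ d t k) ≤ horizon α t := by
  unfold clippedValue
  split_ifs with h
  · exact h
  · rw [dist_self]
    exact horizon_nonneg α t

theorem loss_le_mul_of_dist_le {α c : ℝ} (hα : 0 ≤ α) (hc : 0 ≤ c) {a b y₀ y : Y}
    (h : dist a b ≤ c * dist y₀ y) : loss α a b ≤ c ^ α * loss α y₀ y := by
  rw [loss, loss, ← Real.mul_rpow hc dist_nonneg]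
  exact Real.rpow_le_rpow dist_nonneg h hα

theorem clippedLoss_le {α : ℝ} (hα : 0 < α) {y₀ : Y} {t : ℕ} {p : Y × Y}
    (hp : dist y₀ p.1 ≤ horizon α t) :
    clippedLoss α y₀ t p ≤ 2 ^ α * ((t : ℝ) + 1) ^ (1 / 8 : ℝ) := by
  have h0 := horizon_nonneg α t
  unfold clippedLoss
  split_ifs with h
  · rw [← horizon_rpow hα, ← Real.mul_rpow zero_le_two h0]
    refine loss_le_rpow hα.le ?_
    have := dist_triangle_left p.1 p.2 y₀
    linarith
  · positivity

/-- If `y` is within `R`, clipping changes nothing and only the comparator is replaced: a near `a`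
by a nearby `d i`, a far `a` by `y₀`. The latter is no worse than `a` when `y` is within `R / 2`,
and is charged to the tail otherwise. If `y` is beyond `R`, the constants `2 ^ α` and `3 ^ α` bound,
relative to the tail loss, the unclipped loss of `p` and the clipped mean loss of `w`. -/
theorem loss_sub_loss_le {α : ℝ} (hα : 0 < α) {y₀ : Y} {d : ℕ → Y} {t : ℕ} {R ε : ℝ}
    (hR : 1 ≤ R) (hε : 0 ≤ ε) (ht : R + 1 ≤ horizon α t) {p : Y} (hp : dist y₀ p ≤ horizon α t)
    {w : ℕ → ENNReal} (hw1 : ∑' k, w k = 1) (hw : ∀ k, w k ≠ 0 → dist y₀ (d k) ≤ R + 1) {i : ℕ}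
    {a y : Y} (hi : dist y₀ y < R → dist y₀ a < R → loss α (d i) y ≤ loss α a y + ε)
    (hi' : R ≤ dist y₀ a → d i = y₀) :
    loss α p y - loss α a y ≤ clippedLoss α y₀ t (p, y) -
      expLoss w (fun k => clippedLoss α y₀ t (clippedValue α y₀ d t k, y)) +
      (if dist y₀ y < R then expLoss w (fun k => loss α (d k) y) - loss α (d i) y else 0) + ε +
      (2 ^ α + 3 ^ α + 1) * tailLoss α y₀ (R / 2) y := by
  have hq := tailLoss_nonneg α y₀ (R / 2) y
  have ha := loss_nonneg α a y
  have h2 : (0 : ℝ) ≤ 2 ^ α := by positivity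
  have h3 : (0 : ℝ) ≤ 3 ^ α := by positivity
  have hp' : loss α p y ≤ clippedLoss α y₀ t (p, y) + 2 ^ α * tailLoss α y₀ (R / 2) y := by
    by_cases h : dist y₀ y ≤ horizon α t
    · rw [clippedLoss, if_pos h]
      have := mul_nonneg h2 hq
      linarith
    · push Not at h
      have h4 : tailLoss α y₀ (R / 2) y = loss α y₀ y := if_pos (by linarith)
      rw [clippedLoss, if_neg h.not_ge, h4, zero_add]
      refine loss_le_mul_of_dist_le hα.le zero_le_two ?_
      have := dist_triangle_left p y y₀
      linarith
  by_cases hy : dist y₀ y < R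
  · rw [if_pos hy]
    have h4 : expLoss w (fun k => clippedLoss α y₀ t (clippedValue α y₀ d t k, y)) =
        expLoss w fun k => loss α (d k) y := by
      refine expLoss_congr fun k hk => ?_
      have h5 : clippedValue α y₀ d t k = d k := if_pos ((hw k hk).trans ht)
      rw [h5]
      exact if_pos (by linarith : dist y₀ y ≤ horizon α t)
    have h5 : loss α (d i) y ≤ loss α a y + ε + tailLoss α y₀ (R / 2) y := by
      by_cases haR : dist y₀ a < R
      · have := hi hy haR
        linarith
      · push Not at haR
        rw [hi' haR]
        by_cases hy2 : R / 2 ≤ dist y₀ y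
        · have h6 : tailLoss α y₀ (R / 2) y = loss α y₀ y := if_pos hy2
          linarith
        · have : loss α y₀ y ≤ loss α a y := loss_mono hα.le (by
            have := dist_triangle_right y₀ a y
            push Not at hy2
            linarith)
          linarith
    have := mul_nonneg h3 hq
    rw [h4]
    linarith
  · rw [if_neg hy]
    push Not at hy
    have h6 : tailLoss α y₀ (R / 2) y = loss α y₀ y := if_pos (by linarith)
    have h4 : expLoss w (fun k => clippedLoss α y₀ t (clippedValue α y₀ d t k, y)) ≤
        3 ^ α * tailLoss α y₀ (R / 2) y := by
      refine expLoss_le hw1 (mul_nonneg h3 hq) fun k hk => ?_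
      have h5 : clippedValue α y₀ d t k = d k := if_pos ((hw k hk).trans ht)
      rw [h5, h6, clippedLoss]
      split_ifs
      · refine loss_le_mul_of_dist_le hα.le (by norm_num) ?_
        have := dist_triangle_left (d k) y y₀
        have := hw k hk
        linarith
      · exact mul_nonneg h3 (loss_nonneg _ _ _)
    linarith

theorem eventually_le_of_limsup_le {u : ℕ → ℝ} {ε ε' : ℝ} (hε : ε < ε')
    (h : limsup (fun T : ℕ => (((1 / (T : ℝ)) * u T : ℝ) : EReal)) atTop ≤ (ε : EReal)) :
    ∀ᶠ T : ℕ in atTop, u T ≤ ε' * T := by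
  have h1 := eventually_lt_of_limsup_lt (h.trans_lt (EReal.coe_lt_coe_iff.2 hε))
  filter_upwards [h1, eventually_gt_atTop 0] with T hT hT0
  have hT' : (0 : ℝ) < T := by exact_mod_cast hT0
  have h2 := EReal.coe_lt_coe_iff.1 hT
  rw [one_div_mul_eq_div, div_lt_iff₀ hT'] at h2
  exact h2.le

theorem limsup_average_le_zero {u : ℕ → ℝ} (h : ∀ ε : ℝ, 0 < ε → ∀ᶠ T : ℕ in atTop, u T ≤ ε * T) :
    limsup (fun T : ℕ => (((1 / (T : ℝ)) * u T : ℝ) : EReal)) atTop ≤ 0 := by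
  by_contra! hlt
  obtain ⟨ε, h0, h1⟩ := EReal.lt_iff_exists_real_btwn.1 hlt
  have hε : 0 < ε := by exact_mod_cast h0
  refine absurd (limsup_le_of_le (h := ?_)) h1.not_ge
  filter_upwards [h ε hε, eventually_gt_atTop 0] with T hT hT0
  have hT' : (0 : ℝ) < T := by exact_mod_cast hT0
  rw [EReal.coe_le_coe_iff, one_div_mul_eq_div, div_le_iff₀ hT']
  exact hT

/-- Changing the base point from `z` to `y₀` at most doubles distances once they exceed `2 * dist y₀
z`, so the tail about `y₀` is at most `2 ^ α` times a tail about `z`. -/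
theorem exists_sum_tailLoss_le {α : ℝ} (hα : 1 ≤ α) {y : ℕ → Y} {z : Y}
    (h : ∀ m : ℕ, ∃ M : ℝ, 0 ≤ M ∧ limsup (fun T : ℕ => (((1 / (T : ℝ)) * ∑ t ∈ Finset.range T,
      Set.indicator {z' | M ≤ loss α z z'} (loss α z) (y t) : ℝ) : EReal)) atTop ≤
        ((1 / ((m : ℝ) + 1) : ℝ) : EReal)) (y₀ : Y) {ε : ℝ} (hε : 0 < ε) :
    ∃ N : ℝ, ∀ R, N ≤ R → ∀ᶠ T : ℕ in atTop,
      ∑ t ∈ Finset.range T, tailLoss α y₀ R (y t) ≤ ε * T := by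
  have hα0 : 0 < α := by linarith
  have h2 : (0 : ℝ) < 2 ^ α := by positivity
  obtain ⟨m, hm⟩ := exists_nat_one_div_lt (show 0 < ε / 2 ^ α by positivity)
  obtain ⟨M, hM, hlim⟩ := h m
  have hev := eventually_le_of_limsup_le hm hlim
  -- The second bound forces `dist z y' ≥ M + 1 ≥ 1`, so that `dist z y' ^ α ≥ dist z y' ≥ M` as `α
  -- ≥ 1`.
  refine ⟨max (2 * dist y₀ z) (2 * (M + 1)), fun R hR => ?_⟩
  have hR1 := (le_max_left _ _).trans hR
  have hR2 := (le_max_right _ _).trans hR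
  have hpt : ∀ y' : Y, tailLoss α y₀ R y' ≤
      2 ^ α * Set.indicator {z' | M ≤ loss α z z'} (loss α z) y' := by
    intro y'
    unfold tailLoss
    split_ifs with hy
    · have hd : dist y₀ y' ≤ 2 * dist z y' := by
        have := dist_triangle y₀ z y'
        linarith
      have hmem : y' ∈ {z' | M ≤ loss α z z'} := by
        change M ≤ dist z y' ^ α
        have h3 : M + 1 ≤ dist z y' := by linarith
        have h4 := Real.rpow_le_rpow_of_exponent_le (show 1 ≤ dist z y' by linarith) hα
        rw [Real.rpow_one] at h4
        linarith
      rw [Set.indicator_of_mem hmem]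
      exact loss_le_mul_of_dist_le hα0.le zero_le_two hd
    · exact mul_nonneg h2.le (Set.indicator_nonneg (fun _ _ => loss_nonneg _ _ _) _)
  filter_upwards [hev] with T hT
  calc ∑ t ∈ Finset.range T, tailLoss α y₀ R (y t)
      ≤ ∑ t ∈ Finset.range T, 2 ^ α * Set.indicator {z' | M ≤ loss α z z'} (loss α z) (y t) :=
        Finset.sum_le_sum fun t _ => hpt _
    _ ≤ 2 ^ α * (ε / 2 ^ α * T) := by
        rw [← Finset.mul_sum]
        exact mul_le_mul_of_nonneg_left hT h2.le
    _ = ε * T := by field_simp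

theorem exists_sum_le_of_eventually_le {a b : ℕ → ℝ} (h : ∀ᶠ t in atTop, a t ≤ b t) :
    ∃ K : ℝ, ∀ T, ∑ t ∈ Finset.range T, a t ≤ K + ∑ t ∈ Finset.range T, b t := by
  obtain ⟨N, hN⟩ := eventually_atTop.1 h
  refine ⟨∑ t ∈ Finset.range N, |a t - b t|, fun T => ?_⟩
  rw [← sub_le_iff_le_add, ← Finset.sum_sub_distrib]
  calc ∑ t ∈ Finset.range T, (a t - b t)
      ≤ ∑ t ∈ Finset.range T, if t ∈ Finset.range N then |a t - b t| else 0 := by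
        refine Finset.sum_le_sum fun t _ => ?_
        split_ifs with ht
        · exact le_abs_self _
        · rw [Finset.mem_range, not_lt] at ht
          exact sub_nonpos.2 (hN t ht)
    _ ≤ ∑ t ∈ Finset.range N, |a t - b t| := by
        rw [← Finset.sum_filter]
        refine Finset.sum_le_sum_of_subset_of_nonneg (fun t ht => (Finset.mem_filter.1 ht).2)
          fun t _ _ => abs_nonneg _

variable [MeasurableSpace Y] [BorelSpace Y] [SecondCountableTopology Y]

theorem measurable_clippedLoss (α : ℝ) (y₀ : Y) (t : ℕ) : Measurable (clippedLoss α y₀ t) :=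
  Measurable.ite (measurableSet_le (measurable_const.dist measurable_snd) measurable_const)
    (measurable_loss α) measurable_const

theorem exists_ball_index {d : ℕ → Y} (hd : DenseRange d) {R : ℝ} (hR : 0 < R) {δ : ℝ}
    (hδ : 0 < δ) : ∃ κ : Y → ℕ, Measurable κ ∧ (∀ z, dist (d 0) (d (κ z)) < R) ∧
      (∀ z, dist (d 0) z < R → dist (d (κ z)) z < δ) ∧ ∀ z, R ≤ dist (d 0) z → κ z = 0 := by
  classical
  have hex : ∀ z, ∃ k, (dist (d 0) z < R ∧ dist (d 0) (d k) < R ∧ dist (d k) z < δ) ∨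
      (R ≤ dist (d 0) z ∧ k = 0) := by
    intro z
    by_cases hz : dist (d 0) z < R
    · have hopen : IsOpen (Metric.ball (d 0) R ∩ Metric.ball z δ) :=
        Metric.isOpen_ball.inter Metric.isOpen_ball
      obtain ⟨k, hk⟩ := hd.exists_mem_open hopen
        ⟨z, by rwa [Metric.mem_ball, dist_comm], Metric.mem_ball_self hδ⟩
      refine ⟨k, Or.inl ⟨hz, ?_, hk.2⟩⟩
      rw [dist_comm]
      exact hk.1
    · exact ⟨0, Or.inr ⟨not_lt.1 hz, rfl⟩⟩
  refine ⟨fun z => Nat.find (hex z), measurable_find hex fun k => ?_, fun z => ?_, fun z hz => ?_,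
    fun z hz => ?_⟩
  · have hm : Measurable fun z : Y => dist (d 0) z := measurable_const.dist measurable_id
    have hm' : Measurable fun z : Y => dist (d k) z := measurable_const.dist measurable_id
    refine measurableSet_setOfPred.2 (Measurable.or (Measurable.and ?_ (Measurable.and ?_ ?_))
      (Measurable.and ?_ measurable_const))
    · exact measurableSet_setOfPred.1 (measurableSet_lt hm measurable_const)
    · exact measurable_const
    · exact measurableSet_setOfPred.1 (measurableSet_lt hm' measurable_const)
    · exact measurableSet_setOfPred.1 (measurableSet_le measurable_const hm)
  · rcases Nat.find_spec (hex z) with h | h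
    · exact h.2.1
    · change dist (d 0) (d (Nat.find (hex z))) < R
      rw [h.2, dist_self]
      exact hR
  · rcases Nat.find_spec (hex z) with h | h
    · exact h.2.2
    · exact absurd hz h.1.not_gt
  · rcases Nat.find_spec (hex z) with h | h
    · exact absurd hz h.1.not_ge
    · exact h.2

end Clipping


/-! ### The universal rule -/

theorem exists_denseRange_zero {Y : Type*} [TopologicalSpace Y]
    [TopologicalSpace.SeparableSpace Y] (y₀ : Y) : ∃ d : ℕ → Y, DenseRange d ∧ d 0 = y₀ := by
  have : Nonempty Y := ⟨y₀⟩
  let d : ℕ → Y := fun n => Nat.casesOn n y₀ (TopologicalSpace.denseSeq Y)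
  refine ⟨d, (TopologicalSpace.denseRange_denseSeq Y).mono ?_, rfl⟩
  rintro _ ⟨n, rfl⟩
  exact ⟨n + 1, rfl⟩

/-- The rule is built from `Y`, `α` and the codes of `X` alone; the process and the comparator `h`
enter only through the existence of good labelings for the countable-valued maps `κ n ∘ h`, which
approximate `h` on the balls about `y₀`. -/
theorem exists_universallyConsistent_on_SMV {X Y : Type*} [MeasurableSpace X]
    [MeasurableSpace.CountablyGenerated X] [MeasurableSpace.SeparatesPoints X] [MetricSpace Y]
    [SecondCountableTopology Y] [MeasurableSpace Y] [BorelSpace Y] [Nonempty Y] {α : ℝ}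
    (hα : 1 ≤ α) (hball : ∀ (y : Y) (r : ℝ), 0 < r → FTiME (lossBall α y r) α) :
    ∃ f : OnlineRule X Y, ∀ μ ∈ SMV X, IsUniversallyConsistent α f μ := by
  have hα0 : 0 < α := by linarith
  obtain ⟨d, hd, -⟩ := exists_denseRange_zero (Classical.arbitrary Y)
  set y₀ := d 0 with hy₀
  have hR : ∀ n : ℕ, (0 : ℝ) < (n : ℝ) + 1 := fun n => by positivity
  have hε : ∀ n : ℕ, (0 : ℝ) < 1 / ((n : ℝ) + 1) := fun n => by positivity
  choose σ hσs hσr using fun n : ℕ => exists_ball_strategy (X := X) hα0 (hR n)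
    (hball y₀ (((n : ℝ) + 1) ^ α) (Real.rpow_pos_of_pos (hR n) α)) hd (hε n)
  let v : ℕ → ℕ → Y := clippedValue α y₀ d
  let g : ℕ → ℕ → Y → ℝ := fun t k y => clippedLoss α y₀ t (v t k, y)
  have hg : ∀ t k, Measurable (g t k) := fun t k =>
    (measurable_clippedLoss α y₀ t).comp measurable_prodMk_left
  obtain ⟨ρ, hρ⟩ := exists_strategy_le_seq σ hg (K := 2 ^ α) (by positivity) fun t k y =>
    clippedLoss_le hα0 (dist_clippedValue_le α y₀ d t k)
  obtain ⟨f, hfv, hfm⟩ := exists_rule_of_strategy ρ y₀ v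
  have hfd : ∀ t r x y, dist y₀ (f.prediction t r x y) ≤ horizon α t := fun t r x y => by
    obtain ⟨k, hk⟩ := hfv t r x y
    rw [hk]
    exact dist_clippedValue_le α y₀ d t k
  refine ⟨f, fun μ hμ Ω _ P _ x y r hadv hlaw hemp h hh => ?_⟩
  obtain ⟨z, hz⟩ := hemp
  -- Countably many tolerances suffice, so one null set serves them all.
  have htail := ae_all_iff.2 fun m : ℕ => hz (1 / ((m : ℝ) + 1)) (hε m)
  have hdev := ae_tendsto_deviation hadv (measurable_clippedLoss α y₀) (K := 2 ^ α)
    fun t r x y z => by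
      rw [abs_of_nonneg (clippedLoss_nonneg _ _ _ _)]
      exact clippedLoss_le hα0 (hfd t r x y)
  have hunif : ∀ n : ℕ, ∃ δ, 0 < δ ∧ δ ≤ 1 ∧ ∀ a b y : Y, dist a b < δ →
      dist a y ≤ 2 * ((n : ℝ) + 1) → dist b y ≤ 2 * ((n : ℝ) + 1) →
        loss α a y ≤ loss α b y + 1 / ((n : ℝ) + 1) := fun n =>
    exists_loss_le_add hα0 _ (hε n)
  choose δ hδ _ hδl using hunif
  choose κ hκ hκR hκδ hκ0 using fun n : ℕ => exists_ball_index hd (hR n) (hδ n)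
  have hmx : Measurable fun ω t => x t ω := measurable_pi_lambda _ hadv.measurable_X
  have hexp : ∀ᵐ ω ∂P, ∀ n, ∃ e, IsGoodExpert (fun w => κ n (h w)) (fun t => x t ω) e := by
    refine ae_all_iff.2 fun n => ?_
    have h1 := exists_goodExpert hμ ((hκ n).comp hh)
    rw [← hlaw] at h1
    exact ae_of_ae_map hmx.aemeasurable h1
  filter_upwards [htail, hdev, hexp] with ω htail hdev hexp
  set xs : ℕ → X := fun t => x t ω
  set ys : ℕ → Y := fun t => y t ω
  set rs : ℕ → f.R := fun t => r t ω
  refine limsup_average_le_zero fun ε hε0 => ?_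
  set C : ℝ := 2 ^ α + 3 ^ α + 1 with hC
  have hCpos : 0 < C := by positivity
  -- Six errors of `ε / 6` each: the finitely many early steps, the tail, the discretization of `h`,
  -- the regret on the ball, the aggregation over balls and the random deviations.
  obtain ⟨N, hN⟩ := exists_sum_tailLoss_le hα htail y₀ (show 0 < ε / 6 / C by positivity)
  obtain ⟨n₁, hn₁⟩ := exists_nat_one_div_lt (show 0 < ε / 6 by linarith)
  obtain ⟨n₂, hn₂⟩ := exists_nat_ge (2 * N)
  set n := max n₁ n₂
  have hnε : 1 / ((n : ℝ) + 1) ≤ ε / 6 := by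
    refine le_trans ?_ hn₁.le
    have : (n₁ : ℝ) ≤ n := by exact_mod_cast le_max_left _ _
    gcongr
  -- The tail enters at half the radius of the ball.
  have hnN : N ≤ ((n : ℝ) + 1) / 2 := by
    have : (n₂ : ℝ) ≤ n := by exact_mod_cast le_max_right _ _
    linarith
  obtain ⟨e, he⟩ := hexp n
  have hlev := hσr n xs ys (fun w => κ n (h w)) e (fun w => hκR n _) he
  have hpt : ∀ᶠ t in atTop,
      loss α (f.prediction t (rs t) xs ys) (ys t) - loss α (h (xs t)) (ys t) ≤
        deviation f (clippedLoss α y₀) t (rs t, (xs, ys)) +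
        (ρ.lossAt g t ((), (xs, ys)) - (σ n).lossAt g t ((), (xs, ys))) +
        (if dist y₀ (ys t) < (n : ℝ) + 1 then
          expLoss ((σ n).w t ((), (xs, ys))) (fun k => loss α (d k) (ys t)) -
            loss α (d (κ n (h (xs t)))) (ys t) else 0) + 1 / ((n : ℝ) + 1) +
        C * tailLoss α y₀ (((n : ℝ) + 1) / 2) (ys t) := by
    filter_upwards [(tendsto_horizon hα0).eventually_ge_atTop ((n : ℝ) + 1 + 1)] with t ht
    have h1 := loss_sub_loss_le hα0 (y₀ := y₀) (d := d) (t := t) (R := (n : ℝ) + 1)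
      (ε := 1 / ((n : ℝ) + 1)) (by
        have : (0 : ℝ) ≤ n := Nat.cast_nonneg n
        linarith) (hε n).le ht (hfd t (rs t) xs ys) ((σ n).tsum_w t ((), (xs, ys)))
      (hσs n t _) (i := κ n (h (xs t))) (a := h (xs t)) (y := ys t) (fun h2 h3 => by
        refine hδl n _ _ _ (hκδ n _ h3) ?_ ?_
        · have := dist_triangle_left (d (κ n (h (xs t)))) (ys t) y₀
          have := hκR n (h (xs t))
          linarith
        · have := dist_triangle_left (h (xs t)) (ys t) y₀
          linarith) fun h2 => by rw [hκ0 n _ h2]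
    have h2 : ∫ u, clippedLoss α y₀ t (f.prediction t u xs ys, ys t) ∂f.law t =
        ρ.lossAt g t ((), (xs, ys)) :=
      hfm t xs ys (fun p => clippedLoss α y₀ t (p, ys t)) fun p => clippedLoss_nonneg _ _ _ _
    have h3 : deviation f (clippedLoss α y₀) t (rs t, (xs, ys)) =
        clippedLoss α y₀ t (f.prediction t (rs t) xs ys, ys t) - ρ.lossAt g t ((), (xs, ys)) := by
      rw [← h2]
      rfl
    have h4 : (σ n).lossAt g t ((), (xs, ys)) = expLoss ((σ n).w t ((), (xs, ys)))
        fun k => clippedLoss α y₀ t (clippedValue α y₀ d t k, ys t) := rfl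
    rw [h3, h4]
    linarith
  obtain ⟨K, hK⟩ := exists_sum_le_of_eventually_le hpt
  have hKev : ∀ᶠ T : ℕ in atTop, K ≤ ε / 6 * T :=
    (tendsto_natCast_atTop_atTop.const_mul_atTop (by linarith)).eventually_ge_atTop K
  filter_upwards [hKev, hN _ hnN, hlev, hρ n (xs, ys) (ε / 6) (by linarith),
    hdev.eventually (gt_mem_nhds (show 0 < ε / 6 by linarith)), eventually_gt_atTop 0] with T h1 h2 h3
    h4 h5 h6
  have hT : (0 : ℝ) < T := by exact_mod_cast h6
  have h7 := hK T
  simp only [Finset.sum_add_distrib, Finset.sum_sub_distrib, ← Finset.mul_sum, Finset.sum_const,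
    Finset.card_range, nsmul_eq_mul] at h7
  simp only [Finset.sum_sub_distrib]
  rw [one_div_mul_eq_div, div_lt_iff₀ hT] at h5
  have h8 : C * ∑ t ∈ Finset.range T, tailLoss α y₀ (((n : ℝ) + 1) / 2) (ys t) ≤ ε / 6 * T := by
    calc _ ≤ C * (ε / 6 / C * T) := mul_le_mul_of_nonneg_left h2 hCpos.le
      _ = _ := by field_simp
  have h9 : (T : ℝ) * (1 / ((n : ℝ) + 1)) ≤ ε / 6 * T := by
    rw [mul_comm]
    exact mul_le_mul_of_nonneg_right hnε hT.le
  have h10 : 1 / ((n : ℝ) + 1) * T ≤ ε / 6 * T := mul_le_mul_of_nonneg_right hnε hT.le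
  change ∑ t ∈ Finset.range T, ρ.lossAt g t ((), (xs, ys)) ≤
    ∑ t ∈ Finset.range T, (σ n).lossAt g t ((), (xs, ys)) + _ at h4
  linarith

end AdvRegression

theorem mainTheorem1 {𝓧 𝓨 : Type*}
    [MetricSpace 𝓧] [TopologicalSpace.SeparableSpace 𝓧] [MeasurableSpace 𝓧] [BorelSpace 𝓧]
    [MetricSpace 𝓨] [TopologicalSpace.SeparableSpace 𝓨] [MeasurableSpace 𝓨] [BorelSpace 𝓨]
    [Nontrivial 𝓨] (α : ℝ) (hα : 1 ≤ α)
    (hball : ∀ (y : 𝓨) (r : ℝ), 0 < r → FTiME (lossBall α y r) α) :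
    SOLAR 𝓧 𝓨 α = SMV 𝓧 ∧
      ∃ f : OnlineRule 𝓧 𝓨, IsOptimisticallyUniversal α f ∧
        ∀ μ ∈ SMV 𝓧, IsUniversallyConsistent α f μ := by
  have : SecondCountableTopology 𝓧 := UniformSpace.secondCountable_of_separable 𝓧
  have : SecondCountableTopology 𝓨 := UniformSpace.secondCountable_of_separable 𝓨
  obtain ⟨f, hf⟩ := exists_universallyConsistent_on_SMV (X := 𝓧) hα hball
  have hsub : SOLAR 𝓧 𝓨 α ⊆ SMV 𝓧 := SOLAR_subset_SMV hα
  exact ⟨hsub.antisymm fun μ hμ => ⟨f, hf μ hμ⟩, f, fun μ hμ => hf μ (hsub hμ), hf⟩
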